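/- **Setting.** Let $\mathcal A\subset\{0,1\}^d$ be a set of at least two actions, let $m=\max_{A\in\mathcal A}\|A\|_1\ge 2$, and suppose that every item $i\in[d]$ belongs to some action. In round $t=1,2,\dots$ a learner selects $A(t)\in\mathcal A$, observes $A(t)\odot X(t)$ and obtains the reward $A(t)^\top X(t)$. The vectors $X(t)\in\mathbb R^d$ are i.i.d. with mean $\mu^\star$ and independent entries, and they are $\sigma^2$-subgaussian with $\sigma>0$: $\mathbb E[e^{\ell^\top X(t)}]\le e^{\ell^\top\mu^\star+\|\ell\|_2^2\sigma^2/2}$ for all $\ell\in\mathbb R^d$. The maximizer $A^\star$ of $A^\top\mu^\star$ over $\mathcal A$ is unique. Put $\Delta_A=(A^\star-A)^\top\mu^\star$, $\Delta_{\min}=\min_{A\in\mathcal A:\Delta_A>0}\Delta_A$, $\Delta_{\max}=\max_{A\in\mathcal A}\Delta_A$, and $R(T,\mu^\star)=T\,{A^\star}^\top\mu^\star-\mathbb E\big[\sum_{t=1}^T A(t)^\top\mu^\star\big]$. **Algorithm.** BG-CTS (boosted Gaussian combinatorial Thompson sampling) with parameter $\lambda>0$ first plays a fixed sequence of at most $d$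 actions of $\mathcal A$ that together contain every item. In every later round $t$, let $N_i(t)$ be the number of earlier rounds whose action contains item $i$ and $\hat\mu_i(t)$ the average of the rewards observed for item $i$ in them. The algorithm computes $$\theta_i(t)=\hat\mu_i(t)+\sigma\sqrt{\tfrac{2g(t)}{N_i(t)}}\,Z_i(t)\quad(i\in[d]),\qquad g(t)=\frac{f(t)}{\ln t},\qquad f(t)=(1+\lambda)\Big(\ln t+(m+2)\ln\ln t+\tfrac m2\ln\big(1+\tfrac e\lambda\big)\Big),$$ where the $Z(t)$ are i.i.d. $\mathcal N(0,I_d)$ and independent of $(X(t))_{t\ge1}$, and plays some $A(t)\in\arg\max_{A\in\mathcal A}A^\top\theta(t)$. **Theorem 1.** There are universal constants $C,C'>0$ and a real polynomial $P$ in five variables, with universal coefficients, such that for every instance as above and every $T\ge 2$, BG-CTS with $\lambda=1$ satisfies $$R(T,\mu^\star)\le C\,\frac{\sigma^2 d\ln m}{\Delta_{\min}}\ln T+C'\,\frac{\sigma^2d^2m\ln m}{\Delta_{\min}}\ln\ln T+P\Big(m,d,\frac1{\Delta_{\min}},\Delta_{\max},\sigma\Big).$$ In particular the bound has no exponential dependence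 on $m$. -/

import Mathlib

open MeasureTheory ProbabilityTheory

namespace SemiBandit

/-! An action, i.e. a binary vector of length `d`, is identified with its support, a
`Finset (Fin d)`; the action set is a `Finset (Finset (Fin d))`. -/

/-- The linear value of an action `a` (the inner product of its binary vector with `v`). -/
def value {d : ℕ} (v : Fin d → ℝ) (a : Finset (Fin d)) : ℝ := ∑ i ∈ a, v i

/-- The maximal size `m` of an action. -/
def maxSize {d : ℕ} (𝒜 : Finset (Finset (Fin d))) : ℕ := 𝒜.sup Finset.card

/-- The largest expected reward of an action. -/
noncomputable def optValue {d : ℕ} (𝒜 : Finset (Finset (Fin d))) (μ : Fin d → ℝ) : ℝ :=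
  sSup (value μ '' (𝒜 : Set (Finset (Fin d))))

/-- The reward gap of an action. -/
noncomputable def gap {d : ℕ} (𝒜 : Finset (Finset (Fin d))) (μ : Fin d → ℝ)
    (a : Finset (Fin d)) : ℝ :=
  optValue 𝒜 μ - value μ a

/-- The minimal positive reward gap (the infimum of a finite set; it is a minimum as soon as
there is a suboptimal action). -/
noncomputable def minGap {d : ℕ} (𝒜 : Finset (Finset (Fin d))) (μ : Fin d → ℝ) : ℝ :=
  sInf (gap 𝒜 μ '' {a | a ∈ 𝒜 ∧ 0 < gap 𝒜 μ a})

/-- The maximal reward gap. -/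
noncomputable def maxGap {d : ℕ} (𝒜 : Finset (Finset (Fin d))) (μ : Fin d → ℝ) : ℝ :=
  sSup (gap 𝒜 μ '' (𝒜 : Set (Finset (Fin d))))

/-- The optimal action is unique. -/
def UniqueOptimal {d : ℕ} (𝒜 : Finset (Finset (Fin d))) (μ : Fin d → ℝ) : Prop :=
  ∃! a, a ∈ 𝒜 ∧ ∀ b ∈ 𝒜, value μ b ≤ value μ a

/-- A maximization oracle over `𝒜`: it returns an element of `argmax_{a ∈ 𝒜} ⟨a, θ⟩`
(ties are broken in an arbitrary measurable way). -/
structure IsArgmaxOracle {d : ℕ} (𝒜 : Finset (Finset (Fin d)))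
    (sel : (Fin d → ℝ) → Finset (Fin d)) : Prop where
  mem : ∀ θ, sel θ ∈ 𝒜
  le : ∀ θ, ∀ b ∈ 𝒜, value θ b ≤ value θ (sel θ)
  measurable : ∀ a, MeasurableSet {θ | sel θ = a}

/-- An initialization: at most `d` actions that together contain every item. -/
structure IsInitialization {d : ℕ} (𝒜 : Finset (Finset (Fin d)))
    (init : List (Finset (Fin d))) : Prop where
  mem : ∀ a ∈ init, a ∈ 𝒜
  length_le : init.length ≤ d
  cover : ∀ i : Fin d, ∃ a ∈ init, i ∈ a

/-- The exploration function `f(t)`. -/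
noncomputable def explore (lam : ℝ) (m : ℕ) (t : ℝ) : ℝ :=
  (1 + lam) * (Real.log t + (m + 2) * Real.log (Real.log t)
    + m / 2 * Real.log (1 + Real.exp 1 / lam))

/-- The exploration boost `g(t) = f(t) / ln t`. -/
noncomputable def boost (lam : ℝ) (m : ℕ) (t : ℝ) : ℝ := explore lam m t / Real.log t

/-- What the learner remembers of the past observations: for every item, how many times it was
selected and the sum of the rewards that were observed for it. -/
structure Stats (d : ℕ) where
  count : Fin d → ℕ
  total : Fin d → ℝ

/-- The statistics before the first round. -/
def Stats.empty (d : ℕ) : Stats d := ⟨fun _ => 0, fun _ => 0⟩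

/-- The empirical mean of an item. -/
noncomputable def Stats.mean {d : ℕ} (s : Stats d) (i : Fin d) : ℝ := s.total i / s.count i

/-- Playing `a` when the reward vector is `x` reveals the entries `x i`, `i ∈ a`. -/
noncomputable def Stats.update {d : ℕ} (s : Stats d) (a : Finset (Fin d)) (x : Fin d → ℝ) :
    Stats d :=
  ⟨fun i => if i ∈ a then s.count i + 1 else s.count i,
   fun i => if i ∈ a then s.total i + x i else s.total i⟩

/-- The Thompson sample in round number `t`, from the statistics `s` of the previous rounds and
the Gaussian vector `z`. -/
noncomputable def thompson {d : ℕ} (lam σ : ℝ) (m : ℕ) (t : ℕ) (s : Stats d) (z : Fin d → ℝ) :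
    Fin d → ℝ :=
  fun i => s.mean i + σ * Real.sqrt (2 * boost lam m t / s.count i) * z i

/-- The action of BG-CTS in round number `t + 1`, given the statistics `s` of the rounds
`1, …, t` and the Gaussian vector `z` of round `t + 1`: the next action of the initialization
while there is one, afterwards an action maximizing the Thompson sample. -/
noncomputable def choose {d : ℕ} (𝒜 : Finset (Finset (Fin d))) (lam σ : ℝ)
    (sel : (Fin d → ℝ) → Finset (Fin d)) (init : List (Finset (Fin d)))
    (t : ℕ) (s : Stats d) (z : Fin d → ℝ) : Finset (Fin d) :=
  match init[t]? with
  | some a => a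
  | none => sel (thompson lam σ (maxSize 𝒜) (t + 1) s z)

/-- The statistics after `t` rounds of BG-CTS on the reward vectors `x 0, x 1, …` with the
Gaussian vectors `z 0, z 1, …` (`x t` and `z t` belong to round number `t + 1`). -/
noncomputable def stats {d : ℕ} (𝒜 : Finset (Finset (Fin d))) (lam σ : ℝ)
    (sel : (Fin d → ℝ) → Finset (Fin d)) (init : List (Finset (Fin d)))
    (x z : ℕ → Fin d → ℝ) : ℕ → Stats d
  | 0 => Stats.empty d
  | t + 1 =>
    (stats 𝒜 lam σ sel init x z t).update
      (choose 𝒜 lam σ sel init t (stats 𝒜 lam σ sel init x z t) (z t)) (x t)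

/-- The action played by BG-CTS in round number `t + 1`. -/
noncomputable def action {d : ℕ} (𝒜 : Finset (Finset (Fin d))) (lam σ : ℝ)
    (sel : (Fin d → ℝ) → Finset (Fin d)) (init : List (Finset (Fin d)))
    (x z : ℕ → Fin d → ℝ) (t : ℕ) : Finset (Fin d) :=
  choose 𝒜 lam σ sel init t (stats 𝒜 lam σ sel init x z t) (z t)

/-- The regret of BG-CTS after `T` rounds. -/
noncomputable def regret {d : ℕ} {Ω : Type*} [MeasurableSpace Ω] (P : Measure Ω)
    (𝒜 : Finset (Finset (Fin d))) (μ : Fin d → ℝ) (lam σ : ℝ)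
    (sel : (Fin d → ℝ) → Finset (Fin d)) (init : List (Finset (Fin d)))
    (X Z : ℕ → Ω → Fin d → ℝ) (T : ℕ) : ℝ :=
  T * optValue 𝒜 μ
    - ∫ ω, ∑ t ∈ Finset.range T,
        value μ (action 𝒜 lam σ sel init (fun s => X s ω) (fun s => Z s ω) t) ∂P

/-- The reward vectors are i.i.d. with independent entries, have mean `μ`, and are
`σ²`-subgaussian. -/
structure IsRewardProcess {d : ℕ} {Ω : Type*} [MeasurableSpace Ω] (P : Measure Ω)
    (μ : Fin d → ℝ) (σ : ℝ) (X : ℕ → Ω → Fin d → ℝ) : Prop where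
  measurable : ∀ t, Measurable (X t)
  indep : iIndepFun (fun (p : ℕ × Fin d) ω => X p.1 ω p.2) P
  ident : ∀ t i, IdentDistrib (fun ω => X t ω i) (fun ω => X 0 ω i) P P
  integrable : ∀ t i, Integrable (fun ω => X t ω i) P
  mean : ∀ t i, ∫ ω, X t ω i ∂P = μ i
  integrable_exp : ∀ t (l : Fin d → ℝ), Integrable (fun ω => Real.exp (∑ i, l i * X t ω i)) P
  subgaussian : ∀ t (l : Fin d → ℝ),
    ∫ ω, Real.exp (∑ i, l i * X t ω i) ∂P
      ≤ Real.exp (∑ i, l i * μ i + (∑ i, l i ^ 2) * σ ^ 2 / 2)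

/-- The vectors `Z t` are i.i.d. standard Gaussian vectors. -/
structure IsGaussianProcess {d : ℕ} {Ω : Type*} [MeasurableSpace Ω] (P : Measure Ω)
    (Z : ℕ → Ω → Fin d → ℝ) : Prop where
  measurable : ∀ t, Measurable (Z t)
  indep : iIndepFun (fun (p : ℕ × Fin d) ω => Z p.1 ω p.2) P
  law : ∀ t i, P.map (fun ω => Z t ω i) = gaussianReal 0 1

end SemiBandit

/-! Rounds are good or bad. Good rounds produce the logarithmic terms of the bound, and the expected
number of bad rounds is polynomial in the parameters.

A round is good when the squared norm of its Gaussian vector is at most `radius`, of order `ln t +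
d`, when the items of the optimal action have been played often and are well estimated, and when the
items of the played action are well estimated. The sample of the optimal action is then within
`Δ_min / 4` of its mean, so a suboptimal action can only win through its own Gaussian noise. By
Cauchy–Schwarz its gap `x` satisfies `x² ≤ L ∑ 1 / N_i`, with `L` of order `σ² (ln T + m ln ln T + d
m)`. The function `charge` splits such a gap over the items of the action (`le_sum_charge`), and one
item pays in total at most a constant times `(L / Δ_min) ln m` over all its plays (`sum_charge_le`).

Bad rounds are of several kinds. Early rounds and rounds with large Gaussian vectors are few.
Playing a badly estimated item adds an observation of it, so the expected number of such rounds is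
bounded per item (`sum_measure_play_dev_le`). It remains to show that the items of the optimal
action are rarely short of observations (`measure_count_lt_le`), and this is where an exponential
dependence on `m` could enter.

The boost prevents it. A self-normalized inequality for the optimal action alone, by a union bound
over a product of geometric grids, shows that its empirical value is rarely lower than its mean by
more than `σ √(2 · (4/3) f(t) · ∑ 1 / N_i)`; the term `m ln ln t` in `f` pays for the grid. Its
sample has standard deviation `σ √(2 g(t) ∑ 1 / N_i)`, so as `f = g ln t` the noise compensates the
error as soon as one standard Gaussian exceeds `√((4/3) ln t)`. This has probability at least a
constant times `t^(-3/4)`, whatever `m` is (`optimism`). Hence about `t^(1/4)` rounds of the window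
`[t/2, t)` are optimistic. In an optimistic round either the optimal action is played or some item
with few observations gains one, or else accurate samples would contradict the argmax. As `t^(1/4)`
exceeds `(d + 1) t^(1/8)` for late `t`, every item of the optimal action reaches about `t^(1/8)`
observations with high probability. -/

namespace SemiBandit

/-! ### Charging the regret of a round to the items of its action -/

/-- The part of the regret of a round that is charged to an item played `n` times before. -/
noncomputable def charge (L D : ℝ) (m n : ℕ) : ℝ :=
  if (n : ℝ) ≤ L / D ^ 2 then 2 * √(L / n)
  else if (n : ℝ) ≤ 2 * m * L / D ^ 2 then 2 * L / (D * n) else 0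

lemma charge_nonneg {L D : ℝ} (hL : 0 ≤ L) (hD : 0 ≤ D) (m n : ℕ) : 0 ≤ charge L D m n := by
  unfold charge
  split_ifs <;> positivity

/-- An item with `N i ≤ L / x²` pays for all of `x` alone. If there is none, each `1 / N i` is at
most `x / (2L)` times its charge plus a share `x² / (2mL)`; the at most `m` shares use up half of
`x²` and are absorbed on the left. Beyond the cutoff `2mL / D²` the share suffices, so that the
charge can vanish there. -/
lemma le_sum_charge {ι : Type*} {a : Finset ι} {N : ι → ℕ} {L D x : ℝ} {m : ℕ} (hL : 0 < L)
    (hD : 0 < D) (hDx : D ≤ x) (hN : ∀ i ∈ a, 1 ≤ N i) (ha : a.card ≤ m)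
    (h : x ^ 2 ≤ L * ∑ i ∈ a, (1 : ℝ) / N i) : x ≤ ∑ i ∈ a, charge L D m (N i) := by
  have hx : 0 < x := hD.trans_le hDx
  by_cases hsmall : ∃ i ∈ a, (N i : ℝ) ≤ L / x ^ 2
  · obtain ⟨i, hi, hNi⟩ := hsmall
    have hNpos : (0 : ℝ) < N i := by exact_mod_cast hN i hi
    have h1 : charge L D m (N i) = 2 * √(L / N i) := by
      unfold charge
      rw [if_pos]
      exact hNi.trans (by gcongr)
    have h2 : x ≤ √(L / N i) := by
      apply Real.le_sqrt_of_sq_le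
      rw [le_div_iff₀ hNpos]
      rw [le_div_iff₀ (by positivity)] at hNi
      linarith
    have h3 := Finset.single_le_sum (f := fun i => charge L D m (N i))
      (fun j _ => charge_nonneg hL.le hD.le m (N j)) hi
    have h4 : 0 ≤ √(L / N i) := Real.sqrt_nonneg _
    simp only [h1] at h3
    linarith
  · push Not at hsmall
    have hm : (0 : ℝ) < m := by
      rcases Finset.eq_empty_or_nonempty a with rfl | hne
      · simp at h
        nlinarith
      · exact_mod_cast hne.card_pos.trans_le ha
    have key : ∀ i ∈ a, (1 : ℝ) / N i
        ≤ x / (2 * L) * charge L D m (N i) + x ^ 2 / (2 * m * L) := by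
      intro i hi
      have hNpos : (0 : ℝ) < N i := by exact_mod_cast hN i hi
      have h0 : 0 ≤ x ^ 2 / (2 * m * L) := by positivity
      have hxN : L / N i < x ^ 2 := by
        have := hsmall i hi
        rw [div_lt_iff₀ (by positivity)] at this
        rw [div_lt_iff₀ hNpos]
        linarith
      unfold charge
      split_ifs with h1 h2
      · have hs : √(L / N i) ≤ x := Real.sqrt_le_iff.2 ⟨hx.le, hxN.le⟩
        have hs2 : √(L / N i) * √(L / N i) = L / N i := Real.mul_self_sqrt (by positivity)
        have : (1 : ℝ) / N i = 1 / L * (√(L / N i) * √(L / N i)) := by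
          rw [hs2]; field_simp
        have h5 : √(L / N i) * √(L / N i) ≤ x * √(L / N i) := by gcongr
        calc (1 : ℝ) / N i = 1 / L * (√(L / N i) * √(L / N i)) := this
          _ ≤ 1 / L * (x * √(L / N i)) := by gcongr
          _ = x / (2 * L) * (2 * √(L / N i)) := by field_simp
          _ ≤ _ := le_add_of_nonneg_right h0
      · calc (1 : ℝ) / N i ≤ (x / D) * (1 / N i) := by
              have : 1 ≤ x / D := by rwa [one_le_div hD]
              have h6 : (0 : ℝ) ≤ 1 / N i := by positivity
              nlinarith
          _ = x / (2 * L) * (2 * L / (D * N i)) := by field_simp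
          _ ≤ _ := le_add_of_nonneg_right h0
      · have h3 : 2 * m * L / x ^ 2 ≤ N i := by
          refine le_trans ?_ (not_le.1 h2).le
          gcongr
        rw [div_le_iff₀ (by positivity)] at h3
        rw [mul_zero, zero_add, div_le_div_iff₀ hNpos (by positivity)]
        linarith
    have hsum := Finset.sum_le_sum key
    rw [Finset.sum_add_distrib, ← Finset.mul_sum, Finset.sum_const, nsmul_eq_mul] at hsum
    have hcard : (a.card : ℝ) * (x ^ 2 / (2 * m * L)) ≤ x ^ 2 / (2 * L) := by
      calc (a.card : ℝ) * (x ^ 2 / (2 * m * L)) ≤ m * (x ^ 2 / (2 * m * L)) := by gcongr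
        _ = _ := by field_simp
    set Sc := ∑ i ∈ a, charge L D m (N i)
    have h7 : x ^ 2 ≤ L * (x / (2 * L) * Sc + x ^ 2 / (2 * L)) :=
      h.trans (mul_le_mul_of_nonneg_left (by linarith) hL.le)
    have h8 : L * (x / (2 * L) * Sc + x ^ 2 / (2 * L)) = x * Sc / 2 + x ^ 2 / 2 := by
      field_simp
    rw [h8] at h7
    have h9 : x * x ≤ x * Sc := by nlinarith
    exact le_of_mul_le_mul_left h9 hx

lemma sum_one_div_sqrt_le (n : ℕ) : ∑ k ∈ Finset.Icc 1 n, 1 / √(k : ℝ) ≤ 2 * √n := by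
  induction n with
  | zero => simp
  | succ n ih =>
    rw [Finset.sum_Icc_succ_top (by omega)]
    push_cast
    have h1 : 0 < √((n : ℝ) + 1) := Real.sqrt_pos.2 (by positivity)
    have h2 : √((n : ℝ) + 1) * √((n : ℝ) + 1) = n + 1 := Real.mul_self_sqrt (by positivity)
    have h3 : √(n : ℝ) * √(n : ℝ) = n := Real.mul_self_sqrt (by positivity)
    have h4 : 0 ≤ √(n : ℝ) := Real.sqrt_nonneg _
    have : 1 / √((n : ℝ) + 1) ≤ 2 * √((n : ℝ) + 1) - 2 * √n := by
      rw [div_le_iff₀ h1]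
      nlinarith [sq_nonneg (√((n : ℝ) + 1) - √n)]
    linarith

lemma sum_one_div_Ioc_le (p q : ℕ) (h : p + 1 ≤ q) :
    ∑ k ∈ Finset.Ioc p q, 1 / (k : ℝ) ≤ 1 + Real.log q - Real.log (p + 1) := by
  induction q, h using Nat.le_induction with
  | base =>
    simp only [Nat.Ioc_succ_singleton, Finset.sum_singleton]
    push_cast
    rw [add_sub_cancel_right, div_le_one (by positivity)]
    have : (0 : ℝ) ≤ p := by positivity
    linarith
  | succ q hq ih =>
    rw [Finset.sum_Ioc_succ_top (by omega)]
    have hq0 : (0 : ℝ) < q := by exact_mod_cast (by omega : 0 < q)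
    have h1 := Real.log_le_sub_one_of_pos (x := (q : ℝ) / (q + 1)) (by positivity)
    rw [Real.log_div (by positivity) (by positivity)] at h1
    have h2 : (q : ℝ) / (q + 1) - 1 = - (1 / (q + 1)) := by field_simp; ring
    push_cast
    linarith

/-- The square-root regime contributes `4L / D`. The harmonic regime lies between two cutoffs of
ratio `2m`, so its logarithm is that of `m` and not of `T`. The constants are absorbed by `ln m ≥ ln
2`. -/
lemma sum_charge_le {L D : ℝ} (hL : 0 < L) (hD : 0 < D) {m : ℕ} (hm : 2 ≤ m) (T : ℕ) :
    ∑ n ∈ Finset.Icc 1 T, charge L D m n ≤ 13 * (L / D) * Real.log m := by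
  have hm' : (2 : ℝ) ≤ m := by exact_mod_cast hm
  set x := L / D ^ 2 with hx
  have hx0 : 0 < x := by positivity
  set y := 2 * m * L / D ^ 2 with hy
  have hyx : y = 2 * m * x := by rw [hy, hx]; ring
  have hxy : x ≤ y := by rw [hyx]; nlinarith
  have hlog2 : 1 / 2 ≤ Real.log m :=
    (by linarith [Real.log_two_gt_d9] : (1 / 2 : ℝ) ≤ Real.log 2).trans
      (Real.log_le_log (by norm_num) hm')
  have h1 : ∑ n ∈ Finset.Icc 1 ⌊x⌋₊, 2 * √(L / n) ≤ 4 * (L / D) := by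
    calc ∑ n ∈ Finset.Icc 1 ⌊x⌋₊, 2 * √(L / n)
        = 2 * √L * ∑ n ∈ Finset.Icc 1 ⌊x⌋₊, 1 / √(n : ℝ) := by
          rw [Finset.mul_sum]
          refine Finset.sum_congr rfl fun n _ => ?_
          rw [Real.sqrt_div hL.le]; ring
      _ ≤ 2 * √L * (2 * √x) := by
          gcongr
          refine (sum_one_div_sqrt_le _).trans ?_
          gcongr
          exact Nat.floor_le hx0.le
      _ = 4 * (L / D) := by
          rw [hx, Real.sqrt_div hL.le, Real.sqrt_sq hD.le]
          have := Real.mul_self_sqrt hL.le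
          field_simp
          linarith
  have h2 : ∑ n ∈ Finset.Ioc ⌊x⌋₊ ⌊y⌋₊, 2 * L / (D * n)
      ≤ 2 * (L / D) * (1 + Real.log 2 + Real.log m) := by
    have h3 : ∑ n ∈ Finset.Ioc ⌊x⌋₊ ⌊y⌋₊, (1 : ℝ) / n ≤ 1 + Real.log 2 + Real.log m := by
      rcases Nat.lt_or_ge ⌊x⌋₊ ⌊y⌋₊ with hlt | hge
      · refine (sum_one_div_Ioc_le _ _ hlt).trans ?_
        have h4 : Real.log ⌊y⌋₊ ≤ Real.log y := by
          apply Real.log_le_log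
          · exact_mod_cast (by omega : 0 < ⌊y⌋₊)
          · exact Nat.floor_le (by positivity)
        have h5 : Real.log x ≤ Real.log (⌊x⌋₊ + 1) :=
          Real.log_le_log hx0 (Nat.lt_floor_add_one x).le
        have h6 : Real.log y = Real.log 2 + Real.log m + Real.log x := by
          rw [hyx, Real.log_mul (by positivity) hx0.ne', Real.log_mul (by norm_num) (by positivity)]
        linarith
      · rw [Finset.Ioc_eq_empty_of_le hge, Finset.sum_empty]
        have := Real.log_two_gt_d9
        linarith
    calc ∑ n ∈ Finset.Ioc ⌊x⌋₊ ⌊y⌋₊, 2 * L / (D * n)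
        = 2 * (L / D) * ∑ n ∈ Finset.Ioc ⌊x⌋₊ ⌊y⌋₊, (1 : ℝ) / n := by
          rw [Finset.mul_sum]
          refine Finset.sum_congr rfl fun n _ => ?_
          ring
      _ ≤ _ := by gcongr
  have h3 : ∀ n ∈ Finset.Icc 1 T, charge L D m n
      ≤ (if n ∈ Finset.Icc 1 ⌊x⌋₊ then 2 * √(L / n) else 0)
        + (if n ∈ Finset.Ioc ⌊x⌋₊ ⌊y⌋₊ then 2 * L / (D * n) else 0) := by
    intro n hn
    rw [Finset.mem_Icc] at hn
    unfold charge
    rw [← hx, ← hy]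
    simp only [Finset.mem_Icc, Finset.mem_Ioc, hn.1, true_and, Nat.le_floor_iff hx0.le,
      Nat.floor_lt hx0.le, Nat.le_floor_iff (hx0.le.trans hxy)]
    by_cases h5 : (n : ℝ) ≤ x
    · rw [if_pos h5, if_pos h5, if_neg (by intro h; linarith [h.1]), add_zero]
    · rw [if_neg h5, if_neg h5, zero_add]
      by_cases h6 : (n : ℝ) ≤ y
      · rw [if_pos h6, if_pos ⟨not_le.1 h5, h6⟩]
      · rw [if_neg h6, if_neg (fun h => h6 h.2)]
  have h4 : ∀ (s : Finset ℕ) (f : ℕ → ℝ), (∀ n, 0 ≤ f n) →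
      ∑ n ∈ Finset.Icc 1 T, (if n ∈ s then f n else 0) ≤ ∑ n ∈ s, f n := by
    intro s f hf
    rw [← Finset.sum_filter]
    exact Finset.sum_le_sum_of_subset_of_nonneg
      (fun n hn => (Finset.mem_filter.1 hn).2) (fun n _ _ => hf n)
  refine (Finset.sum_le_sum h3).trans ?_
  rw [Finset.sum_add_distrib]
  refine (add_le_add (h4 _ _ fun n => by positivity) (h4 _ _ fun n => by positivity)).trans ?_
  refine (add_le_add h1 h2).trans ?_
  have hLD : 0 < L / D := by positivity
  have : Real.log 2 ≤ Real.log m := Real.log_le_log (by norm_num) hm'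
  have h69 := Real.log_two_gt_d9
  nlinarith

/-! ### Gaussian estimates -/

/-- On `[y, y + 1]` the density is at least its value at the right end. The lost factor of order
`e^(-y)` is harmless later. -/
lemma gaussian_tail_ge {y : ℝ} (hy : 0 ≤ y) :
    ENNReal.ofReal ((√(2 * Real.pi))⁻¹ * Real.exp (-(y + 1) ^ 2 / 2))
      ≤ gaussianReal 0 1 (Set.Ici y) := by
  rw [gaussianReal_apply 0 one_ne_zero]
  calc ENNReal.ofReal ((√(2 * Real.pi))⁻¹ * Real.exp (-(y + 1) ^ 2 / 2))
      = ∫⁻ _ in Set.Icc y (y + 1),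
          ENNReal.ofReal ((√(2 * Real.pi))⁻¹ * Real.exp (-(y + 1) ^ 2 / 2)) := by
        simp
    _ ≤ ∫⁻ x in Set.Icc y (y + 1), gaussianPDF 0 1 x := by
        refine setLIntegral_mono (measurable_gaussianPDF 0 1) fun x hx => ?_
        rw [gaussianPDF, gaussianPDFReal]
        apply ENNReal.ofReal_le_ofReal
        simp only [NNReal.coe_one, mul_one, sub_zero]
        gcongr
        · linarith [hx.1]
        · exact hx.2
    _ ≤ ∫⁻ x in Set.Ici y, gaussianPDF 0 1 x :=
        lintegral_mono_set Set.Icc_subset_Ici_self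

/-- The integral equals `√2`; the weaker bound `e` makes the product over `d` coordinates simply
`e^d`. -/
lemma lintegral_exp_sq_gaussian_le :
    ∫⁻ x, ENNReal.ofReal (Real.exp (x ^ 2 / 4)) ∂(gaussianReal 0 1)
      ≤ ENNReal.ofReal (Real.exp 1) := by
  rw [gaussianReal_of_var_ne_zero 0 one_ne_zero,
    lintegral_withDensity_eq_lintegral_mul _ (measurable_gaussianPDF 0 1) (by fun_prop)]
  have h1 : ∀ x : ℝ, (gaussianPDF 0 1 * fun x => ENNReal.ofReal (Real.exp (x ^ 2 / 4))) x
      = ENNReal.ofReal ((√(2 * Real.pi))⁻¹ * Real.exp (-(1 / 4) * x ^ 2)) := by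
    intro x
    simp only [Pi.mul_apply, gaussianPDF, gaussianPDFReal]
    rw [← ENNReal.ofReal_mul (by positivity), mul_assoc, ← Real.exp_add]
    congr 2
    · simp
    · congr 1
      simp
      ring
  simp_rw [h1]
  have hint : Integrable (fun x : ℝ => (√(2 * Real.pi))⁻¹ * Real.exp (-(1 / 4) * x ^ 2)) :=
    (integrable_exp_neg_mul_sq (by norm_num)).const_mul _
  rw [← ofReal_integral_eq_lintegral_ofReal hint (ae_of_all _ fun x => by positivity)]
  apply ENNReal.ofReal_le_ofReal
  rw [integral_const_mul, integral_gaussian]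
  have h2 : Real.pi / (1 / 4) = 2 * (2 * Real.pi) := by ring
  rw [h2, Real.sqrt_mul (by norm_num : (0 : ℝ) ≤ 2) (2 * Real.pi)]
  have h3 : 0 < √(2 * Real.pi) := Real.sqrt_pos.2 (by positivity)
  rw [mul_comm (√2), ← mul_assoc, inv_mul_cancel₀ h3.ne', one_mul]
  have h4 : √2 ≤ 2 := Real.sqrt_le_iff.2 ⟨by norm_num, by norm_num⟩
  linarith [Real.add_one_le_exp (1 : ℝ)]

end SemiBandit

namespace SemiBandit

/-! ### The information available to the learner -/

/-- Merging rewards and Gaussian variables into one independent family makes the σ-algebras of any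
two disjoint sets of driving variables independent. -/
lemma iIndepFun_sumElim {Ω ι κ β : Type*} [MeasurableSpace Ω] [MeasurableSpace β] {P : Measure Ω}
    {f : ι → Ω → β} {g : κ → Ω → β} (hf : iIndepFun f P) (hg : iIndepFun g P)
    (hfg : IndepFun (fun ω i => f i ω) (fun ω k => g k ω) P) :
    iIndepFun (Sum.elim f g) P := by
  rw [iIndepFun_iff_measure_inter_preimage_eq_mul]
  intro S sets hsets
  have h1 : (⋂ j ∈ S, Sum.elim f g j ⁻¹' sets j)
      = (⋂ i ∈ S.toLeft, f i ⁻¹' sets (.inl i)) ∩ ⋂ k ∈ S.toRight, g k ⁻¹' sets (.inr k) := by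
    ext ω
    simp only [Set.mem_iInter, Set.mem_inter_iff, Finset.mem_toLeft, Finset.mem_toRight,
      Sum.forall, Sum.elim_inl, Sum.elim_inr]
  have h2 : (⋂ i ∈ S.toLeft, f i ⁻¹' sets (.inl i))
      = (fun ω i => f i ω) ⁻¹' ⋂ i ∈ S.toLeft, (fun x => x i) ⁻¹' sets (.inl i) := by
    ext ω; simp
  have h3 : (⋂ k ∈ S.toRight, g k ⁻¹' sets (.inr k))
      = (fun ω k => g k ω) ⁻¹' ⋂ k ∈ S.toRight, (fun x => x k) ⁻¹' sets (.inr k) := by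
    ext ω; simp
  have hl : ∀ i ∈ S.toLeft, MeasurableSet (sets (.inl i)) := fun i hi =>
    hsets _ (Finset.mem_toLeft.1 hi)
  have hr : ∀ k ∈ S.toRight, MeasurableSet (sets (.inr k)) := fun k hk =>
    hsets _ (Finset.mem_toRight.1 hk)
  rw [h1, h2, h3, hfg.measure_inter_preimage_eq_mul _ _
      (Finset.measurableSet_biInter _ fun i hi => measurable_pi_apply i (hl i hi))
      (Finset.measurableSet_biInter _ fun k hk => measurable_pi_apply k (hr k hk)),
    ← h2, ← h3, hf.measure_inter_preimage_eq_mul S.toLeft hl,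
    hg.measure_inter_preimage_eq_mul S.toRight hr]
  conv_rhs => rw [← Finset.toLeft_disjSum_toRight (u := S), Finset.prod_disjSum]
  rfl

/-- The data of a run of BG-CTS with parameter `1`. -/
structure Setup (d : ℕ) (Ω : Type*) where
  /-- The set of actions. -/
  𝒜 : Finset (Finset (Fin d))
  /-- The mean rewards. -/
  μ : Fin d → ℝ
  /-- The subgaussian scale. -/
  σ : ℝ
  /-- The maximization oracle. -/
  sel : (Fin d → ℝ) → Finset (Fin d)
  /-- The initial actions. -/
  init : List (Finset (Fin d))
  /-- The reward vectors. -/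
  X : ℕ → Ω → Fin d → ℝ
  /-- The Gaussian vectors. -/
  Z : ℕ → Ω → Fin d → ℝ

/-- The assumptions on a run of BG-CTS. -/
structure Setup.IsValid {d : ℕ} {Ω : Type*} [MeasurableSpace Ω] (I : Setup d Ω) (P : Measure Ω) :
    Prop where
  nontrivial : I.𝒜.Nontrivial
  two_le : 2 ≤ maxSize I.𝒜
  unique : UniqueOptimal I.𝒜 I.μ
  pos : 0 < I.σ
  oracle : IsArgmaxOracle I.𝒜 I.sel
  initial : IsInitialization I.𝒜 I.init
  reward : IsRewardProcess P I.μ I.σ I.X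
  gaussian : IsGaussianProcess P I.Z
  indep : IndepFun (fun ω t => I.X t ω) (fun ω t => I.Z t ω) P

namespace Setup

variable {d : ℕ} {Ω : Type*}

/-- The statistics after `t` rounds. -/
noncomputable def hist (I : Setup d Ω) (t : ℕ) (ω : Ω) : Stats d :=
  stats I.𝒜 1 I.σ I.sel I.init (fun s => I.X s ω) (fun s => I.Z s ω) t

/-- The number of times that an item was played in the first `t` rounds. -/
noncomputable def count (I : Setup d Ω) (t : ℕ) (ω : Ω) (i : Fin d) : ℕ := (I.hist t ω).count i

/-- The cumulative centered reward observed for an item in the first `t` rounds. -/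
noncomputable def dev (I : Setup d Ω) (t : ℕ) (ω : Ω) (i : Fin d) : ℝ :=
  (I.hist t ω).total i - I.μ i * I.count t ω i

/-- The Thompson sample used in round `t + 1`. -/
noncomputable def sample (I : Setup d Ω) (t : ℕ) (ω : Ω) : Fin d → ℝ :=
  thompson 1 I.σ (maxSize I.𝒜) (t + 1) (I.hist t ω) (I.Z t ω)

/-- The action played in round `t + 1`. -/
noncomputable def play (I : Setup d Ω) (t : ℕ) (ω : Ω) : Finset (Fin d) :=
  action I.𝒜 1 I.σ I.sel I.init (fun s => I.X s ω) (fun s => I.Z s ω) t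

lemma hist_succ (I : Setup d Ω) (t : ℕ) (ω : Ω) :
    I.hist (t + 1) ω = (I.hist t ω).update (I.play t ω) (I.X t ω) := rfl

lemma count_zero (I : Setup d Ω) (ω : Ω) (i : Fin d) : I.count 0 ω i = 0 := rfl

lemma count_succ (I : Setup d Ω) (t : ℕ) (ω : Ω) (i : Fin d) :
    I.count (t + 1) ω i = I.count t ω i + if i ∈ I.play t ω then 1 else 0 := by
  simp only [count, hist_succ, Stats.update]
  split_ifs <;> rfl

lemma dev_zero (I : Setup d Ω) (ω : Ω) (i : Fin d) : I.dev 0 ω i = 0 := by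
  simp [dev, count, hist, stats, Stats.empty]

lemma dev_succ (I : Setup d Ω) (t : ℕ) (ω : Ω) (i : Fin d) :
    I.dev (t + 1) ω i
      = I.dev t ω i + if i ∈ I.play t ω then I.X t ω i - I.μ i else 0 := by
  rw [dev, count_succ, dev]
  simp only [count, hist_succ, Stats.update]
  split_ifs
  · push_cast; ring
  · simp

lemma play_of_length_le (I : Setup d Ω) {t : ℕ} (ht : I.init.length ≤ t) (ω : Ω) :
    I.play t ω = I.sel (I.sample t ω) := by
  unfold play action choose
  rw [List.getElem?_eq_none ht]
  rfl

lemma play_of_lt_length (I : Setup d Ω) {t : ℕ} (ht : t < I.init.length) (ω : Ω) :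
    I.play t ω = I.init[t] := by
  unfold play action choose
  rw [List.getElem?_eq_getElem ht]

/-- The real random variables that drive the run. -/
def noise (I : Setup d Ω) : (ℕ × Fin d) ⊕ (ℕ × Fin d) → Ω → ℝ :=
  Sum.elim (fun p ω => I.X p.1 ω p.2) (fun p ω => I.Z p.1 ω p.2)

/-- The σ-algebra generated by a set of driving variables. -/
@[reducible]
def noiseAlgebra (I : Setup d Ω) (S : Set ((ℕ × Fin d) ⊕ (ℕ × Fin d))) : MeasurableSpace Ω :=
  ⨆ j ∈ S, MeasurableSpace.comap (I.noise j) inferInstance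

lemma measurable_noiseAlgebra (I : Setup d Ω) {S : Set ((ℕ × Fin d) ⊕ (ℕ × Fin d))}
    {j : (ℕ × Fin d) ⊕ (ℕ × Fin d)} (hj : j ∈ S) : Measurable[I.noiseAlgebra S] (I.noise j) :=
  Measurable.of_comap_le
    (le_iSup₂ (f := fun j (_ : j ∈ S) => MeasurableSpace.comap (I.noise j) inferInstance) j hj)

/-- The rewards before round `s + 1` and the Gaussian vectors before round `t + 1`. -/
@[reducible]
def info (I : Setup d Ω) (s t : ℕ) : MeasurableSpace Ω :=
  I.noiseAlgebra {j | Sum.elim (fun p => p.1 < s) (fun p => p.1 < t) j}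

lemma info_mono (I : Setup d Ω) {s t s' t' : ℕ} (hs : s ≤ s') (ht : t ≤ t') :
    I.info s t ≤ I.info s' t' := by
  apply biSup_mono
  rintro (p | p) hp
  · exact lt_of_lt_of_le (hp : p.1 < s) hs
  · exact lt_of_lt_of_le (hp : p.1 < t) ht

lemma measurable_info_reward (I : Setup d Ω) {r s : ℕ} (t : ℕ) (h : r < s) :
    Measurable[I.info s t] (I.X r) :=
  @measurable_pi_lambda _ _ _ (I.info s t) _ _ fun i =>
    I.measurable_noiseAlgebra (j := Sum.inl (r, i)) h

lemma measurable_info_gaussian (I : Setup d Ω) {r t : ℕ} (s : ℕ) (h : r < t) :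
    Measurable[I.info s t] (I.Z r) :=
  @measurable_pi_lambda _ _ _ (I.info s t) _ _ fun i =>
    I.measurable_noiseAlgebra (j := Sum.inr (r, i)) h

lemma measurable_sample (I : Setup d Ω) {s t u v : ℕ}
    (hcount : ∀ i, Measurable[I.info s t] fun ω => I.count u ω i)
    (htotal : ∀ i, Measurable[I.info s t] fun ω => (I.hist u ω).total i) (hs : s ≤ v)
    (ht : t ≤ u + 1) : Measurable[I.info v (u + 1)] (I.sample u) := by
  refine @measurable_pi_lambda _ _ _ (_) _ _ fun i => ?_
  have h1 := (hcount i).mono (I.info_mono hs ht) le_rfl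
  have h2 := (htotal i).mono (I.info_mono hs ht) le_rfl
  have h3 : Measurable[I.info v (u + 1)] fun ω => I.Z u ω i :=
    (measurable_pi_apply i).comp (I.measurable_info_gaussian v (Nat.lt_succ_self u))
  have h4 : Measurable[I.info v (u + 1)] fun ω => (I.count u ω i : ℝ) :=
    (measurable_from_top (f := fun n : ℕ => (n : ℝ))).comp h1
  change Measurable[I.info v (u + 1)] fun ω => (I.hist u ω).total i / (I.count u ω i : ℝ)
    + I.σ * √(2 * boost 1 (maxSize I.𝒜) (u + 1 : ℕ) / (I.count u ω i : ℝ)) * I.Z u ω i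
  let _ := I.info v (u + 1)
  fun_prop

lemma measurableSet_play_of_sample (I : Setup d Ω) (hsel : IsArgmaxOracle I.𝒜 I.sel) {s t u : ℕ}
    (h : Measurable[I.info s t] (I.sample u)) (a : Finset (Fin d)) :
    MeasurableSet[I.info s t] {ω | I.play u ω = a} := by
  rcases Nat.lt_or_ge u I.init.length with hu | hu
  · simp only [I.play_of_lt_length hu]
    exact @MeasurableSet.const _ (I.info s t) _
  · simp only [I.play_of_length_le hu]
    exact h (hsel.measurable a)

lemma measurable_hist (I : Setup d Ω) (hsel : IsArgmaxOracle I.𝒜 I.sel) (t : ℕ) :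
    (∀ i, Measurable[I.info t t] fun ω => I.count t ω i)
      ∧ ∀ i, Measurable[I.info t t] fun ω => (I.hist t ω).total i := by
  induction t with
  | zero =>
    exact ⟨fun i => @measurable_const _ _ _ (_) _, fun i => @measurable_const _ _ _ (_) _⟩
  | succ t ih =>
    have hs : ∀ i, MeasurableSet[I.info (t + 1) (t + 1)] {ω | i ∈ I.play t ω} := by
      intro i
      have : {ω | i ∈ I.play t ω} = ⋃ a ∈ {a : Finset (Fin d) | i ∈ a}, {ω | I.play t ω = a} := by
        ext ω; simp
      rw [this]
      refine @MeasurableSet.biUnion _ _ (I.info (t + 1) (t + 1)) _ _ (Set.to_countable _)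
        fun a _ => ?_
      exact I.measurableSet_play_of_sample hsel
        (I.measurable_sample ih.1 ih.2 (Nat.le_succ t) (Nat.le_succ t)) a
    have hm := I.info_mono (Nat.le_succ t) (Nat.le_succ t)
    refine ⟨fun i => ?_, fun i => ?_⟩
    · exact @Measurable.ite _ _ (_) _ _ _ _ _ (hs i)
        ((measurable_from_top (f := fun n : ℕ => n + 1)).comp ((ih.1 i).mono hm le_rfl))
        ((ih.1 i).mono hm le_rfl)
    · refine @Measurable.ite _ _ (_) _ _ _ _ _ (hs i) ?_ ((ih.2 i).mono hm le_rfl)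
      exact @Measurable.add _ _ _ _ _ (_) _ _ ((ih.2 i).mono hm le_rfl)
        ((measurable_pi_apply i).comp (I.measurable_info_reward _ (Nat.lt_succ_self t)))

/-- The exponential weight of the observations made for a direction `l`. -/
noncomputable def weight (I : Setup d Ω) (l : Fin d → ℝ) (t : ℕ) (ω : Ω) : ℝ :=
  Real.exp (∑ i, (l i * I.dev t ω i - l i ^ 2 * I.σ ^ 2 / 2 * I.count t ω i))

lemma weight_succ (I : Setup d Ω) (l : Fin d → ℝ) (t : ℕ) (ω : Ω) :
    I.weight l (t + 1) ω = I.weight l t ω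
      * Real.exp (∑ i ∈ I.play t ω, (l i * (I.X t ω i - I.μ i) - l i ^ 2 * I.σ ^ 2 / 2)) := by
  rw [weight, weight, ← Real.exp_add]
  congr 1
  rw [← Finset.sum_ite_mem_eq (I.play t ω), ← Finset.sum_add_distrib]
  refine Finset.sum_congr rfl fun i _ => ?_
  rw [dev_succ, count_succ]
  split_ifs
  · push_cast; ring
  · simp

section

variable [mΩ : MeasurableSpace Ω] {P : Measure Ω} {I : Setup d Ω}

lemma IsValid.measurable_noise (hI : I.IsValid P) (j : (ℕ × Fin d) ⊕ (ℕ × Fin d)) :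
    Measurable (I.noise j) := by
  rcases j with p | p
  · exact (measurable_pi_apply p.2).comp (hI.reward.measurable p.1)
  · exact (measurable_pi_apply p.2).comp (hI.gaussian.measurable p.1)

lemma IsValid.info_le (hI : I.IsValid P) (s t : ℕ) : I.info s t ≤ mΩ :=
  iSup₂_le fun j _ => (hI.measurable_noise j).comap_le

lemma IsValid.indep_noise (hI : I.IsValid P) : iIndepFun I.noise P := by
  refine iIndepFun_sumElim hI.reward.indep hI.gaussian.indep ?_
  exact hI.indep.comp (φ := fun x (p : ℕ × Fin d) => x p.1 p.2)
    (ψ := fun x (p : ℕ × Fin d) => x p.1 p.2) (by fun_prop) (by fun_prop)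

lemma IsValid.indep_noiseAlgebra (hI : I.IsValid P) {S T : Set ((ℕ × Fin d) ⊕ (ℕ × Fin d))}
    (h : Disjoint S T) : Indep (I.noiseAlgebra S) (I.noiseAlgebra T) P :=
  indep_iSup_of_disjoint (fun j => (hI.measurable_noise j).comap_le) hI.indep_noise h

lemma IsValid.indep_gaussian (hI : I.IsValid P) (s t : ℕ) :
    Indep (I.info s t) (MeasurableSpace.comap (I.Z t) inferInstance) P := by
  refine indep_of_indep_of_le_right
    (hI.indep_noiseAlgebra (T := Set.range fun i => Sum.inr (t, i)) ?_) ?_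
  · rw [Set.disjoint_left]
    rintro _ h ⟨i, rfl⟩
    exact lt_irrefl t h
  · rw [← measurable_iff_comap_le]
    exact @measurable_pi_lambda _ _ _ (_) _ _ fun i =>
      I.measurable_noiseAlgebra (j := Sum.inr (t, i)) ⟨i, rfl⟩

/-- The second time index is arbitrary: a reward vector is independent even of the Gaussian vector
that selects the action of its own round. This is the reason for two separate time indices in
`info`. -/
lemma IsValid.indep_reward (hI : I.IsValid P) (s t : ℕ) :
    Indep (I.info s t) (MeasurableSpace.comap (I.X s) inferInstance) P := by
  refine indep_of_indep_of_le_right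
    (hI.indep_noiseAlgebra (T := Set.range fun i => Sum.inl (s, i)) ?_) ?_
  · rw [Set.disjoint_left]
    rintro _ h ⟨i, rfl⟩
    exact lt_irrefl s h
  · rw [← measurable_iff_comap_le]
    exact @measurable_pi_lambda _ _ _ (_) _ _ fun i =>
      I.measurable_noiseAlgebra (j := Sum.inl (s, i)) ⟨i, rfl⟩

lemma IsValid.measurable_count (hI : I.IsValid P) (t : ℕ) (i : Fin d) :
    Measurable[I.info t t] fun ω => I.count t ω i :=
  (I.measurable_hist hI.oracle t).1 i

lemma IsValid.measurable_dev (hI : I.IsValid P) (t : ℕ) (i : Fin d) :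
    Measurable[I.info t t] fun ω => I.dev t ω i := by
  have h1 := (I.measurable_hist hI.oracle t).2 i
  have h2 : Measurable[I.info t t] fun ω => (I.count t ω i : ℝ) :=
    (measurable_from_top (f := fun n : ℕ => (n : ℝ))).comp (hI.measurable_count t i)
  let _ := I.info t t
  unfold dev
  fun_prop

lemma IsValid.measurable_sample (hI : I.IsValid P) (t : ℕ) :
    Measurable[I.info t (t + 1)] (I.sample t) :=
  I.measurable_sample (I.measurable_hist hI.oracle t).1 (I.measurable_hist hI.oracle t).2
    le_rfl (Nat.le_succ t)

lemma IsValid.measurableSet_play (hI : I.IsValid P) (t : ℕ) (p : Finset (Fin d) → Prop) :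
    MeasurableSet[I.info t (t + 1)] {ω | p (I.play t ω)} := by
  have : {ω | p (I.play t ω)} = ⋃ a ∈ {a : Finset (Fin d) | p a}, {ω | I.play t ω = a} := by
    ext ω; simp
  rw [this]
  exact @MeasurableSet.biUnion _ _ (I.info t (t + 1)) _ _ (Set.to_countable _)
    fun a _ => I.measurableSet_play_of_sample hI.oracle (hI.measurable_sample t) a

/-! ### The exponential supermartingale -/

lemma IsValid.lintegral_exp_reward_le [IsProbabilityMeasure P] (hI : I.IsValid P) (t : ℕ)
    (l : Fin d → ℝ) (a : Finset (Fin d)) :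
    ∫⁻ ω, ENNReal.ofReal
      (Real.exp (∑ i ∈ a, (l i * (I.X t ω i - I.μ i) - l i ^ 2 * I.σ ^ 2 / 2))) ∂P ≤ 1 := by
  set l' : Fin d → ℝ := fun i => if i ∈ a then l i else 0 with hl'
  have h1 : ∀ ω, Real.exp (∑ i ∈ a, (l i * (I.X t ω i - I.μ i) - l i ^ 2 * I.σ ^ 2 / 2))
      = (Real.exp (∑ i, l' i * I.μ i + (∑ i, l' i ^ 2) * I.σ ^ 2 / 2))⁻¹
        * Real.exp (∑ i, l' i * I.X t ω i) := by
    intro ω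
    rw [← Real.exp_neg, ← Real.exp_add]
    congr 1
    rw [← Finset.sum_ite_mem_eq a, Finset.sum_mul, Finset.sum_div, ← Finset.sum_add_distrib,
      ← Finset.sum_neg_distrib, ← Finset.sum_add_distrib]
    refine Finset.sum_congr rfl fun i _ => ?_
    simp only [hl']
    split_ifs
    · ring
    · ring
  simp_rw [h1]
  rw [← ofReal_integral_eq_lintegral_ofReal ((hI.reward.integrable_exp t l').const_mul _)
    (ae_of_all _ fun ω => by positivity), integral_const_mul]
  refine ENNReal.ofReal_le_one.2 ?_
  rw [inv_mul_le_iff₀ (Real.exp_pos _), mul_one]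
  exact hI.reward.subgaussian t l'

/-- Splitting along the finitely many values of the played action replaces the exponential factor by
one for a fixed action, which is independent of `info t (t + 1)` and has mean at most 1. The weight
`Y` is left general so that the step also serves for weights with an additional discount. -/
lemma IsValid.lintegral_mul_exp_reward_le [IsProbabilityMeasure P] (hI : I.IsValid P) (t : ℕ)
    (l : Fin d → ℝ) {Y : Ω → ENNReal} (hY : Measurable[I.info t (t + 1)] Y) :
    ∫⁻ ω, Y ω * ENNReal.ofReal (Real.exp
      (∑ i ∈ I.play t ω, (l i * (I.X t ω i - I.μ i) - l i ^ 2 * I.σ ^ 2 / 2))) ∂P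
      ≤ ∫⁻ ω, Y ω ∂P := by
  set E : Finset (Fin d) → Ω → ENNReal := fun a ω => ENNReal.ofReal (Real.exp
    (∑ i ∈ a, (l i * (I.X t ω i - I.μ i) - l i ^ 2 * I.σ ^ 2 / 2))) with hE
  set W : Finset (Fin d) → Ω → ENNReal := fun a => {ω | I.play t ω = a}.indicator Y with hW
  have hWm : ∀ a, Measurable[I.info t (t + 1)] (W a) := fun a =>
    hY.indicator (hI.measurableSet_play t (· = a))
  have hle := hI.info_le t (t + 1)
  have hEm : ∀ a, Measurable[MeasurableSpace.comap (I.X t) inferInstance] (E a) := by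
    intro a
    have : E a = (fun x : Fin d → ℝ => ENNReal.ofReal (Real.exp
      (∑ i ∈ a, (l i * (x i - I.μ i) - l i ^ 2 * I.σ ^ 2 / 2)))) ∘ I.X t := rfl
    rw [this]
    exact Measurable.comp (by fun_prop) (comap_measurable _)
  have hXle : MeasurableSpace.comap (I.X t) inferInstance ≤ mΩ := (hI.reward.measurable t).comap_le
  have hsum : ∀ (F : Finset (Fin d) → Ω → ENNReal) ω,
      ∑ a, W a ω * F a ω = Y ω * F (I.play t ω) ω := by
    intro F ω
    rw [Finset.sum_eq_single (I.play t ω)]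
    · simp [hW]
    · intro a _ ha
      simp [hW, Set.indicator_of_notMem, Ne.symm ha]
    · simp
  calc ∫⁻ ω, Y ω * E (I.play t ω) ω ∂P = ∫⁻ ω, ∑ a, W a ω * E a ω ∂P := by
        refine lintegral_congr fun ω => ?_
        rw [hsum E ω]
    _ = ∑ a, ∫⁻ ω, W a ω * E a ω ∂P :=
        lintegral_finsetSum _ fun a _ => ((hWm a).mono hle le_rfl).mul ((hEm a).mono hXle le_rfl)
    _ = ∑ a, (∫⁻ ω, W a ω ∂P) * ∫⁻ ω, E a ω ∂P := by
        refine Finset.sum_congr rfl fun a _ => ?_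
        exact lintegral_mul_eq_lintegral_mul_lintegral_of_independent_measurableSpace hle hXle
          (hI.indep_reward t (t + 1)) (hWm a) (hEm a)
    _ ≤ ∑ a, ∫⁻ ω, W a ω ∂P := by
        refine Finset.sum_le_sum fun a _ => ?_
        exact mul_le_of_le_one_right' (hI.lintegral_exp_reward_le t l a)
    _ = ∫⁻ ω, ∑ a, W a ω * 1 ∂P := by
        simp only [mul_one]
        rw [lintegral_finsetSum _ fun a _ => (hWm a).mono hle le_rfl]
    _ = ∫⁻ ω, Y ω ∂P := by
        refine lintegral_congr fun ω => ?_
        rw [hsum (fun _ _ => 1) ω, mul_one]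

lemma IsValid.measurable_weight (hI : I.IsValid P) (l : Fin d → ℝ) (t : ℕ) :
    Measurable[I.info t t] (I.weight l t) := by
  have h1 := hI.measurable_dev t
  have h2 : ∀ i, Measurable[I.info t t] fun ω => (I.count t ω i : ℝ) := fun i =>
    (measurable_from_top (f := fun n : ℕ => (n : ℝ))).comp (hI.measurable_count t i)
  let _ := I.info t t
  unfold weight
  fun_prop

lemma IsValid.lintegral_weight_le_one [IsProbabilityMeasure P] (hI : I.IsValid P)
    (l : Fin d → ℝ) (t : ℕ) : ∫⁻ ω, ENNReal.ofReal (I.weight l t ω) ∂P ≤ 1 := by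
  induction t with
  | zero => simp [weight, dev_zero, count_zero]
  | succ t ih =>
    refine le_trans ?_ ih
    have hm : Measurable[I.info t (t + 1)] fun ω => ENNReal.ofReal (I.weight l t ω) :=
      ENNReal.measurable_ofReal.comp
        ((hI.measurable_weight l t).mono (I.info_mono le_rfl (Nat.le_succ t)) le_rfl)
    refine le_trans (le_of_eq (lintegral_congr fun ω => ?_))
      (hI.lintegral_mul_exp_reward_le t l hm)
    rw [weight_succ, ENNReal.ofReal_mul (by unfold weight; positivity)]

end

end Setup

end SemiBandit

namespace SemiBandit
namespace Setup

variable {d : ℕ} {Ω : Type*}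

/-! ### Deviations of the empirical means -/

lemma weight_single (I : Setup d Ω) (i : Fin d) (x : ℝ) (t : ℕ) (ω : Ω) :
    I.weight (Pi.single i x) t ω
      = Real.exp (x * I.dev t ω i - x ^ 2 * I.σ ^ 2 / 2 * I.count t ω i) := by
  unfold weight
  congr 1
  rw [Finset.sum_eq_single i]
  · simp
  · intro j _ hj
    simp [Pi.single_eq_of_ne hj]
  · simp

lemma count_le (I : Setup d Ω) (t : ℕ) (ω : Ω) (i : Fin d) : I.count t ω i ≤ t := by
  induction t with
  | zero => simp [count_zero]
  | succ t ih =>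
    rw [count_succ]
    split_ifs <;> omega

variable [mΩ : MeasurableSpace Ω] {P : Measure Ω} [IsProbabilityMeasure P] {I : Setup d Ω}

/-- Markov's inequality for the exponential weight. -/
lemma IsValid.measure_weight_ge_le (hI : I.IsValid P) (l : Fin d → ℝ) (t : ℕ) (y : ℝ) :
    P {ω | Real.exp y ≤ I.weight l t ω} ≤ ENNReal.ofReal (Real.exp (-y)) := by
  have hm : Measurable fun ω => ENNReal.ofReal (I.weight l t ω) :=
    ENNReal.measurable_ofReal.comp ((hI.measurable_weight l t).mono (hI.info_le t t) le_rfl)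
  have h := mul_meas_ge_le_lintegral₀ (μ := P) hm.aemeasurable (ENNReal.ofReal (Real.exp y))
  have h2 : {ω | Real.exp y ≤ I.weight l t ω}
      ⊆ {ω | ENNReal.ofReal (Real.exp y) ≤ ENNReal.ofReal (I.weight l t ω)} := fun ω hω =>
    ENNReal.ofReal_le_ofReal hω
  rw [Real.exp_neg, ENNReal.ofReal_inv_of_pos (Real.exp_pos y)]
  refine (measure_mono h2).trans ?_
  rw [ENNReal.le_inv_iff_mul_le, mul_comm]
  exact h.trans (hI.lintegral_weight_le_one l t)

/-- With the exponent `e ε / σ²` the weight is at least `exp (ε² N / (2σ²))` on the event, for the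
random count `N ≥ n`. Hence Markov's inequality needs no union bound over the values of the count.
-/
lemma IsValid.measure_signed_dev_le (hI : I.IsValid P) (t : ℕ) (i : Fin d) {e ε : ℝ}
    (he : e ^ 2 = 1) (hε : 0 < ε) (n : ℕ) :
    P {ω | n ≤ I.count t ω i ∧ ε * I.count t ω i < e * I.dev t ω i}
      ≤ ENNReal.ofReal (Real.exp (-(ε ^ 2 / (2 * I.σ ^ 2) * n))) := by
  have hσ := hI.pos
  refine (measure_mono ?_).trans (hI.measure_weight_ge_le (Pi.single i (e * ε / I.σ ^ 2)) t _)
  rintro ω ⟨h1, h2⟩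
  simp only [Set.mem_ofPred_eq]
  rw [weight_single]
  apply Real.exp_le_exp.2
  have h3 : (n : ℝ) ≤ I.count t ω i := by exact_mod_cast h1
  have h4 : e * ε / I.σ ^ 2 * I.dev t ω i
      - (e * ε / I.σ ^ 2) ^ 2 * I.σ ^ 2 / 2 * I.count t ω i
      = ε / I.σ ^ 2 * (e * I.dev t ω i) - e ^ 2 * (ε ^ 2 / (2 * I.σ ^ 2) * I.count t ω i) := by
    field_simp
  rw [h4, he, one_mul]
  have h5 : ε / I.σ ^ 2 * (ε * I.count t ω i) ≤ ε / I.σ ^ 2 * (e * I.dev t ω i) := by gcongr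
  have h6 : ε / I.σ ^ 2 * (ε * I.count t ω i)
      = 2 * (ε ^ 2 / (2 * I.σ ^ 2) * I.count t ω i) := by field_simp
  have h7 : ε ^ 2 / (2 * I.σ ^ 2) * n ≤ ε ^ 2 / (2 * I.σ ^ 2) * I.count t ω i := by gcongr
  linarith

/-- An item with many observations has an accurate empirical mean with high probability. -/
lemma IsValid.measure_dev_le (hI : I.IsValid P) (t : ℕ) (i : Fin d) {ε : ℝ} (hε : 0 < ε) (n : ℕ) :
    P {ω | n ≤ I.count t ω i ∧ ε * I.count t ω i < |I.dev t ω i|}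
      ≤ ENNReal.ofReal (2 * Real.exp (-(ε ^ 2 / (2 * I.σ ^ 2) * n))) := by
  have h1 := hI.measure_signed_dev_le t i (e := 1) (by norm_num) hε n
  have h2 := hI.measure_signed_dev_le t i (e := -1) (by norm_num) hε n
  rw [two_mul, ENNReal.ofReal_add (Real.exp_pos _).le (Real.exp_pos _).le]
  refine le_trans (measure_mono ?_) ((measure_union_le _ _).trans (add_le_add h1 h2))
  rintro ω ⟨h3, h4⟩
  rcases lt_abs.1 h4 with h | h
  · exact Or.inl ⟨h3, by simpa using h⟩
  · exact Or.inr ⟨h3, by simpa using h⟩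

/-- The weight is discounted by a factor `e^(-c)` at each play of the item, with `c = ε² / (2σ²)`.
The mass lost over all rounds, `1 - e^(-c)` times the sum of the expected discounted weights at
plays, is at most the initial mass 1. On the event the discounted weight is at least 1, so the sum
is at most `1 / (1 - e^(-c)) ≤ 1 + 1 / c`. -/
lemma IsValid.sum_measure_play_signed_dev_le (hI : I.IsValid P) (T : ℕ) (i : Fin d) {e ε : ℝ}
    (he : e ^ 2 = 1) (hε : 0 < ε) :
    ∑ t ∈ Finset.range T, P {ω | i ∈ I.play t ω ∧ ε * I.count t ω i < e * I.dev t ω i}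
      ≤ ENNReal.ofReal (1 + 2 * I.σ ^ 2 / ε ^ 2) := by
  have hσ := hI.pos
  set c := ε ^ 2 / (2 * I.σ ^ 2) with hc
  have hc0 : 0 < c := by positivity
  set x := e * ε / I.σ ^ 2 with hx
  set l : Fin d → ℝ := Pi.single i x with hl
  set Y : ℕ → Ω → ENNReal := fun t ω =>
    ENNReal.ofReal (I.weight l t ω * Real.exp (-c * I.count t ω i)) with hY
  have hYm : ∀ t, Measurable[I.info t t] (Y t) := by
    intro t
    have h1 := hI.measurable_weight l t
    have h2 : Measurable[I.info t t] fun ω => (I.count t ω i : ℝ) :=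
      (measurable_from_top (f := fun n : ℕ => (n : ℝ))).comp (hI.measurable_count t i)
    let _ := I.info t t
    fun_prop
  have hYm' : ∀ t, Measurable[I.info t (t + 1)] (Y t) := fun t =>
    (hYm t).mono (I.info_mono le_rfl (Nat.le_succ t)) le_rfl
  have hset : ∀ t, MeasurableSet[I.info t (t + 1)] {ω | i ∈ I.play t ω} := fun t =>
    hI.measurableSet_play t fun a => i ∈ a
  have hweight : ∀ t ω, 0 < I.weight l t ω := fun t ω => Real.exp_pos _
  have hstep : ∀ t, ENNReal.ofReal (1 - Real.exp (-c))
      * ∫⁻ ω, {ω | i ∈ I.play t ω}.indicator (Y t) ω ∂P + ∫⁻ ω, Y (t + 1) ω ∂P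
      ≤ ∫⁻ ω, Y t ω ∂P := by
    intro t
    set V : Ω → ENNReal := fun ω =>
      Y t ω * ENNReal.ofReal (Real.exp (-c * if i ∈ I.play t ω then 1 else 0)) with hV
    have hVm : Measurable[I.info t (t + 1)] V := by
      have h1 : Measurable[I.info t (t + 1)]
          fun ω => (if i ∈ I.play t ω then (1 : ℝ) else 0) :=
        @Measurable.ite _ _ (_) _ _ _ _ _ (hset t) measurable_const measurable_const
      have h2 := hYm' t
      let _ := I.info t (t + 1)
      fun_prop
    have h1 : ∫⁻ ω, Y (t + 1) ω ∂P ≤ ∫⁻ ω, V ω ∂P := by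
      refine le_trans (le_of_eq (lintegral_congr fun ω => ?_))
        (hI.lintegral_mul_exp_reward_le t l hVm)
      simp only [hV, hY]
      rw [← ENNReal.ofReal_mul (by have := hweight t ω; positivity),
        ← ENNReal.ofReal_mul (by have := hweight t ω; positivity), weight_succ, count_succ]
      congr 1
      have : Real.exp (-c * ((I.count t ω i + if i ∈ I.play t ω then 1 else 0 : ℕ) : ℝ))
          = Real.exp (-c * I.count t ω i)
            * Real.exp (-c * if i ∈ I.play t ω then 1 else 0) := by
        rw [← Real.exp_add]
        congr 1
        push_cast
        ring
      rw [this]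
      ring
    have hexp : Real.exp (-c) ≤ 1 := Real.exp_le_one_iff.2 (by linarith)
    have h2 : ENNReal.ofReal (1 - Real.exp (-c))
        * ∫⁻ ω, {ω | i ∈ I.play t ω}.indicator (Y t) ω ∂P + ∫⁻ ω, V ω ∂P
        = ∫⁻ ω, Y t ω ∂P := by
      rw [← lintegral_const_mul _ (((hYm' t).indicator (hset t)).mono (hI.info_le _ _) le_rfl),
        ← lintegral_add_right _ (hVm.mono (hI.info_le _ _) le_rfl)]
      refine lintegral_congr fun ω => ?_
      by_cases h : i ∈ I.play t ω
      · simp only [hV, Set.indicator, Set.mem_ofPred_eq, h, if_true, mul_one]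
        rw [mul_comm, ← mul_add, ← ENNReal.ofReal_add (by linarith) (Real.exp_pos _).le]
        simp
      · simp [hV, h]
    rw [← h2]
    gcongr
  have hsum : ∀ T, ENNReal.ofReal (1 - Real.exp (-c))
      * ∑ t ∈ Finset.range T, ∫⁻ ω, {ω | i ∈ I.play t ω}.indicator (Y t) ω ∂P
        + ∫⁻ ω, Y T ω ∂P ≤ 1 := by
    intro T
    induction T with
    | zero => simp [hY, weight, dev_zero, count_zero]
    | succ T ih =>
      rw [Finset.sum_range_succ, mul_add, add_assoc]
      exact (add_le_add le_rfl (hstep T)).trans ih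
  have hpt : ∀ t, P {ω | i ∈ I.play t ω ∧ ε * I.count t ω i < e * I.dev t ω i}
      ≤ ∫⁻ ω, {ω | i ∈ I.play t ω}.indicator (Y t) ω ∂P := by
    intro t
    have hm : Measurable ({ω | i ∈ I.play t ω}.indicator (Y t)) :=
      ((hYm' t).indicator (hset t)).mono (hI.info_le _ _) le_rfl
    have h := mul_meas_ge_le_lintegral₀ (μ := P) hm.aemeasurable 1
    rw [one_mul] at h
    refine (measure_mono ?_).trans h
    rintro ω ⟨h1, h2⟩
    simp only [Set.mem_ofPred_eq, Set.indicator, h1, if_true, hY]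
    rw [ENNReal.one_le_ofReal, hl, weight_single, ← Real.exp_add]
    apply Real.one_le_exp
    have h4 : x * I.dev t ω i - x ^ 2 * I.σ ^ 2 / 2 * I.count t ω i + -c * I.count t ω i
        = ε / I.σ ^ 2 * (e * I.dev t ω i) - (e ^ 2 + 1) / 2 * (ε / I.σ ^ 2)
          * (ε * I.count t ω i) := by
      rw [hx, hc]; field_simp; ring
    rw [h4, he]
    have h5 : ε / I.σ ^ 2 * (ε * I.count t ω i) ≤ ε / I.σ ^ 2 * (e * I.dev t ω i) := by
      gcongr
    linarith
  refine (Finset.sum_le_sum fun t _ => hpt t).trans ?_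
  have h1 := le_trans le_self_add (hsum T)
  have hexp : c / (1 + c) ≤ 1 - Real.exp (-c) := by
    have h2 := Real.add_one_le_exp c
    have h3 : Real.exp (-c) ≤ 1 / (1 + c) := by
      rw [Real.exp_neg, ← one_div]
      exact one_div_le_one_div_of_le (by positivity) (by linarith)
    have h4 : c / (1 + c) = 1 - 1 / (1 + c) := by field_simp; ring
    linarith
  have h5 : 1 + 2 * I.σ ^ 2 / ε ^ 2 = (c / (1 + c))⁻¹ := by
    rw [hc]; field_simp; ring
  have h6 : 0 < c / (1 + c) := by positivity
  rw [h5, ENNReal.ofReal_inv_of_pos h6, ENNReal.le_inv_iff_mul_le, mul_comm]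
  refine le_trans ?_ h1
  gcongr

/-- The expected number of rounds in which an item with an inaccurate empirical mean is played
is bounded. -/
lemma IsValid.sum_measure_play_dev_le (hI : I.IsValid P) (T : ℕ) (i : Fin d) {ε : ℝ}
    (hε : 0 < ε) :
    ∑ t ∈ Finset.range T, P {ω | i ∈ I.play t ω ∧ ε * I.count t ω i < |I.dev t ω i|}
      ≤ ENNReal.ofReal (2 * (1 + 2 * I.σ ^ 2 / ε ^ 2)) := by
  have h1 := hI.sum_measure_play_signed_dev_le T i (e := 1) (by norm_num) hε
  have h2 := hI.sum_measure_play_signed_dev_le T i (e := -1) (by norm_num) hε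
  rw [two_mul, ENNReal.ofReal_add (by positivity) (by positivity)]
  refine le_trans ?_ (add_le_add h1 h2)
  rw [← Finset.sum_add_distrib]
  refine Finset.sum_le_sum fun t _ => ?_
  refine le_trans (measure_mono ?_) (measure_union_le _ _)
  rintro ω ⟨h3, h4⟩
  rcases lt_abs.1 h4 with h | h
  · exact Or.inl ⟨h3, by simpa using h⟩
  · exact Or.inr ⟨h3, by simpa using h⟩

end Setup

/-! ### A self-normalized deviation inequality -/

/-- A geometric grid of exponents. -/
noncomputable def grid (σ : ℝ) (K : ℕ) : Finset ℝ :=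
  insert 0 ((Finset.Icc (-K : ℤ) K).image fun k => (2 : ℝ) ^ k / σ)

lemma card_grid_le (σ : ℝ) (K : ℕ) : (grid σ K).card ≤ 2 * K + 2 := by
  refine (Finset.card_insert_le _ _).trans ?_
  have := (Finset.card_image_le (s := Finset.Icc (-K : ℤ) K) (f := fun k => (2 : ℝ) ^ k / σ))
  rw [Int.card_Icc] at this
  omega

lemma zero_mem_grid (σ : ℝ) (K : ℕ) : 0 ∈ grid σ K := Finset.mem_insert_self _ _

lemma mem_grid {σ : ℝ} {K : ℕ} {k : ℤ} (h1 : -K ≤ k) (h2 : k ≤ K) : (2 : ℝ) ^ k / σ ∈ grid σ K :=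
  Finset.mem_insert_of_mem (Finset.mem_image_of_mem _ (Finset.mem_Icc.2 ⟨h1, h2⟩))

/-- The grid nearly attains the maximum of `x D - x² σ² n / 2` over `x ≥ 0`. -/
lemma exists_mem_grid {σ : ℝ} (hσ : 0 < σ) {K n : ℕ} (hn : 1 ≤ n) (hnK : n ≤ 2 * 4 ^ K) (D : ℝ) :
    ∃ x ∈ grid σ K, 0 ≤ x * D - x ^ 2 * σ ^ 2 / 2 * n ∧
      ((4 : ℝ) ^ K / 2 ≤ x * D - x ^ 2 * σ ^ 2 / 2 * n ∨
        3 / 4 * (max D 0 ^ 2 / (2 * σ ^ 2 * n) - 1) ≤ x * D - x ^ 2 * σ ^ 2 / 2 * n) := by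
  have hn0 : (1 : ℝ) ≤ n := by exact_mod_cast hn
  -- When the maximal value is at most 1 the exponent 0 will do: this is the reason for the `- 1` in
  -- the statement.
  by_cases hq : max D 0 ^ 2 / (2 * σ ^ 2 * n) ≤ 1
  · refine ⟨0, zero_mem_grid _ _, by simp, Or.inr ?_⟩
    simp only [zero_mul, ne_eq, OfNat.ofNat_ne_zero, not_false_eq_true, zero_pow, zero_div,
      sub_zero]
    linarith
  push Not at hq
  rw [one_lt_div (by positivity)] at hq
  have hD : 0 < D := by
    by_contra hD
    rw [max_eq_right (not_lt.1 hD)] at hq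
    have : 0 < 2 * σ ^ 2 * n := by positivity
    simp at hq
    linarith
  rw [max_eq_left hD.le] at hq ⊢
  set v := D / (n * σ) with hv
  have hv0 : 0 < v := by positivity
  have hDv : D = v * (n * σ) := by rw [hv]; field_simp
  have hval : ∀ w : ℝ, w / σ * D - (w / σ) ^ 2 * σ ^ 2 / 2 * n = n * (w * v - w ^ 2 / 2) := by
    intro w; rw [hDv]; field_simp
  -- The exact maximizer is `v / σ`, with value `n v² / 2`. If `v` lies above the grid, its top
  -- point `2 ^ K / σ` already gives `4 ^ K / 2`, as `n ≥ 1`.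
  rcases le_or_gt ((2 : ℝ) ^ K) v with hbig | hsmall
  · have h1 : (4 : ℝ) ^ K / 2 ≤ n * ((2 : ℝ) ^ K * v - ((2 : ℝ) ^ K) ^ 2 / 2) := by
      have h2 : (4 : ℝ) ^ K = ((2 : ℝ) ^ K) ^ 2 := by rw [← pow_mul, mul_comm, pow_mul]; norm_num
      have h3 : (0 : ℝ) < 2 ^ K := by positivity
      have h4 : ((2 : ℝ) ^ K) ^ 2 / 2 ≤ (2 : ℝ) ^ K * v - ((2 : ℝ) ^ K) ^ 2 / 2 := by nlinarith
      rw [h2]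
      have h5 : 0 ≤ ((2 : ℝ) ^ K) ^ 2 / 2 := by positivity
      nlinarith
    refine ⟨(2 : ℝ) ^ (K : ℤ) / σ, mem_grid (by omega) le_rfl, ?_, Or.inl ?_⟩
    · rw [hval, zpow_natCast]
      exact le_trans (by positivity) h1
    · rw [hval, zpow_natCast]
      exact h1
  · obtain ⟨k, hk1, hk2⟩ := exists_mem_Ico_zpow (y := (2 : ℝ)) hv0 (by norm_num)
    have hkK : k ≤ K := by
      have : (2 : ℝ) ^ k < (2 : ℝ) ^ (K : ℤ) := by rw [zpow_natCast]; exact hk1.trans_lt hsmall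
      exact ((zpow_lt_zpow_iff_right₀ (by norm_num)).1 this).le
    -- The grid also reaches low enough: a maximal value above 1 and `n ≤ 2 * 4 ^ K` give `v > 2 ^
    -- (-K)`.
    have hkK' : -(K : ℤ) ≤ k := by
      have hvn : 1 < v ^ 2 * 4 ^ K := by
        have h1 : 2 < v ^ 2 * n := by
          rw [hDv] at hq
          have h2 : 2 * (σ ^ 2 * n) < v ^ 2 * n * (σ ^ 2 * n) := by nlinarith
          exact lt_of_mul_lt_mul_right h2 (by positivity)
        have h2 : (n : ℝ) ≤ 2 * 4 ^ K := by exact_mod_cast hnK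
        have h3 : v ^ 2 * n ≤ v ^ 2 * (2 * 4 ^ K) := by gcongr
        linarith
      have h4 : (4 : ℝ) ^ K = ((2 : ℝ) ^ K) ^ 2 := by rw [← pow_mul, mul_comm, pow_mul]; norm_num
      rw [h4, ← mul_pow] at hvn
      have h5 : 1 < v * 2 ^ K := by
        by_contra h
        push Not at h
        have : (v * 2 ^ K) ^ 2 ≤ 1 := pow_le_one₀ (by positivity) h
        linarith
      have h6 : (2 : ℝ) ^ (-(K : ℤ)) < 2 ^ (k + 1) := by
        refine lt_trans ?_ hk2
        rw [zpow_neg, zpow_natCast, inv_lt_iff_one_lt_mul₀ (by positivity)]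
        linarith
      have := (zpow_lt_zpow_iff_right₀ (by norm_num)).1 h6
      omega
    have hk3 : v < 2 * 2 ^ k := by
      rw [zpow_add_one₀ (by norm_num)] at hk2
      linarith
    -- For `w` between `v / 2` and `v`, the concave function `w v - w² / 2` is smallest at `v / 2`,
    -- where it is three quarters of its maximum.
    have hw : 3 / 8 * v ^ 2 ≤ (2 : ℝ) ^ k * v - ((2 : ℝ) ^ k) ^ 2 / 2 := by
      nlinarith [mul_nonneg (sub_nonneg.2 hk1) (sub_nonneg.2 hk3.le)]
    have hq' : D ^ 2 / (2 * σ ^ 2 * n) = n * v ^ 2 / 2 := by rw [hDv]; field_simp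
    have h8 : n * (3 / 8 * v ^ 2) ≤ n * ((2 : ℝ) ^ k * v - ((2 : ℝ) ^ k) ^ 2 / 2) := by gcongr
    refine ⟨(2 : ℝ) ^ k / σ, mem_grid hkK' hkK, ?_, Or.inr ?_⟩
    · rw [hval]
      exact le_trans (by positivity) h8
    · rw [hval, hq']
      linarith

/-- By Cauchy–Schwarz a large normalized sum forces `∑ D_i² / (2σ² N_i) > x` over the positive
parts. Each grid coordinate recovers three quarters of its summand, up to the loss of 1 that
produces `a.card`. A coordinate that leaves the grid at the top suffices alone, because `y ≤ 4 ^ K /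
2` and the other coordinates are nonnegative. -/
lemma exists_grid_vector {d : ℕ} {σ : ℝ} (hσ : 0 < σ) {K : ℕ} {a : Finset (Fin d)}
    {N : Fin d → ℕ} {D : Fin d → ℝ} (hN : ∀ i ∈ a, 1 ≤ N i) (hNK : ∀ i, N i ≤ 2 * 4 ^ K)
    {x y : ℝ} (hx : 0 ≤ x) (hyK : y ≤ 4 ^ K / 2) (hxy : y ≤ 3 / 4 * (x - a.card))
    (h : σ * √(2 * x * ∑ i ∈ a, (1 : ℝ) / N i) < ∑ i ∈ a, D i / N i) :
    ∃ l ∈ Fintype.piFinset fun i => if i ∈ a then grid σ K else {0},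
      y ≤ ∑ i, (l i * D i - l i ^ 2 * σ ^ 2 / 2 * N i) := by
  classical
  have hex : ∀ i ∈ a, _ := fun i hi => exists_mem_grid hσ (hN i hi) (hNK i) (D i)
  choose! w hw using hex
  refine ⟨fun i => if i ∈ a then w i else 0, ?_, ?_⟩
  · rw [Fintype.mem_piFinset]
    intro i
    by_cases hi : i ∈ a
    · simpa [hi] using (hw i hi).1
    · simp [hi]
  have hsum : ∑ i, ((if i ∈ a then w i else 0) * D i
      - (if i ∈ a then w i else 0) ^ 2 * σ ^ 2 / 2 * N i)
      = ∑ i ∈ a, (w i * D i - w i ^ 2 * σ ^ 2 / 2 * N i) := by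
    rw [← Finset.sum_ite_mem_eq a]
    refine Finset.sum_congr rfl fun i _ => ?_
    split_ifs <;> simp
  rw [hsum]
  by_cases hbig : ∃ i ∈ a, (4 : ℝ) ^ K / 2 ≤ w i * D i - w i ^ 2 * σ ^ 2 / 2 * N i
  · obtain ⟨i, hi, hbig⟩ := hbig
    exact hyK.trans (hbig.trans (Finset.single_le_sum
      (f := fun i => w i * D i - w i ^ 2 * σ ^ 2 / 2 * N i) (fun j hj => (hw j hj).2.1) hi))
  · have h1 : ∀ i ∈ a, 3 / 4 * (max (D i) 0 ^ 2 / (2 * σ ^ 2 * N i) - 1)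
        ≤ w i * D i - w i ^ 2 * σ ^ 2 / 2 * N i := fun i hi =>
      (hw i hi).2.2.resolve_left fun hb => hbig ⟨i, hi, hb⟩
    refine hxy.trans (le_trans ?_ (Finset.sum_le_sum h1))
    rw [← Finset.mul_sum, Finset.sum_sub_distrib]
    simp only [Finset.sum_const, nsmul_eq_mul, mul_one]
    have hcs := Finset.sum_mul_sq_le_sq_mul_sq a (fun i => max (D i) 0 / √(N i))
      (fun i => 1 / √(N i : ℝ))
    set V := ∑ i ∈ a, (1 : ℝ) / N i with hV
    have hNi : ∀ i ∈ a, (0 : ℝ) < N i := fun i hi => by exact_mod_cast hN i hi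
    have e1 : ∑ i ∈ a, max (D i) 0 / √(N i : ℝ) * (1 / √(N i : ℝ))
        = ∑ i ∈ a, max (D i) 0 / N i := by
      refine Finset.sum_congr rfl fun i hi => ?_
      rw [div_mul_div_comm, mul_one, Real.mul_self_sqrt (hNi i hi).le]
    have e2 : ∑ i ∈ a, (1 / √(N i : ℝ)) ^ 2 = V := by
      refine Finset.sum_congr rfl fun i hi => ?_
      rw [div_pow, Real.sq_sqrt (hNi i hi).le, one_pow]
    have e3 : ∑ i ∈ a, (max (D i) 0 / √(N i : ℝ)) ^ 2
        = 2 * σ ^ 2 * ∑ i ∈ a, max (D i) 0 ^ 2 / (2 * σ ^ 2 * N i) := by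
      rw [Finset.mul_sum]
      refine Finset.sum_congr rfl fun i hi => ?_
      have := hNi i hi
      rw [div_pow, Real.sq_sqrt (hNi i hi).le]
      field_simp
    rw [e1, e2, e3] at hcs
    set q := ∑ i ∈ a, max (D i) 0 ^ 2 / (2 * σ ^ 2 * N i) with hq
    have h2 : σ * √(2 * x * V) < ∑ i ∈ a, max (D i) 0 / N i := by
      refine h.trans_le (Finset.sum_le_sum fun i hi => ?_)
      have := hNi i hi
      gcongr
      exact le_max_left _ _
    have hV0 : 0 ≤ V := Finset.sum_nonneg fun i hi => by have := hNi i hi; positivity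
    have h3 : (σ * √(2 * x * V)) ^ 2 < 2 * σ ^ 2 * q * V :=
      (pow_lt_pow_left₀ h2 (by positivity) (by norm_num)).trans_le hcs
    rw [mul_pow, Real.sq_sqrt (by positivity)] at h3
    have h4 : x * (2 * σ ^ 2 * V) < q * (2 * σ ^ 2 * V) := by nlinarith
    have h5 := lt_of_mul_lt_mul_right h4 (by positivity)
    linarith

namespace Setup

variable {d : ℕ} {Ω : Type*} [mΩ : MeasurableSpace Ω] {P : Measure Ω} [IsProbabilityMeasure P]
  {I : Setup d Ω}

/-- The best direction depends on the random counts and deviations, but it may be taken in a product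
grid of at most `(2K + 2) ^ a.card` vectors. Each fixed direction is handled by Markov's inequality
for its weight. With `K` logarithmic in time this costs only `a.card` times a double logarithm in
the exponent. -/
lemma IsValid.measure_selfNormalized_le (hI : I.IsValid P) (t : ℕ) (a : Finset (Fin d)) {K : ℕ}
    (htK : t ≤ 2 * 4 ^ K) {x y : ℝ} (hx : 0 ≤ x) (hyK : y ≤ 4 ^ K / 2)
    (hxy : y ≤ 3 / 4 * (x - a.card)) :
    P {ω | (∀ i ∈ a, 1 ≤ I.count t ω i) ∧ ∑ i ∈ a, I.dev t ω i / I.count t ω i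
        < -(I.σ * √(2 * x * ∑ i ∈ a, (1 : ℝ) / I.count t ω i))}
      ≤ ENNReal.ofReal ((2 * K + 2) ^ a.card * Real.exp (-y)) := by
  classical
  set G := Fintype.piFinset fun i => if i ∈ a then grid I.σ K else {0} with hG
  have hcard : (G.card : ℝ) ≤ (2 * K + 2) ^ a.card := by
    have : G.card = (grid I.σ K).card ^ a.card := by
      rw [hG, Fintype.card_piFinset]
      simp only [apply_ite Finset.card, Finset.card_singleton]
      rw [Finset.prod_ite_mem, Finset.univ_inter, Finset.prod_const]
    rw [this]
    push_cast
    gcongr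
    exact_mod_cast card_grid_le I.σ K
  have hsub : {ω | (∀ i ∈ a, 1 ≤ I.count t ω i) ∧ ∑ i ∈ a, I.dev t ω i / I.count t ω i
        < -(I.σ * √(2 * x * ∑ i ∈ a, (1 : ℝ) / I.count t ω i))}
      ⊆ ⋃ l ∈ G, {ω | Real.exp y ≤ I.weight (fun i => -l i) t ω} := by
    rintro ω ⟨h1, h2⟩
    obtain ⟨l, hl, hly⟩ := exists_grid_vector hI.pos (K := K) (a := a)
      (N := fun i => I.count t ω i) (D := fun i => -I.dev t ω i) h1
      (fun i => (I.count_le t ω i).trans htK) hx hyK hxy (by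
        simp only [neg_div, Finset.sum_neg_distrib]
        linarith)
    refine Set.mem_biUnion hl ?_
    simp only [Set.mem_ofPred_eq, weight]
    apply Real.exp_le_exp.2
    refine hly.trans (le_of_eq (Finset.sum_congr rfl fun i _ => ?_))
    ring
  refine (measure_mono hsub).trans ((measure_biUnion_finset_le _ _).trans ?_)
  refine (Finset.sum_le_sum fun l _ => hI.measure_weight_ge_le _ t y).trans ?_
  rw [Finset.sum_const, nsmul_eq_mul, ENNReal.ofReal_mul (by positivity)]
  gcongr
  rw [← ENNReal.ofReal_natCast]
  exact ENNReal.ofReal_le_ofReal hcard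

end Setup

end SemiBandit

/-! ### Projections of Gaussian vectors, and counting successes of given conditional probability -/

namespace SemiBandit

lemma map_sum_mul_gaussian {Ω ι : Type*} [MeasurableSpace Ω] {P : Measure Ω}
    [IsProbabilityMeasure P] {Z : ι → Ω → ℝ} (hm : ∀ i, Measurable (Z i)) (hZ : iIndepFun Z P)
    (hlaw : ∀ i, P.map (Z i) = gaussianReal 0 1) (w : ι → ℝ) (s : Finset ι) :
    P.map (fun ω => ∑ i ∈ s, w i * Z i ω) = gaussianReal 0 (∑ i ∈ s, ‖w i‖₊ ^ 2) := by
  classical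
  induction s using Finset.induction_on with
  | empty => simp [gaussianReal_zero_var]
  | insert i s hi ih =>
    have h1 : P.map (fun ω => w i * Z i ω) = gaussianReal 0 (‖w i‖₊ ^ 2) := by
      have : P.map (fun ω => w i * Z i ω) = (P.map (Z i)).map (w i * ·) := by
        rw [Measure.map_map (by fun_prop) (hm i)]
        rfl
      rw [this, hlaw i, gaussianReal_map_const_mul]
      congr 1
      · simp
      · ext; simp
    have hind : iIndepFun (fun i ω => w i * Z i ω) P :=
      hZ.comp (fun i x => w i * x) (fun i => by fun_prop)
    have h2 := (hind.indepFun_finsetSum_of_notMem (fun i => (hm i).const_mul (w i)) hi).symm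
    have h3 := gaussianReal_add_gaussianReal_of_indepFun h2 h1
      (by simpa [Finset.sum_fn] using ih)
    rw [Finset.sum_insert hi]
    simp only [Finset.sum_insert hi]
    convert h3 using 2
    · ext ω; simp
    · simp

/-- The combination is one Gaussian variable of variance `∑ w_i²`, so the number of coordinates
plays no role. Writing its law as the image of the standard one under scaling covers `w = 0` as
well. -/
lemma gaussian_tail_le_measure_sum {Ω ι : Type*} [Fintype ι] [MeasurableSpace Ω] {P : Measure Ω}
    [IsProbabilityMeasure P] {Z : ι → Ω → ℝ} (hm : ∀ i, Measurable (Z i)) (hZ : iIndepFun Z P)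
    (hlaw : ∀ i, P.map (Z i) = gaussianReal 0 1) (w : ι → ℝ) (y : ℝ) :
    gaussianReal 0 1 (Set.Ici y) ≤ P {ω | y * √(∑ i, w i ^ 2) ≤ ∑ i, w i * Z i ω} := by
  have hsum : ((∑ i, ‖w i‖₊ ^ 2 : NNReal) : ℝ) = ∑ i, w i ^ 2 := by simp
  have h1 := map_sum_mul_gaussian hm hZ hlaw w Finset.univ
  have h2 : P {ω | y * √(∑ i, w i ^ 2) ≤ ∑ i, w i * Z i ω}
      = P.map (fun ω => ∑ i, w i * Z i ω) (Set.Ici (y * √(∑ i, w i ^ 2))) := by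
    rw [Measure.map_apply (by fun_prop) measurableSet_Ici]
    rfl
  have h3 : gaussianReal 0 (∑ i, ‖w i‖₊ ^ 2)
      = (gaussianReal 0 1).map (√(∑ i, w i ^ 2) * ·) := by
    rw [gaussianReal_map_const_mul, mul_zero, mul_one]
    congr 1
    ext
    rw [hsum]
    simp only [NNReal.coe_mk]
    rw [Real.sq_sqrt (Finset.sum_nonneg fun i _ => sq_nonneg _)]
  rw [h2, h1, h3, Measure.map_apply (by fun_prop) measurableSet_Ici]
  refine measure_mono fun x hx => ?_
  simp only [Set.mem_preimage, Set.mem_Ici] at hx ⊢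
  rw [mul_comm]
  gcongr

/-- One step of the counting supermartingale, where `A` and `B` are the masses without and with a
success. The share of `B` is at least `p` and `1 - e^(-1) ≥ 1/2`, so the mean factor is at most
`e^(p/2) (1 - p/2) ≤ 1`. -/
lemma exp_mul_add_le {p A B : ℝ} (hA : 0 ≤ A) (hB : 0 ≤ B)
    (h : p * (A + B) ≤ B) : Real.exp (p / 2) * (A + Real.exp (-1) * B) ≤ A + B := by
  have h1 : Real.exp (p / 2) * (1 - p / 2) ≤ 1 := by
    have := Real.add_one_le_exp (-(p / 2))
    calc Real.exp (p / 2) * (1 - p / 2) ≤ Real.exp (p / 2) * Real.exp (-(p / 2)) := by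
          gcongr; linarith
      _ = 1 := by rw [← Real.exp_add]; simp
  have h2 : Real.exp (-1) ≤ 1 / 2 := by
    rw [Real.exp_neg, ← one_div]
    exact one_div_le_one_div_of_le (by norm_num) (by linarith [Real.add_one_le_exp (1 : ℝ)])
  have h3 : A + Real.exp (-1) * B ≤ (1 - p / 2) * (A + B) := by nlinarith
  calc Real.exp (p / 2) * (A + Real.exp (-1) * B)
      ≤ Real.exp (p / 2) * ((1 - p / 2) * (A + B)) := by gcongr
    _ = (Real.exp (p / 2) * (1 - p / 2)) * (A + B) := by ring
    _ ≤ 1 * (A + B) := by gcongr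
    _ = A + B := one_mul _

open Classical in
/-- If the event `E s` is followed by `O s` with conditional probability at least `p`, then many
occurrences of `E` come with many occurrences of `O`. -/
lemma measure_card_filter_le {Ω : Type*} [mΩ : MeasurableSpace Ω] {P : Measure Ω}
    [IsProbabilityMeasure P] {𝓕 : ℕ → MeasurableSpace Ω} (hmono : ∀ s, 𝓕 s ≤ 𝓕 (s + 1))
    (hle : ∀ s, 𝓕 s ≤ mΩ) {E O : ℕ → Set Ω} {a b : ℕ}
    (hE : ∀ s, MeasurableSet[𝓕 s] (E s)) (hO : ∀ s, MeasurableSet[𝓕 (s + 1)] (O s))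
    {p : ℝ} (hp0 : 0 ≤ p)
    (hEO : ∀ s ∈ Finset.Ico a b, ∀ W : Ω → ENNReal, Measurable[𝓕 s] W →
      ENNReal.ofReal p * ∫⁻ ω in E s, W ω ∂P ≤ ∫⁻ ω in E s ∩ O s, W ω ∂P)
    (x y : ℝ) :
    P {ω | x ≤ ((Finset.Ico a b).filter fun s => ω ∈ E s).card ∧
        ((Finset.Ico a b).filter fun s => ω ∈ E s ∩ O s).card ≤ y}
      ≤ ENNReal.ofReal (Real.exp (y - p / 2 * x)) := by
  -- Each occurrence of `E` multiplies `Y` by `e^(p/2)`, and each success divides it by `e`. Its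
  -- mean stays at most 1, since `hEO` expresses the conditional probability by integrals against
  -- weights known before the round.
  set Y : ℕ → Ω → ENNReal := fun c ω => ENNReal.ofReal (Real.exp
    (∑ s ∈ Finset.Ico a c, ((if ω ∈ E s then p / 2 else 0) - if ω ∈ E s ∩ O s then 1 else 0)))
    with hY
  have hmono' : ∀ s c, s ≤ c → 𝓕 s ≤ 𝓕 c := fun s c h => monotone_nat_of_le_succ hmono h
  have hYm : ∀ c, Measurable[𝓕 c] (Y c) := by
    intro c
    have h1 : ∀ s ∈ Finset.Ico a c, Measurable[𝓕 c] fun ω =>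
        ((if ω ∈ E s then p / 2 else 0) - if ω ∈ E s ∩ O s then (1 : ℝ) else 0) := by
      intro s hs
      have hs' := (Finset.mem_Ico.1 hs).2
      have hE' : MeasurableSet[𝓕 c] (E s) := hmono' s c hs'.le _ (hE s)
      have hO' : MeasurableSet[𝓕 c] (O s) := hmono' (s + 1) c hs' _ (hO s)
      let _ := 𝓕 c
      exact (Measurable.ite hE' measurable_const measurable_const).sub
        (Measurable.ite (hE'.inter hO') measurable_const measurable_const)
    exact ENNReal.measurable_ofReal.comp
      (Real.measurable_exp.comp (@Finset.measurable_sum _ _ _ _ _ _ (𝓕 c) _ _ h1))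
  have hstep : ∀ c, a ≤ c → c < b → ∫⁻ ω, Y c ω ∂P ≤ 1 → ∫⁻ ω, Y (c + 1) ω ∂P ≤ 1 := by
    intro c hac hcb hc
    have hEc := hle c _ (hE c)
    have hOc := hle (c + 1) _ (hO c)
    have hrec : ∀ ω, Y (c + 1) ω = Y c ω * ENNReal.ofReal (Real.exp
        ((if ω ∈ E c then p / 2 else 0) - if ω ∈ E c ∩ O c then 1 else 0)) := by
      intro ω
      simp only [hY]
      rw [← ENNReal.ofReal_mul (Real.exp_pos _).le, ← Real.exp_add,
        Finset.sum_Ico_succ_top hac]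
    have hfin : ∀ S : Set Ω, ∫⁻ ω in S, Y c ω ∂P ≠ ⊤ := fun S =>
      ((setLIntegral_le_lintegral S _).trans hc).trans_lt ENNReal.one_lt_top |>.ne
    have i1 : ∫⁻ ω in (E c)ᶜ, Y (c + 1) ω ∂P = ∫⁻ ω in (E c)ᶜ, Y c ω ∂P := by
      refine setLIntegral_congr_fun hEc.compl fun ω hω => ?_
      have : ω ∉ E c := hω
      simp [hrec, this]
    have i2 : ∫⁻ ω in E c ∩ O c, Y (c + 1) ω ∂P
        = ENNReal.ofReal (Real.exp (p / 2 - 1)) * ∫⁻ ω in E c ∩ O c, Y c ω ∂P := by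
      rw [← lintegral_const_mul _ ((hYm c).mono (hle c) le_rfl)]
      refine setLIntegral_congr_fun (hEc.inter hOc) fun ω hω => ?_
      simp only [hrec, hω, hω.1, if_true]
      rw [mul_comm]
    have i3 : ∫⁻ ω in E c \ O c, Y (c + 1) ω ∂P
        = ENNReal.ofReal (Real.exp (p / 2)) * ∫⁻ ω in E c \ O c, Y c ω ∂P := by
      rw [← lintegral_const_mul _ ((hYm c).mono (hle c) le_rfl)]
      refine setLIntegral_congr_fun (hEc.diff hOc) fun ω hω => ?_
      have h2 : ω ∉ E c ∩ O c := fun h => hω.2 h.2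
      simp only [hrec, hω.1, h2, if_true, if_false, sub_zero]
      rw [mul_comm]
    have hsplit : ∀ f : Ω → ENNReal, ∫⁻ ω, f ω ∂P
        = (∫⁻ ω in E c ∩ O c, f ω ∂P + ∫⁻ ω in E c \ O c, f ω ∂P) + ∫⁻ ω in (E c)ᶜ, f ω ∂P := by
      intro f
      rw [lintegral_inter_add_sdiff f (E c) hOc, lintegral_add_compl f hEc]
    refine le_trans ?_ hc
    rw [hsplit (Y (c + 1)), hsplit (Y c), i1, i2, i3]
    refine add_le_add ?_ le_rfl
    set A := ∫⁻ ω in E c \ O c, Y c ω ∂P with hA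
    set B := ∫⁻ ω in E c ∩ O c, Y c ω ∂P with hB
    have hAfin : A ≠ ⊤ := hfin _
    have hBfin : B ≠ ⊤ := hfin _
    have hAB := hEO c (Finset.mem_Ico.2 ⟨hac, hcb⟩) (Y c) (hYm c)
    rw [← lintegral_inter_add_sdiff (Y c) (E c) hOc, ← hA, ← hB] at hAB
    rw [← ENNReal.ofReal_toReal hAfin, ← ENNReal.ofReal_toReal hBfin] at hAB ⊢
    have hA0 : 0 ≤ A.toReal := ENNReal.toReal_nonneg
    have hB0 : 0 ≤ B.toReal := ENNReal.toReal_nonneg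
    rw [← ENNReal.ofReal_add hB0 hA0, ← ENNReal.ofReal_mul hp0,
      ENNReal.ofReal_le_ofReal_iff hB0] at hAB
    rw [← ENNReal.ofReal_mul (Real.exp_pos _).le, ← ENNReal.ofReal_mul (Real.exp_pos _).le,
      ← ENNReal.ofReal_add (by positivity) (by positivity), ← ENNReal.ofReal_add hB0 hA0]
    apply ENNReal.ofReal_le_ofReal
    have := exp_mul_add_le (p := p) hA0 hB0 (by linarith)
    rw [sub_eq_add_neg, Real.exp_add]
    linarith
  have hall : ∀ c, a ≤ c → c ≤ b → ∫⁻ ω, Y c ω ∂P ≤ 1 := by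
    intro c hac
    induction c, hac using Nat.le_induction with
    | base => intro _; simp [hY]
    | succ c hac ih => intro hcb; exact hstep c hac hcb (ih (by omega))
  -- For `b < a` the window is empty and the recursion says nothing; the bound then holds directly.
  rcases Nat.lt_or_ge b a with hba | hab
  · rw [Finset.Ico_eq_empty_of_le hba.le]
    by_cases h : x ≤ 0 ∧ 0 ≤ y
    · have h0 : 0 ≤ y - p / 2 * x := by nlinarith
      exact prob_le_one.trans (ENNReal.one_le_ofReal.2 (Real.one_le_exp h0))
    · have : {ω : Ω | x ≤ ((∅ : Finset ℕ).filter fun s => ω ∈ E s).card ∧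
          ((∅ : Finset ℕ).filter fun s => ω ∈ E s ∩ O s).card ≤ y} = ∅ := by
        ext ω
        simpa using h
      rw [this]
      simp
  have hm := mul_meas_ge_le_lintegral₀ (μ := P) ((hYm b).mono (hle b) le_rfl).aemeasurable
    (ENNReal.ofReal (Real.exp (p / 2 * x - y)))
  have h1 : y - p / 2 * x = -(p / 2 * x - y) := by ring
  rw [h1, Real.exp_neg, ENNReal.ofReal_inv_of_pos (Real.exp_pos _), ENNReal.le_inv_iff_mul_le,
    mul_comm]
  refine le_trans ?_ (hm.trans (hall b hab le_rfl))
  refine mul_le_mul' le_rfl (measure_mono ?_)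
  rintro ω ⟨h2, h3⟩
  simp only [Set.mem_ofPred_eq, hY]
  apply ENNReal.ofReal_le_ofReal
  apply Real.exp_le_exp.2
  rw [Finset.sum_sub_distrib, ← Finset.sum_filter, Finset.sum_const, nsmul_eq_mul,
    Finset.sum_boole]
  have h4 : p / 2 * x ≤ p / 2 * ((Finset.Ico a b).filter fun s => ω ∈ E s).card := by gcongr
  linarith

namespace Setup

variable {d : ℕ} {Ω : Type*} [mΩ : MeasurableSpace Ω] {P : Measure Ω} {I : Setup d Ω}

lemma IsValid.indep_gaussian_coord (hI : I.IsValid P) (t : ℕ) :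
    iIndepFun (fun i ω => I.Z t ω i) P :=
  hI.gaussian.indep.precomp (g := fun i => (t, i)) fun _ _ h => (Prod.mk.inj h).2

lemma IsValid.measurable_gaussian_coord (hI : I.IsValid P) (t : ℕ) (i : Fin d) :
    Measurable fun ω => I.Z t ω i :=
  (measurable_pi_apply i).comp (hI.gaussian.measurable t)

/-- Chernoff's bound with exponent `1/4`, for which the exponential moment of the squared norm is at
most `e^d`. -/
lemma IsValid.measure_gaussian_norm_le (hI : I.IsValid P) (t : ℕ) {y : ℝ} :
    P {ω | 4 * (y + d) ≤ ∑ i, I.Z t ω i ^ 2} ≤ ENNReal.ofReal (Real.exp (-y)) := by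
  have hm := hI.measurable_gaussian_coord t
  have h1 : ∫⁻ ω, ∏ i, ENNReal.ofReal (Real.exp (I.Z t ω i ^ 2 / 4)) ∂P
      ≤ ENNReal.ofReal (Real.exp d) := by
    rw [lintegral_prod_eq_prod_lintegral_of_indepFun Finset.univ
      (fun i ω => ENNReal.ofReal (Real.exp (I.Z t ω i ^ 2 / 4)))
      ((hI.indep_gaussian_coord t).comp (fun i x => ENNReal.ofReal (Real.exp (x ^ 2 / 4)))
        fun i => by fun_prop) (fun i => by have := hm i; fun_prop)]
    have h2 : ∀ i, ∫⁻ ω, ENNReal.ofReal (Real.exp (I.Z t ω i ^ 2 / 4)) ∂P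
        ≤ ENNReal.ofReal (Real.exp 1) := by
      intro i
      refine le_trans (le_of_eq ?_) lintegral_exp_sq_gaussian_le
      rw [← hI.gaussian.law t i, lintegral_map (by fun_prop) (hm i)]
    refine (Finset.prod_le_prod' fun i _ => h2 i).trans ?_
    rw [Finset.prod_const, Finset.card_univ, Fintype.card_fin,
      ← ENNReal.ofReal_pow (Real.exp_pos _).le, ← Real.exp_nat_mul, mul_one]
  have hmeas : Measurable fun ω => ∏ i, ENNReal.ofReal (Real.exp (I.Z t ω i ^ 2 / 4)) := by
    fun_prop
  have h3 := mul_meas_ge_le_lintegral₀ (μ := P) hmeas.aemeasurable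
    (ENNReal.ofReal (Real.exp (y + d)))
  have h4 : {ω | 4 * (y + d) ≤ ∑ i, I.Z t ω i ^ 2} ⊆ {ω | ENNReal.ofReal (Real.exp (y + d))
      ≤ ∏ i, ENNReal.ofReal (Real.exp (I.Z t ω i ^ 2 / 4))} := by
    intro ω hω
    simp only [Set.mem_ofPred_eq] at hω ⊢
    rw [← ENNReal.ofReal_prod_of_nonneg fun i _ => (Real.exp_pos _).le, ← Real.exp_sum,
      ← Finset.sum_div]
    apply ENNReal.ofReal_le_ofReal
    apply Real.exp_le_exp.2
    linarith
  have h5 := h3.trans h1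
  refine (measure_mono h4).trans ?_
  rw [Real.exp_add, ENNReal.ofReal_mul (Real.exp_pos _).le] at h5
  rw [Real.exp_neg, ENNReal.ofReal_inv_of_pos (Real.exp_pos _), ENNReal.le_inv_iff_mul_le]
  have h6 : ENNReal.ofReal (Real.exp d) ≠ 0 := by simp [Real.exp_pos]
  refine (ENNReal.mul_le_mul_iff_left h6 ENNReal.ofReal_ne_top).1 ?_
  rw [one_mul]
  refine le_trans (le_of_eq ?_) h5
  rw [Real.exp_add, ENNReal.ofReal_mul (Real.exp_pos _).le]
  ring

/-- `W` and `w` are functions of the past, independent of the Gaussian vector of the round. Fubini's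
theorem freezes them and leaves the tail of a linear combination with fixed coefficients. -/
lemma IsValid.gaussian_tail_mul_lintegral_le [IsProbabilityMeasure P] (hI : I.IsValid P) (t : ℕ) {W : Ω → ENNReal}
    (hW : Measurable[I.info t t] W) {w : Ω → Fin d → ℝ} (hw : Measurable[I.info t t] w) (y : ℝ) :
    gaussianReal 0 1 (Set.Ici y) * ∫⁻ ω, W ω ∂P
      ≤ ∫⁻ ω in {ω | y * √(∑ i, w ω i ^ 2) ≤ ∑ i, w ω i * I.Z t ω i}, W ω ∂P := by
  have hle := hI.info_le t t
  have hZ := hI.gaussian.measurable t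
  have hU : Measurable[I.info t t] fun ω => (W ω, w ω) := by
    let _ := I.info t t
    exact hW.prodMk hw
  have hU' : Measurable fun ω => (W ω, w ω) := hU.mono hle le_rfl
  have hind : IndepFun (fun ω => (W ω, w ω)) (I.Z t) P :=
    indep_of_indep_of_le_left (hI.indep_gaussian t t) hU.comap_le
  set S : Set ((ENNReal × (Fin d → ℝ)) × (Fin d → ℝ)) :=
    {u | y * √(∑ i, u.1.2 i ^ 2) ≤ ∑ i, u.1.2 i * u.2 i} with hS
  have hSm : MeasurableSet S := measurableSet_le (by fun_prop) (by fun_prop)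
  have hset : MeasurableSet {ω | y * √(∑ i, w ω i ^ 2) ≤ ∑ i, w ω i * I.Z t ω i} :=
    (hU'.prodMk hZ) hSm
  have hφ : Measurable (S.indicator fun u : (ENNReal × (Fin d → ℝ)) × (Fin d → ℝ) => u.1.1) :=
    (by fun_prop : Measurable fun u : (ENNReal × (Fin d → ℝ)) × (Fin d → ℝ) => u.1.1).indicator
      hSm
  rw [← lintegral_indicator hset]
  have h1 : ∫⁻ ω, {ω | y * √(∑ i, w ω i ^ 2) ≤ ∑ i, w ω i * I.Z t ω i}.indicator W ω ∂P
      = ∫⁻ u, S.indicator (fun u => u.1.1) u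
        ∂((P.map fun ω => (W ω, w ω)).prod (P.map (I.Z t))) := by
    rw [← (indepFun_iff_map_prod_eq_prod_map_map hU'.aemeasurable hZ.aemeasurable).1 hind,
      lintegral_map hφ (hU'.prodMk hZ)]
    rfl
  rw [h1, lintegral_prod _ hφ.aemeasurable, lintegral_map hφ.lintegral_prod_right' hU',
    ← lintegral_const_mul _ (hW.mono hle le_rfl)]
  refine lintegral_mono fun ω => ?_
  have h2 : ∀ z, S.indicator (fun u => u.1.1) ((W ω, w ω), z)
      = {z | y * √(∑ i, w ω i ^ 2) ≤ ∑ i, w ω i * z i}.indicator (fun _ => W ω) z := fun z => rfl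
  simp_rw [h2]
  have hset2 : MeasurableSet {z : Fin d → ℝ | y * √(∑ i, w ω i ^ 2) ≤ ∑ i, w ω i * z i} :=
    measurableSet_le (by fun_prop) (by fun_prop)
  rw [lintegral_indicator_const hset2, Measure.map_apply hZ hset2, mul_comm]
  gcongr
  exact gaussian_tail_le_measure_sum (hI.measurable_gaussian_coord t)
    (hI.indep_gaussian_coord t) (hI.gaussian.law t) (w ω) y

end Setup

end SemiBandit

namespace SemiBandit
namespace Setup

variable {d : ℕ} {Ω : Type*} {I : Setup d Ω}

/-! ### Gaps -/

/-- An optimal action. -/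
def IsOptimal (I : Setup d Ω) (a : Finset (Fin d)) : Prop :=
  a ∈ I.𝒜 ∧ ∀ b ∈ I.𝒜, value I.μ b ≤ value I.μ a

lemma IsOptimal.optValue_eq {a : Finset (Fin d)} (ha : I.IsOptimal a) :
    optValue I.𝒜 I.μ = value I.μ a := by
  refine IsGreatest.csSup_eq ⟨⟨a, ha.1, rfl⟩, ?_⟩
  rintro _ ⟨b, hb, rfl⟩
  exact ha.2 b hb

lemma IsOptimal.gap_nonneg {a b : Finset (Fin d)} (ha : I.IsOptimal a) (hb : b ∈ I.𝒜) :
    0 ≤ gap I.𝒜 I.μ b := by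
  rw [gap, ha.optValue_eq]
  exact sub_nonneg.2 (ha.2 b hb)

lemma IsOptimal.gap_self {a : Finset (Fin d)} (ha : I.IsOptimal a) : gap I.𝒜 I.μ a = 0 := by
  rw [gap, ha.optValue_eq, sub_self]

lemma IsOptimal.gap_pos (hu : UniqueOptimal I.𝒜 I.μ) {a b : Finset (Fin d)}
    (ha : I.IsOptimal a) (hb : b ∈ I.𝒜) (hba : b ≠ a) : 0 < gap I.𝒜 I.μ b := by
  refine (ha.gap_nonneg hb).lt_of_ne' fun h0 => hba ?_
  rw [gap, ha.optValue_eq, sub_eq_zero] at h0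
  exact hu.unique ⟨hb, fun c hc => h0 ▸ ha.2 c hc⟩ ha

lemma gap_le_maxGap (I : Setup d Ω) {b : Finset (Fin d)} (hb : b ∈ I.𝒜) :
    gap I.𝒜 I.μ b ≤ maxGap I.𝒜 I.μ :=
  le_csSup ((I.𝒜.finite_toSet.image _).bddAbove) ⟨b, hb, rfl⟩

lemma minGap_le_gap (I : Setup d Ω) {b : Finset (Fin d)} (hb : b ∈ I.𝒜)
    (hpos : 0 < gap I.𝒜 I.μ b) : minGap I.𝒜 I.μ ≤ gap I.𝒜 I.μ b :=
  csInf_le (((I.𝒜.finite_toSet.subset fun _ h => h.1).image _).bddBelow) ⟨b, ⟨hb, hpos⟩, rfl⟩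

lemma IsOptimal.minGap_pos (hn : I.𝒜.Nontrivial) (hu : UniqueOptimal I.𝒜 I.μ)
    {a : Finset (Fin d)} (ha : I.IsOptimal a) : 0 < minGap I.𝒜 I.μ := by
  obtain ⟨b, hb, hba⟩ := hn.exists_ne a
  have hfin : (gap I.𝒜 I.μ '' {a | a ∈ I.𝒜 ∧ 0 < gap I.𝒜 I.μ a}).Finite :=
    (I.𝒜.finite_toSet.subset fun _ h => h.1).image _
  have hne : (gap I.𝒜 I.μ '' {a | a ∈ I.𝒜 ∧ 0 < gap I.𝒜 I.μ a}).Nonempty :=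
    ⟨_, b, ⟨hb, ha.gap_pos hu hb hba⟩, rfl⟩
  obtain ⟨c, hc, hc'⟩ := hne.csInf_mem hfin
  rw [minGap, ← hc']
  exact hc.2

lemma card_le_maxSize (I : Setup d Ω) {b : Finset (Fin d)} (hb : b ∈ I.𝒜) :
    b.card ≤ maxSize I.𝒜 := Finset.le_sup (f := Finset.card) hb

lemma maxSize_le (I : Setup d Ω) : maxSize I.𝒜 ≤ d :=
  Finset.sup_le fun b _ => (Finset.card_le_univ b).trans (by simp)

/-! ### Counting -/

lemma play_mem (hsel : IsArgmaxOracle I.𝒜 I.sel) (hinit : IsInitialization I.𝒜 I.init) (t : ℕ)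
    (ω : Ω) : I.play t ω ∈ I.𝒜 := by
  rcases Nat.lt_or_ge t I.init.length with h | h
  · rw [I.play_of_lt_length h]
    exact hinit.mem _ (List.getElem_mem h)
  · rw [I.play_of_length_le h]
    exact hsel.mem _

lemma sum_play_eq (I : Setup d Ω) (F : ℕ → ℝ) (t : ℕ) (ω : Ω) (i : Fin d) :
    ∑ s ∈ Finset.range t, (if i ∈ I.play s ω then F (I.count s ω i) else 0)
      = ∑ n ∈ Finset.range (I.count t ω i), F n := by
  induction t with
  | zero => simp [count_zero]
  | succ t ih =>
    rw [Finset.sum_range_succ, ih, count_succ]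
    split_ifs
    · rw [Finset.sum_range_succ]
    · simp

lemma count_mono (I : Setup d Ω) {s t : ℕ} (h : s ≤ t) (ω : Ω) (i : Fin d) :
    I.count s ω i ≤ I.count t ω i :=
  monotone_nat_of_le_succ (f := fun s => I.count s ω i)
    (fun s => by rw [count_succ]; exact Nat.le_add_right _ _) h

lemma one_le_count (hinit : IsInitialization I.𝒜 I.init) {t : ℕ} (ht : I.init.length ≤ t) (ω : Ω)
    (i : Fin d) : 1 ≤ I.count t ω i := by
  obtain ⟨a, ha, hi⟩ := hinit.cover i
  obtain ⟨j, hj, rfl⟩ := List.getElem_of_mem ha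
  refine le_trans ?_ (I.count_mono (s := j + 1) (by omega) ω i)
  rw [count_succ, I.play_of_lt_length hj, if_pos hi]
  omega

lemma card_play_lt_le (I : Setup d Ω) (n t : ℕ) (ω : Ω) (i : Fin d) :
    ((Finset.range t).filter fun s => i ∈ I.play s ω ∧ I.count s ω i < n).card ≤ n := by
  have h := I.sum_play_eq (fun k => if k < n then 1 else 0) t ω i
  simp only [← ite_and] at h
  rw [Finset.sum_boole, Finset.sum_boole] at h
  have h2 : ((Finset.range t).filter fun s => i ∈ I.play s ω ∧ I.count s ω i < n).card
      = ((Finset.range (I.count t ω i)).filter fun k => k < n).card := by exact_mod_cast h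
  rw [h2]
  calc _ ≤ (Finset.range n).card := Finset.card_le_card fun k hk => by
        simp only [Finset.mem_filter, Finset.mem_range] at hk ⊢
        exact hk.2
    _ = n := Finset.card_range n

lemma card_play_eq_le_count (I : Setup d Ω) (t : ℕ) (ω : Ω) {a : Finset (Fin d)} {i : Fin d}
    (hi : i ∈ a) : ((Finset.range t).filter fun s => I.play s ω = a).card ≤ I.count t ω i := by
  have h := I.sum_play_eq (fun _ => 1) t ω i
  rw [Finset.sum_boole] at h
  have h2 : ((Finset.range t).filter fun s => i ∈ I.play s ω).card = I.count t ω i := by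
    simpa using h
  rw [← h2]
  refine Finset.card_le_card fun s hs => ?_
  simp only [Finset.mem_filter] at hs ⊢
  exact ⟨hs.1, hs.2 ▸ hi⟩

/-- The successive plays of an item are charged at the counts `0, 1, 2, …`, each once, so the sum
over rounds becomes a sum over counts, for each of the `d` items. -/
lemma sum_sum_charge_le (I : Setup d Ω) {L D : ℝ} (hL : 0 < L) (hD : 0 < D) {m : ℕ}
    (hm : 2 ≤ m) (T : ℕ) (ω : Ω) :
    ∑ t ∈ Finset.range T, ∑ i ∈ I.play t ω, charge L D m (I.count t ω i)
      ≤ d * (13 * (L / D) * Real.log m) := by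
  -- The first play of an item costs nothing here, by the convention `L / 0 = 0`; this matches sums
  -- of charges that start at 1.
  have h0 : charge L D m 0 = 0 := by
    unfold charge
    rw [if_pos (by simp; positivity)]
    simp
  have h1 : ∀ i, ∑ t ∈ Finset.range T, (if i ∈ I.play t ω then charge L D m (I.count t ω i) else 0)
      ≤ 13 * (L / D) * Real.log m := by
    intro i
    rw [I.sum_play_eq]
    refine le_trans ?_ (sum_charge_le hL hD hm (I.count T ω i))
    rw [Finset.range_eq_Ico]
    rcases Nat.eq_zero_or_pos (I.count T ω i) with h | h
    · simp [h]
    · rw [Finset.sum_eq_sum_Ico_succ_bot h, h0, zero_add]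
      refine Finset.sum_le_sum_of_subset_of_nonneg (fun n hn => ?_)
        fun n _ _ => charge_nonneg hL.le hD.le m n
      simp only [Finset.mem_Ico, Finset.mem_Icc] at hn ⊢
      omega
  calc ∑ t ∈ Finset.range T, ∑ i ∈ I.play t ω, charge L D m (I.count t ω i)
      = ∑ i, ∑ t ∈ Finset.range T,
          (if i ∈ I.play t ω then charge L D m (I.count t ω i) else 0) := by
        rw [Finset.sum_comm]
        refine Finset.sum_congr rfl fun t _ => ?_
        rw [Finset.sum_ite_mem_eq]
    _ ≤ ∑ _i : Fin d, 13 * (L / D) * Real.log m := Finset.sum_le_sum fun i _ => h1 i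
    _ = d * (13 * (L / D) * Real.log m) := by simp

/-! ### Deterministic properties of the Thompson sample -/

/-- The exploration boost of round `t + 1`. -/
noncomputable def boostAt (I : Setup d Ω) (t : ℕ) : ℝ := boost 1 (maxSize I.𝒜) ((t + 1 : ℕ) : ℝ)

/-- The sum of the inverse counts of the items of an action. -/
noncomputable def invCount (I : Setup d Ω) (a : Finset (Fin d)) (t : ℕ) (ω : Ω) : ℝ :=
  ∑ i ∈ a, (1 : ℝ) / I.count t ω i

lemma value_sample (I : Setup d Ω) {a : Finset (Fin d)} {t : ℕ} {ω : Ω}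
    (hN : ∀ i ∈ a, 1 ≤ I.count t ω i) :
    value (I.sample t ω) a = value I.μ a + ∑ i ∈ a, I.dev t ω i / I.count t ω i
      + ∑ i ∈ a, I.σ * √(2 * I.boostAt t / I.count t ω i) * I.Z t ω i := by
  unfold value
  rw [← Finset.sum_add_distrib, ← Finset.sum_add_distrib]
  refine Finset.sum_congr rfl fun i hi => ?_
  have h0 : (0 : ℝ) < I.count t ω i := by exact_mod_cast hN i hi
  have h1 : I.sample t ω i = (I.hist t ω).total i / I.count t ω i
      + I.σ * √(2 * I.boostAt t / I.count t ω i) * I.Z t ω i := by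
    simp only [sample, thompson, Stats.mean, boostAt, count]
  rw [h1, dev]
  congr 1
  field_simp
  ring

/-- Cauchy–Schwarz against the whole Gaussian vector: one norm bound controls all actions at once,
without a union bound over the action set. -/
lemma abs_gaussian_part_le (I : Setup d Ω) (hσ : 0 ≤ I.σ) {a : Finset (Fin d)} {t : ℕ} {ω : Ω}
    (hg : 0 ≤ I.boostAt t) {y : ℝ} (hy : ∑ i, I.Z t ω i ^ 2 ≤ y) :
    |∑ i ∈ a, I.σ * √(2 * I.boostAt t / I.count t ω i) * I.Z t ω i|
      ≤ I.σ * √(2 * I.boostAt t * y * I.invCount a t ω) := by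
  have hcs := Finset.sum_mul_sq_le_sq_mul_sq a
    (fun i => √(2 * I.boostAt t / I.count t ω i)) (fun i => I.Z t ω i)
  have e1 : ∑ i ∈ a, √(2 * I.boostAt t / I.count t ω i) ^ 2
      = 2 * I.boostAt t * I.invCount a t ω := by
    unfold invCount
    rw [Finset.mul_sum]
    refine Finset.sum_congr rfl fun i _ => ?_
    rw [Real.sq_sqrt (by positivity)]
    ring
  have e2 : ∑ i ∈ a, I.Z t ω i ^ 2 ≤ y := (Finset.sum_le_sum_of_subset_of_nonneg
    (Finset.subset_univ a) fun i _ _ => sq_nonneg _).trans hy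
  have e3 : 0 ≤ I.invCount a t ω := Finset.sum_nonneg fun i _ => by positivity
  simp_rw [mul_assoc I.σ]
  rw [← Finset.mul_sum, abs_mul, abs_of_nonneg hσ]
  gcongr
  apply Real.abs_le_sqrt
  refine hcs.trans ?_
  rw [e1]
  calc 2 * I.boostAt t * I.invCount a t ω * ∑ i ∈ a, I.Z t ω i ^ 2
      ≤ 2 * I.boostAt t * I.invCount a t ω * y := by gcongr
    _ = _ := by ring

lemma abs_sum_dev_div_le (I : Setup d Ω) {a : Finset (Fin d)} {t : ℕ} {ω : Ω}
    (hN : ∀ i ∈ a, 1 ≤ I.count t ω i) {ε : ℝ}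
    (hdev : ∀ i ∈ a, |I.dev t ω i| ≤ ε * I.count t ω i) :
    |∑ i ∈ a, I.dev t ω i / I.count t ω i| ≤ a.card * ε := by
  refine (Finset.abs_sum_le_sum_abs _ _).trans ?_
  rw [← nsmul_eq_mul, ← Finset.sum_const]
  refine Finset.sum_le_sum fun i hi => ?_
  have h0 : (0 : ℝ) < I.count t ω i := by exact_mod_cast hN i hi
  rw [abs_div, abs_of_pos h0, div_le_iff₀ h0]
  exact hdev i hi

/-- The accuracy at which items are estimated well enough. -/
noncomputable def accuracy (I : Setup d Ω) : ℝ := minGap I.𝒜 I.μ / (8 * maxSize I.𝒜)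

lemma card_mul_accuracy_le (hD : 0 < minGap I.𝒜 I.μ) (hm : 2 ≤ maxSize I.𝒜)
    {a : Finset (Fin d)} (ha : a ∈ I.𝒜) : a.card * I.accuracy ≤ minGap I.𝒜 I.μ / 8 := by
  have h1 : (a.card : ℝ) ≤ maxSize I.𝒜 := by exact_mod_cast I.card_le_maxSize ha
  have h2 : (0 : ℝ) < maxSize I.𝒜 := by exact_mod_cast (by omega : 0 < maxSize I.𝒜)
  calc a.card * I.accuracy ≤ maxSize I.𝒜 * I.accuracy := by
        unfold accuracy; gcongr
    _ = minGap I.𝒜 I.μ / 8 := by unfold accuracy; field_simp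

/-- The Thompson sample of an action with many accurate observations is accurate. -/
lemma abs_value_sample_sub_le (hD : 0 < minGap I.𝒜 I.μ) (hm : 2 ≤ maxSize I.𝒜) (hσ : 0 ≤ I.σ)
    {a : Finset (Fin d)} (ha : a ∈ I.𝒜) {t : ℕ} {ω : Ω} (hg : 0 ≤ I.boostAt t) {y : ℝ}
    (hy : ∑ i, I.Z t ω i ^ 2 ≤ y) {n : ℕ} (hn : 1 ≤ n)
    (hnum : I.σ * √(2 * I.boostAt t * y * (maxSize I.𝒜 / n)) ≤ minGap I.𝒜 I.μ / 8)
    (hN : ∀ i ∈ a, n ≤ I.count t ω i)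
    (hdev : ∀ i ∈ a, |I.dev t ω i| ≤ I.accuracy * I.count t ω i) :
    |value (I.sample t ω) a - value I.μ a| ≤ minGap I.𝒜 I.μ / 4 := by
  have hN1 : ∀ i ∈ a, 1 ≤ I.count t ω i := fun i hi => hn.trans (hN i hi)
  have h1 := (I.abs_sum_dev_div_le hN1 hdev).trans (card_mul_accuracy_le hD hm ha)
  have h2 := I.abs_gaussian_part_le hσ (a := a) hg hy
  have h3 : I.invCount a t ω ≤ maxSize I.𝒜 / n := by
    have hn0 : (0 : ℝ) < n := by exact_mod_cast hn
    calc I.invCount a t ω ≤ ∑ i ∈ a, (1 : ℝ) / n := by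
          refine Finset.sum_le_sum fun i hi => ?_
          have : (n : ℝ) ≤ I.count t ω i := by exact_mod_cast hN i hi
          gcongr
      _ = a.card / n := by rw [Finset.sum_const, nsmul_eq_mul]; ring
      _ ≤ _ := by
          gcongr
          exact I.card_le_maxSize ha
  have hy0 : 0 ≤ y := (Finset.sum_nonneg fun i _ => sq_nonneg (I.Z t ω i)).trans hy
  have h4 : I.σ * √(2 * I.boostAt t * y * I.invCount a t ω)
      ≤ I.σ * √(2 * I.boostAt t * y * (maxSize I.𝒜 / n)) := by gcongr
  rw [I.value_sample hN1]
  have h5 := abs_add_le (∑ i ∈ a, I.dev t ω i / I.count t ω i)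
    (∑ i ∈ a, I.σ * √(2 * I.boostAt t / I.count t ω i) * I.Z t ω i)
  calc _ = |∑ i ∈ a, I.dev t ω i / I.count t ω i
        + ∑ i ∈ a, I.σ * √(2 * I.boostAt t / I.count t ω i) * I.Z t ω i| := by
        congr 1; ring
    _ ≤ _ := by linarith

/-- The gap of the action played in a good round is charged to its items. -/
lemma gap_play_le_sum_charge (hn : I.𝒜.Nontrivial) (hu : UniqueOptimal I.𝒜 I.μ)
    (hsel : IsArgmaxOracle I.𝒜 I.sel) (hinit : IsInitialization I.𝒜 I.init)
    (hm : 2 ≤ maxSize I.𝒜) (hσ : 0 < I.σ) {a : Finset (Fin d)} (ha : I.IsOptimal a) {t : ℕ}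
    (ht : I.init.length ≤ t) {ω : Ω} (hg : 0 ≤ I.boostAt t) {y L : ℝ}
    (hL : 8 * I.σ ^ 2 * I.boostAt t * y ≤ L) (hL0 : 0 < L)
    (hy : ∑ i, I.Z t ω i ^ 2 ≤ y) {n : ℕ} (hn1 : 1 ≤ n)
    (hnum : I.σ * √(2 * I.boostAt t * y * (maxSize I.𝒜 / n)) ≤ minGap I.𝒜 I.μ / 8)
    (hN : ∀ i ∈ a, n ≤ I.count t ω i)
    (hdev : ∀ i ∈ a, |I.dev t ω i| ≤ I.accuracy * I.count t ω i)
    (hplay : ∀ i ∈ I.play t ω, |I.dev t ω i| ≤ I.accuracy * I.count t ω i) :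
    gap I.𝒜 I.μ (I.play t ω)
      ≤ ∑ i ∈ I.play t ω, charge L (minGap I.𝒜 I.μ) (maxSize I.𝒜) (I.count t ω i) := by
  have hD := ha.minGap_pos hn hu
  set b := I.play t ω with hb
  have hbA : b ∈ I.𝒜 := play_mem hsel hinit t ω
  rcases eq_or_ne b a with hba | hba
  · rw [hba, ha.gap_self]
    exact Finset.sum_nonneg fun i _ => charge_nonneg hL0.le hD.le _ _
  have hN1 : ∀ i ∈ b, 1 ≤ I.count t ω i := fun i _ => one_le_count hinit ht ω i
  have hgap := I.minGap_le_gap hbA (ha.gap_pos hu hbA hba)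
  have h1 := (abs_le.1 (abs_value_sample_sub_le hD hm hσ.le ha.1 hg hy hn1 hnum hN hdev)).1
  have h2 : value (I.sample t ω) a ≤ value (I.sample t ω) b := by
    rw [hb, I.play_of_length_le ht]
    exact hsel.le _ a ha.1
  have h3 := (le_abs_self _).trans ((I.abs_sum_dev_div_le hN1 hplay).trans
    (card_mul_accuracy_le hD hm hbA))
  have h4 := (le_abs_self _).trans (I.abs_gaussian_part_le hσ.le (a := b) hg hy)
  rw [I.value_sample hN1] at h2
  have h5 : gap I.𝒜 I.μ b = value I.μ a - value I.μ b := by rw [gap, ha.optValue_eq]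
  -- The errors `Δ_min / 4` for the optimal action and `Δ_min / 8` for the empirical means of `b`
  -- are at most three eighths of the gap, hence absorbed by the factor 2.
  have h6 : gap I.𝒜 I.μ b ≤ 2 * (I.σ * √(2 * I.boostAt t * y * I.invCount b t ω)) := by
    linarith
  have hV : 0 ≤ I.invCount b t ω := Finset.sum_nonneg fun i _ => by positivity
  have hy0 : 0 ≤ y := (Finset.sum_nonneg fun i _ => sq_nonneg (I.Z t ω i)).trans hy
  refine le_sum_charge hL0 hD hgap hN1 (I.card_le_maxSize hbA) ?_
  calc gap I.𝒜 I.μ b ^ 2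
      ≤ (2 * (I.σ * √(2 * I.boostAt t * y * I.invCount b t ω))) ^ 2 := by
        have := hD.trans_le hgap
        gcongr
    _ = 8 * I.σ ^ 2 * I.boostAt t * y * I.invCount b t ω := by
        rw [mul_pow, mul_pow, Real.sq_sqrt (by positivity)]
        ring
    _ ≤ L * I.invCount b t ω := by gcongr

open Classical in
/-- Enough optimistic rounds force enough plays of the optimal action. -/
lemma le_count_of_optimistic (hn : I.𝒜.Nontrivial) (hu : UniqueOptimal I.𝒜 I.μ)
    (hsel : IsArgmaxOracle I.𝒜 I.sel) (hinit : IsInitialization I.𝒜 I.init)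
    (hm : 2 ≤ maxSize I.𝒜) (hσ : 0 < I.σ) {a : Finset (Fin d)} (ha : I.IsOptimal a) {r t : ℕ}
    (hr : I.init.length ≤ r) {ω : Ω} {y : ℝ} {n : ℕ} (hn1 : 1 ≤ n)
    (hg : ∀ s ∈ Finset.Ico r t, 0 ≤ I.boostAt s)
    (hy : ∀ s ∈ Finset.Ico r t, ∑ i, I.Z s ω i ^ 2 ≤ y)
    (hnum : ∀ s ∈ Finset.Ico r t,
      I.σ * √(2 * I.boostAt s * y * (maxSize I.𝒜 / n)) ≤ minGap I.𝒜 I.μ / 8)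
    (hdev : ∀ s ∈ Finset.Ico r t, ∀ i, n ≤ I.count s ω i →
      |I.dev s ω i| ≤ I.accuracy * I.count s ω i)
    (hopt : (d + 1) * n
      < ((Finset.Ico r t).filter fun s => value I.μ a ≤ value (I.sample s ω) a).card)
    {i : Fin d} (hi : i ∈ a) : n ≤ I.count t ω i := by
  have hD := ha.minGap_pos hn hu
  -- In an optimistic round, a suboptimal action with all counts at least `n` would have a sample at
  -- most `Δ_min / 4` above its mean, below that of `a`. So either `a` is played, or an item with
  -- count below `n` gains an observation, which happens at most `n` times per item.
  have hsub : ((Finset.Ico r t).filter fun s => value I.μ a ≤ value (I.sample s ω) a)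
      ⊆ ((Finset.range t).filter fun s => I.play s ω = a)
        ∪ Finset.univ.biUnion fun i : Fin d =>
          (Finset.range t).filter fun s => i ∈ I.play s ω ∧ I.count s ω i < n := by
    intro s hs
    rw [Finset.mem_filter] at hs
    obtain ⟨hs, hso⟩ := hs
    have hs' := Finset.mem_Ico.1 hs
    simp only [Finset.mem_union, Finset.mem_filter, Finset.mem_range, Finset.mem_biUnion,
      Finset.mem_univ, true_and, hs'.2]
    by_contra hcon
    push Not at hcon
    have hbA : I.play s ω ∈ I.𝒜 := play_mem hsel hinit s ω
    have h1 := (abs_le.1 (abs_value_sample_sub_le hD hm hσ.le hbA (hg s hs) (hy s hs) hn1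
      (hnum s hs) hcon.2 fun i hi => hdev s hs i (hcon.2 i hi))).2
    have h2 : value (I.sample s ω) a ≤ value (I.sample s ω) (I.play s ω) := by
      rw [I.play_of_length_le (hr.trans hs'.1)]
      exact hsel.le _ a ha.1
    have h3 := I.minGap_le_gap hbA (ha.gap_pos hu hbA hcon.1)
    rw [gap, ha.optValue_eq] at h3
    linarith
  have hcard := (Finset.card_le_card hsub).trans (Finset.card_union_le _ _)
  have h1 : (Finset.univ.biUnion fun i : Fin d =>
      (Finset.range t).filter fun s => i ∈ I.play s ω ∧ I.count s ω i < n).card ≤ d * n := by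
    refine Finset.card_biUnion_le.trans ((Finset.sum_le_sum fun i _ =>
      I.card_play_lt_le n t ω i).trans ?_)
    simp
  have h2 := I.card_play_eq_le_count t ω hi
  have h3 : (d + 1) * n = d * n + n := by ring
  omega

/-! ### Optimism -/

/-- The event that the optimal action is not heavily underestimated before round `t + 1`. -/
def moderate (I : Setup d Ω) (a : Finset (Fin d)) (t : ℕ) : Set Ω :=
  {ω | -(I.σ * √(2 * (4 / 3 * explore 1 (maxSize I.𝒜) ((t + 1 : ℕ) : ℝ)) * I.invCount a t ω))
    ≤ ∑ i ∈ a, I.dev t ω i / I.count t ω i}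

/-- The event that the sample of round `t + 1` does not underestimate an action. -/
def optimistic (I : Setup d Ω) (a : Finset (Fin d)) (t : ℕ) : Set Ω :=
  {ω | value I.μ a ≤ value (I.sample t ω) a}

lemma boostAt_mul_log {t : ℕ} (ht : 2 ≤ t + 1) :
    I.boostAt t * Real.log ((t + 1 : ℕ) : ℝ) = explore 1 (maxSize I.𝒜) ((t + 1 : ℕ) : ℝ) := by
  have : 0 < Real.log ((t + 1 : ℕ) : ℝ) := Real.log_pos (by exact_mod_cast ht)
  rw [boostAt, boost, div_mul_cancel₀ _ this.ne']

variable [mΩ : MeasurableSpace Ω] {P : Measure Ω}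

lemma IsValid.measurable_inv_count (hI : I.IsValid P) (t : ℕ) (i : Fin d) :
    Measurable[I.info t t] fun ω => (1 : ℝ) / I.count t ω i :=
  (measurable_from_top (f := fun n : ℕ => (1 : ℝ) / n)).comp (hI.measurable_count t i)

lemma IsValid.measurableSet_moderate (hI : I.IsValid P) (a : Finset (Fin d)) (t : ℕ) :
    MeasurableSet[I.info t t] (I.moderate a t) := by
  have h1 := hI.measurable_inv_count t
  have h2 := hI.measurable_dev t
  have h3 : ∀ i, Measurable[I.info t t] fun ω => I.dev t ω i / (I.count t ω i : ℝ) := by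
    intro i
    simp_rw [div_eq_mul_one_div (I.dev t _ i)]
    have h1 := h1 i
    have h2 := h2 i
    let _ := I.info t t
    exact h2.mul h1
  let _ := I.info t t
  unfold moderate invCount
  exact measurableSet_le (by fun_prop) (by fun_prop)

lemma IsValid.measurableSet_optimistic (hI : I.IsValid P) (a : Finset (Fin d)) (t : ℕ) :
    MeasurableSet[I.info (t + 1) (t + 1)] (I.optimistic a t) := by
  have h1 := (hI.measurable_sample t).mono (I.info_mono (Nat.le_succ t) le_rfl) le_rfl
  let _ := I.info (t + 1) (t + 1)
  unfold optimistic value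
  exact measurableSet_le (by fun_prop) (by fun_prop)

/-- On `moderate` the empirical value is too low by at most `√(4/3 ln (t + 1))` standard deviations
of the sample, because `f = g ln`. With `w_i = √(1 / N_i)` on the items of `a`, the Gaussian part of
the sample is a multiple of `∑ w_i Z_i`, so a single one-dimensional tail event yields optimism. -/
lemma IsValid.optimism [IsProbabilityMeasure P] (hI : I.IsValid P) {a : Finset (Fin d)} {t : ℕ}
    (ht : I.init.length ≤ t) (ht2 : 2 ≤ t + 1) (hg : 0 ≤ I.boostAt t) {y : ℝ}
    (hy : √(4 / 3 * Real.log ((t + 1 : ℕ) : ℝ)) ≤ y) {W : Ω → ENNReal}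
    (hW : Measurable[I.info t t] W) :
    gaussianReal 0 1 (Set.Ici y) * ∫⁻ ω in I.moderate a t, W ω ∂P
      ≤ ∫⁻ ω in I.moderate a t ∩ I.optimistic a t, W ω ∂P := by
  set E := I.moderate a t with hE
  have hEm : MeasurableSet[I.info t t] E := hI.measurableSet_moderate a t
  have hEm' : MeasurableSet E := hI.info_le t t _ hEm
  have hOm : MeasurableSet (I.optimistic a t) :=
    hI.info_le _ _ _ (hI.measurableSet_optimistic a t)
  set ℓ := Real.log ((t + 1 : ℕ) : ℝ) with hℓ
  have hℓ0 : 0 < ℓ := Real.log_pos (by exact_mod_cast ht2)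
  set w : Ω → Fin d → ℝ := fun ω i => if i ∈ a then √(1 / I.count t ω i) else 0 with hw
  have hwm : Measurable[I.info t t] w := by
    refine @measurable_pi_lambda _ _ _ (I.info t t) _ _ fun i => ?_
    by_cases hi : i ∈ a
    · simp only [hw, hi, if_true]
      exact Real.continuous_sqrt.measurable.comp (hI.measurable_inv_count t i)
    · simp only [hw, hi, if_false]
      exact @measurable_const _ _ _ (I.info t t) _
  have h1 := hI.gaussian_tail_mul_lintegral_le t (hW.indicator hEm) hwm (√(4 / 3 * ℓ))
  rw [lintegral_indicator hEm', lintegral_indicator hEm', Measure.restrict_restrict hEm'] at h1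
  refine (mul_le_mul' (measure_mono (Set.Ici_subset_Ici.2 hy)) le_rfl).trans (h1.trans ?_)
  refine lintegral_mono_set ?_
  rintro ω ⟨h2, h3⟩
  refine ⟨h2, ?_⟩
  simp only [Set.mem_ofPred_eq] at h3
  have hN : ∀ i ∈ a, 1 ≤ I.count t ω i := fun i _ => one_le_count hI.initial ht ω i
  simp only [optimistic, Set.mem_ofPred_eq]
  rw [I.value_sample hN]
  have e1 : ∑ i, w ω i ^ 2 = I.invCount a t ω := by
    unfold invCount
    rw [← Finset.sum_ite_mem_eq a]
    refine Finset.sum_congr rfl fun i _ => ?_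
    simp only [hw]
    split_ifs
    · rw [Real.sq_sqrt (by positivity)]
    · simp
  have e2 : ∑ i ∈ a, I.σ * √(2 * I.boostAt t / I.count t ω i) * I.Z t ω i
      = I.σ * √(2 * I.boostAt t) * ∑ i, w ω i * I.Z t ω i := by
    rw [Finset.mul_sum, ← Finset.sum_ite_mem_eq a]
    refine Finset.sum_congr rfl fun i _ => ?_
    simp only [hw]
    split_ifs
    · rw [div_eq_mul_one_div, Real.sqrt_mul (by positivity)]
      ring
    · simp
  have hV : 0 ≤ I.invCount a t ω := Finset.sum_nonneg fun i _ => by positivity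
  rw [e1] at h3
  have h4 : I.σ * √(2 * (4 / 3 * explore 1 (maxSize I.𝒜) ((t + 1 : ℕ) : ℝ)) * I.invCount a t ω)
      = I.σ * √(2 * I.boostAt t) * (√(4 / 3 * ℓ) * √(I.invCount a t ω)) := by
    rw [← boostAt_mul_log ht2, mul_assoc I.σ, ← Real.sqrt_mul (by positivity),
      ← Real.sqrt_mul (by positivity)]
    congr 2
    ring
  have h5 : I.σ * √(2 * I.boostAt t) * (√(4 / 3 * ℓ) * √(I.invCount a t ω))
      ≤ I.σ * √(2 * I.boostAt t) * ∑ i, w ω i * I.Z t ω i := by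
    have := hI.pos
    gcongr
  have h6 : -(I.σ * √(2 * (4 / 3 * explore 1 (maxSize I.𝒜) ((t + 1 : ℕ) : ℝ))
      * I.invCount a t ω)) ≤ ∑ i ∈ a, I.dev t ω i / I.count t ω i := h2
  rw [e2]
  linarith

end Setup

end SemiBandit

namespace SemiBandit

/-! ### Estimates of the exploration function -/

lemma one_le_log {x : ℝ} (hx : 3 ≤ x) : 1 ≤ Real.log x := by
  rw [Real.le_log_iff_exp_le (by linarith)]
  linarith [Real.exp_one_lt_d9]

lemma log_one_add_exp_one_mem : Real.log (1 + Real.exp 1 / 1) ∈ Set.Icc (1 : ℝ) 2 := by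
  rw [div_one]
  have h1 := Real.exp_one_gt_d9
  constructor
  · rw [Real.le_log_iff_exp_le (by positivity)]
    linarith
  · rw [Real.log_le_iff_le_exp (by positivity)]
    have : Real.exp 2 = Real.exp 1 * Real.exp 1 := by rw [← Real.exp_add]; norm_num
    rw [this]
    nlinarith

lemma explore_mono (m : ℕ) {x y : ℝ} (hx : 3 ≤ x) (hxy : x ≤ y) :
    explore 1 m x ≤ explore 1 m y := by
  have h1 := one_le_log hx
  have h2 : Real.log x ≤ Real.log y := Real.log_le_log (by linarith) hxy
  have h3 : Real.log (Real.log x) ≤ Real.log (Real.log y) := Real.log_le_log (by linarith) h2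
  unfold explore
  gcongr

lemma explore_nonneg (m : ℕ) {x : ℝ} (hx : 3 ≤ x) : 0 ≤ explore 1 m x := by
  have h1 := one_le_log hx
  have h2 := Real.log_nonneg h1
  have h3 := log_one_add_exp_one_mem.1
  have h4 : (0 : ℝ) ≤ (m + 2) * Real.log (Real.log x) := by positivity
  have h5 : (0 : ℝ) ≤ m / 2 * Real.log (1 + Real.exp 1 / 1) := by positivity
  unfold explore
  linarith

lemma explore_le {m : ℕ} (hm : 2 ≤ m) {x : ℝ} (hx : 3 ≤ x) :
    explore 1 m x ≤ 2 * (Real.log x + 2 * m * Real.log (Real.log x) + m) := by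
  have h1 := one_le_log hx
  have h2 := Real.log_nonneg h1
  have h3 := log_one_add_exp_one_mem.2
  have hm' : (2 : ℝ) ≤ m := by exact_mod_cast hm
  unfold explore
  nlinarith

lemma boost_nonneg (m : ℕ) {x : ℝ} (hx : 3 ≤ x) : 0 ≤ boost 1 m x :=
  div_nonneg (explore_nonneg m hx) (by linarith [one_le_log hx])

lemma boost_le {m : ℕ} (hm : 2 ≤ m) {x : ℝ} (hx : 3 ≤ x) : boost 1 m x ≤ 8 * m := by
  have h1 := one_le_log hx
  have h2 := Real.log_le_sub_one_of_pos (x := Real.log x) (by linarith)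
  have hm' : (2 : ℝ) ≤ m := by exact_mod_cast hm
  rw [boost, div_le_iff₀ (by linarith)]
  refine (explore_le hm hx).trans ?_
  nlinarith

lemma exp_neg_le_factorial_div {x : ℝ} (hx : 0 < x) (k : ℕ) :
    Real.exp (-x) ≤ k.factorial / x ^ k := by
  have h := Real.pow_div_factorial_le_exp x hx.le k
  rw [Real.exp_neg, inv_le_comm₀ (Real.exp_pos _) (by positivity), inv_div]
  exact h

lemma exp_eight_le : Real.exp 8 ≤ 2 ^ 17 := by
  have h1 := Real.exp_one_lt_d9
  have h2 : Real.exp 8 = Real.exp 1 ^ 8 := by rw [← Real.exp_nat_mul]; norm_num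
  rw [h2]
  calc Real.exp 1 ^ 8 ≤ 3 ^ 8 := by
        gcongr
        linarith
    _ ≤ 2 ^ 17 := by norm_num

/-- For `ℓ = ln (t + 1)` the left side is a constant times `(t + 1)^(-3/4)`; it is written with the
16-th root because later estimates are in powers of `root t`. -/
lemma gaussian_tail_log_ge {ℓ : ℝ} (hℓ : 0 ≤ ℓ) :
    ENNReal.ofReal (1 / (512 * Real.exp (ℓ / 16) ^ 12))
      ≤ gaussianReal 0 1 (Set.Ici √(4 / 3 * ℓ)) := by
  refine le_trans (ENNReal.ofReal_le_ofReal ?_) (gaussian_tail_ge (Real.sqrt_nonneg _))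
  set y := √(4 / 3 * ℓ) with hy
  have hy2 : y ^ 2 = 4 / 3 * ℓ := Real.sq_sqrt (by positivity)
  -- The leading part is `y² / 2 = 2ℓ / 3`, and `y ≤ y² / 16 + 4 = ℓ / 12 + 4` raises the
  -- coefficient to `3 / 4`, still below 1.
  have h1 : -(3 / 4 * ℓ + 9 / 2) ≤ -(y + 1) ^ 2 / 2 := by
    nlinarith [sq_nonneg (y - 8)]
  have h2 : (Real.exp 1)⁻¹ ≤ (√(2 * Real.pi))⁻¹ := by
    gcongr
    apply Real.sqrt_le_iff.2
    refine ⟨(Real.exp_pos _).le, ?_⟩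
    have := Real.exp_one_gt_d9
    have := Real.pi_lt_d2
    nlinarith
  have h3 : Real.exp (11 / 2) ≤ 512 := by
    calc Real.exp (11 / 2) ≤ Real.exp 6 := Real.exp_le_exp.2 (by norm_num)
      _ = Real.exp 1 ^ 6 := by rw [← Real.exp_nat_mul]; norm_num
      _ ≤ (2.72 : ℝ) ^ 6 := by
          gcongr
          linarith [Real.exp_one_lt_d9]
      _ ≤ 512 := by norm_num
  calc 1 / (512 * Real.exp (ℓ / 16) ^ 12)
      ≤ 1 / (Real.exp (11 / 2) * Real.exp (ℓ / 16) ^ 12) := by gcongr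
    _ = (Real.exp 1)⁻¹ * Real.exp (-(3 / 4 * ℓ + 9 / 2)) := by
        rw [one_div, ← Real.exp_nat_mul, ← Real.exp_add, ← Real.exp_neg, ← Real.exp_neg,
          ← Real.exp_add]
        congr 1
        push_cast
        ring
    _ ≤ _ := by gcongr

/-! ### Late rounds, measured by the sixteenth root of time -/

namespace Setup

variable {d : ℕ} {Ω : Type*} {I : Setup d Ω}

lemma boostAt_nonneg (I : Setup d Ω) {t : ℕ} (ht : 2 ≤ t) : 0 ≤ I.boostAt t :=
  boost_nonneg _ (by exact_mod_cast (by omega : 3 ≤ t + 1))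

lemma boostAt_le (hm : 2 ≤ maxSize I.𝒜) {t : ℕ} (ht : 2 ≤ t) : I.boostAt t ≤ 8 * maxSize I.𝒜 :=
  boost_le hm (by exact_mod_cast (by omega : 3 ≤ t + 1))

/-- A bound for all the parameters of a run. -/
noncomputable def size (I : Setup d Ω) : ℝ :=
  1 + maxSize I.𝒜 + d + 1 / minGap I.𝒜 I.μ + I.σ

lemma size_bounds (hD : 0 < minGap I.𝒜 I.μ) (hσ : 0 < I.σ) :
    1 ≤ I.size ∧ (maxSize I.𝒜 : ℝ) ≤ I.size ∧ (d : ℝ) ≤ I.size ∧ 1 + (d : ℝ) ≤ I.size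
      ∧ 1 / minGap I.𝒜 I.μ ≤ I.size ∧ I.σ ≤ I.size := by
  have h1 : (0 : ℝ) ≤ maxSize I.𝒜 := by positivity
  have h2 : (0 : ℝ) ≤ d := by positivity
  have h3 : 0 < 1 / minGap I.𝒜 I.μ := by positivity
  unfold size
  refine ⟨?_, ?_, ?_, ?_, ?_, ?_⟩ <;> linarith

/-- The 16-th root of `t + 1`. -/
noncomputable def root (t : ℕ) : ℝ := Real.exp (Real.log ((t + 1 : ℕ) : ℝ) / 16)

lemma root_pow (t : ℕ) : root t ^ 16 = t + 1 := by
  rw [root, ← Real.exp_nat_mul]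
  push_cast
  rw [mul_div_cancel₀ _ (by norm_num), Real.exp_log (by positivity)]

lemma root_pos (t : ℕ) : 0 < root t := Real.exp_pos _

lemma log_le_root (t : ℕ) : Real.log ((t + 1 : ℕ) : ℝ) ≤ 16 * root t := by
  have := Real.add_one_le_exp (Real.log ((t + 1 : ℕ) : ℝ) / 16)
  unfold root
  linarith

/-- A threshold for the squared norm of the Gaussian vector of round `t + 1`. -/
noncomputable def radius (d t : ℕ) : ℝ := 4 * (3 * Real.log ((t + 1 : ℕ) : ℝ) + d)

/-- A number of observations that is sufficient in round `t + 1`. -/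
noncomputable def enough (t : ℕ) : ℕ := ⌈root t ^ 2⌉₊

/-- The round is late compared with the parameters. -/
def IsLate (I : Setup d Ω) (t : ℕ) : Prop := 2 ^ 18 * I.size ^ 7 ≤ root t

lemma IsLate.size_le (hD : 0 < minGap I.𝒜 I.μ) (hσ : 0 < I.σ) {t : ℕ} (ht : I.IsLate t) :
    2 ^ 18 * I.size ≤ root t := by
  have h1 := (size_bounds hD hσ).1
  refine le_trans ?_ ht
  have : I.size ^ 1 ≤ I.size ^ 7 := pow_le_pow_right₀ h1 (by norm_num)
  linarith

lemma IsLate.le (hD : 0 < minGap I.𝒜 I.μ) (hσ : 0 < I.σ) {t : ℕ} (ht : I.IsLate t) :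
    2 ^ 18 * I.size ≤ (t : ℝ) + 1 := by
  have h1 := ht.size_le hD hσ
  have h2 := (size_bounds hD hσ).1
  rw [← root_pow]
  refine h1.trans (le_self_pow₀ ?_ (by norm_num))
  nlinarith

lemma IsLate.le_half (hD : 0 < minGap I.𝒜 I.μ) (hσ : 0 < I.σ) {s t : ℕ} (ht : I.IsLate t)
    (hs : t / 2 ≤ s) : ((t : ℝ) + 1) / 2 ≤ s + 1 ∧ 2 ^ 17 * I.size ≤ (s : ℝ) + 1 ∧ d ≤ s
      ∧ 2 ≤ s := by
  have h1 := ht.le hD hσ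
  have h2 : ((t : ℝ) + 1) / 2 ≤ s + 1 := by
    have : t + 1 ≤ 2 * (s + 1) := by omega
    have h3 : ((t : ℝ) + 1) ≤ 2 * (s + 1) := by exact_mod_cast this
    linarith
  obtain ⟨b1, _, _, b4, _⟩ := size_bounds hD hσ
  have h3 : 2 ^ 17 * I.size ≤ (s : ℝ) + 1 := by linarith
  refine ⟨h2, h3, ?_, ?_⟩
  · have : (d : ℝ) ≤ s := by linarith
    exact_mod_cast this
  · have : (2 : ℝ) ≤ s := by linarith
    exact_mod_cast this

lemma one_le_enough (t : ℕ) : 1 ≤ enough t := Nat.ceil_pos.2 (by have := root_pos t; positivity)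

lemma le_enough (t : ℕ) : root t ^ 2 ≤ enough t := Nat.le_ceil _

lemma IsLate.enough_le (hD : 0 < minGap I.𝒜 I.μ) (hσ : 0 < I.σ) {t : ℕ} (ht : I.IsLate t) :
    (enough t : ℝ) ≤ 2 * root t ^ 2 := by
  have h1 := ht.size_le hD hσ
  have h2 := (size_bounds hD hσ).1
  have h3 := (Nat.ceil_lt_add_one (sq_nonneg (root t))).le
  have h4 : (1 : ℝ) ≤ root t ^ 2 := one_le_pow₀ (by linarith)
  unfold enough
  linarith

/-- The boost is at most `8m`, the radius is of order `size * root t`, and `enough t ≥ root t ^ 2`,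
so the quantity under the root decays like `size ^ 3 / root t`. Comparison with the square of `Δ_min
/ (8 * size)` dictates the threshold `2 ^ 18 * size ^ 7` in `IsLate`. -/
lemma IsLate.gaussian_part_le (hD : 0 < minGap I.𝒜 I.μ) (hσ : 0 < I.σ) (hm : 2 ≤ maxSize I.𝒜)
    {s t : ℕ} (ht : I.IsLate t) (hs : 2 ≤ s) :
    I.σ * √(2 * I.boostAt s * radius d t * (maxSize I.𝒜 / enough t)) ≤ minGap I.𝒜 I.μ / 8 := by
  obtain ⟨b1, b2, b3, b4, b5, b6⟩ := size_bounds hD hσ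
  set B := I.size with hB
  set v := root t with hv
  set D := minGap I.𝒜 I.μ with hDdef
  set M := (maxSize I.𝒜 : ℝ) with hM
  have hM0 : 0 ≤ M := by positivity
  have hv18 : 2 ^ 18 * B ≤ v := ht.size_le hD hσ
  have hv1 : 1 ≤ v := by nlinarith
  have hrad : radius d t ≤ 196 * B * v := by
    have := log_le_root t
    have hd : (d : ℝ) ≤ B * v := b3.trans (le_mul_of_one_le_right (by linarith) hv1)
    have hv' : v ≤ B * v := le_mul_of_one_le_left (by linarith) b1
    unfold radius
    linarith
  have hrad0 : 0 ≤ radius d t := by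
    have : 0 ≤ Real.log ((t + 1 : ℕ) : ℝ) := Real.log_natCast_nonneg _
    unfold radius
    positivity
  have hen := le_enough t
  have hv0 : 0 < v := by linarith
  have h1 : 2 * I.boostAt s * radius d t * (M / enough t) ≤ 3136 * B ^ 3 / v := by
    calc 2 * I.boostAt s * radius d t * (M / enough t)
        ≤ 2 * (8 * B) * (196 * B * v) * (B / v ^ 2) := by
          have hg := boostAt_le (I := I) hm hs
          have hg0 := I.boostAt_nonneg hs
          have hg' : I.boostAt s ≤ 8 * B := hg.trans (by linarith)
          gcongr
      _ = 3136 * B ^ 3 / v := by field_simp; ring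
  have h2 : 1 ≤ B * D := by
    rw [div_le_iff₀ hD] at b5
    exact b5
  have h3 : 3136 * B ^ 3 / v ≤ (D / (8 * B)) ^ 2 := by
    rw [div_le_iff₀ hv0, div_pow, div_mul_eq_mul_div, le_div_iff₀ (by positivity)]
    have h4 : 2 ^ 18 * B ^ 7 ≤ v := ht
    calc 3136 * B ^ 3 * (8 * B) ^ 2 = 200704 * B ^ 5 * 1 ^ 2 := by ring
      _ ≤ 2 ^ 18 * B ^ 5 * (B * D) ^ 2 := by
          gcongr
          norm_num
      _ = D ^ 2 * (2 ^ 18 * B ^ 7) := by ring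
      _ ≤ D ^ 2 * v := by gcongr
  have h5 : √(2 * I.boostAt s * radius d t * (M / enough t)) ≤ D / (8 * B) :=
    Real.sqrt_le_iff.2 ⟨by positivity, h1.trans h3⟩
  calc I.σ * √(2 * I.boostAt s * radius d t * (M / enough t)) ≤ B * (D / (8 * B)) := by gcongr
    _ = D / 8 := by field_simp

/-- The exponential is traded for the power 24, since `(root t ^ 2) ^ 24 = (t + 1) ^ 3`. The rate is
at least `1 / (128 * size ^ 6)`, whence `size ^ 144`. -/
lemma exp_accuracy_le (hD : 0 < minGap I.𝒜 I.μ) (hσ : 0 < I.σ) (hm : 2 ≤ maxSize I.𝒜)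
    (t : ℕ) :
    Real.exp (-(I.accuracy ^ 2 / (2 * I.σ ^ 2) * enough t))
      ≤ Nat.factorial 24 * 128 ^ 24 * I.size ^ 144 / (t + 1 : ℝ) ^ 3 := by
  obtain ⟨b1, b2, b3, b4, b5, b6⟩ := size_bounds hD hσ
  set B := I.size with hB
  set c := I.accuracy ^ 2 / (2 * I.σ ^ 2) with hc
  have hM : (0 : ℝ) < maxSize I.𝒜 := by exact_mod_cast (by omega : 0 < maxSize I.𝒜)
  have hc0 : 0 < c := by unfold c accuracy; positivity
  have hcinv : c⁻¹ ≤ 128 * B ^ 6 := by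
    have : c⁻¹ = 128 * (maxSize I.𝒜 : ℝ) ^ 2 * (1 / minGap I.𝒜 I.μ) ^ 2 * I.σ ^ 2 := by
      unfold c accuracy
      field_simp
      norm_num
    rw [this]
    calc 128 * (maxSize I.𝒜 : ℝ) ^ 2 * (1 / minGap I.𝒜 I.μ) ^ 2 * I.σ ^ 2
        ≤ 128 * B ^ 2 * B ^ 2 * B ^ 2 := by gcongr
      _ = 128 * B ^ 6 := by ring
  have hv0 := root_pos t
  have h1 : c * root t ^ 2 ≤ c * enough t := by
    have := le_enough t
    gcongr
  calc Real.exp (-(c * enough t)) ≤ Real.exp (-(c * root t ^ 2)) :=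
        Real.exp_le_exp.2 (by linarith)
    _ ≤ Nat.factorial 24 / (c * root t ^ 2) ^ 24 := exp_neg_le_factorial_div (by positivity) 24
    _ = Nat.factorial 24 * c⁻¹ ^ 24 / (root t ^ 16) ^ 3 := by
        field_simp
    _ ≤ Nat.factorial 24 * (128 * B ^ 6) ^ 24 / (root t ^ 16) ^ 3 := by gcongr
    _ = _ := by rw [root_pow]; ring

/-- With `v = root t`, the expected number of optimistic rounds is of order `v ^ 16 / v ^ 12 = v ^
4`, while about `2 (d + 1) v ^ 2` are needed. For late rounds the difference is at least `v ^ 2`,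
and `(v ^ 2) ^ 16 = (t + 1) ^ 2`. -/
lemma IsLate.exp_optimism_le (hD : 0 < minGap I.𝒜 I.μ) (hσ : 0 < I.σ) {t : ℕ}
    (ht : I.IsLate t) :
    Real.exp ((d + 1) * enough t - 1 / (512 * root t ^ 12) / 2 * (t / 4))
      ≤ Nat.factorial 16 / (t + 1 : ℝ) ^ 2 := by
  obtain ⟨b1, b2, b3, b4, b5, b6⟩ := size_bounds hD hσ
  have hv18 := ht.size_le hD hσ
  have hle := ht.le hD hσ
  have hen := ht.enough_le hD hσ
  set v := root t with hv
  have hv1 : 1 ≤ v := by nlinarith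
  have ht2 : ((t : ℝ) + 1) / 2 ≤ t := by nlinarith
  have h1 : v ^ 4 / 8192 ≤ 1 / (512 * v ^ 12) / 2 * (t / 4) := by
    have h2 : v ^ 16 / 2 ≤ t := by rw [root_pow]; exact ht2
    calc v ^ 4 / 8192 = 1 / (512 * v ^ 12) / 2 * (v ^ 16 / 2 / 4) := by field_simp; norm_num
      _ ≤ _ := by gcongr
  have h3 : (d + 1) * (enough t : ℝ) ≤ (d + 1) * (2 * v ^ 2) := by gcongr
  have h4 : v ≤ v ^ 2 := le_self_pow₀ hv1 (by norm_num)
  have h5 : (d + 1) * (2 * v ^ 2) + v ^ 2 ≤ v ^ 4 / 8192 := by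
    have h6 : 8192 * (2 * (d + 1) + 1) ≤ v ^ 2 := by nlinarith
    have h7 : v ^ 2 * (8192 * (2 * (d + 1) + 1)) ≤ v ^ 2 * v ^ 2 := by gcongr
    nlinarith
  calc Real.exp ((d + 1) * enough t - 1 / (512 * v ^ 12) / 2 * (t / 4))
      ≤ Real.exp (-(v ^ 2)) := Real.exp_le_exp.2 (by linarith)
    _ ≤ Nat.factorial 16 / (v ^ 2) ^ 16 := exp_neg_le_factorial_div (by positivity) 16
    _ = Nat.factorial 16 / (v ^ 16) ^ 2 := by congr 1; ring
    _ = _ := by rw [root_pow]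

end Setup

end SemiBandit

namespace SemiBandit
-- Probability that the optimal action is under-explored
namespace Setup

variable {d : ℕ} {Ω : Type*} [mΩ : MeasurableSpace Ω] {P : Measure Ω} {I : Setup d Ω}

/-- The event that the Gaussian vector of round `s + 1` is unusually large. -/
def wild (I : Setup d Ω) (t s : ℕ) : Set Ω := {ω | radius d t ≤ ∑ i, I.Z s ω i ^ 2}

lemma IsValid.measure_wild_le (hI : I.IsValid P) (s t : ℕ) :
    P (I.wild t s) ≤ ENNReal.ofReal (1 / (t + 1 : ℝ) ^ 3) := by
  refine (hI.measure_gaussian_norm_le s).trans (ENNReal.ofReal_le_ofReal (le_of_eq ?_))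
  rw [Real.exp_neg, one_div]
  congr 1
  have : (3 : ℝ) * Real.log ((t + 1 : ℕ) : ℝ) = (3 : ℕ) * Real.log ((t + 1 : ℕ) : ℝ) := by
    norm_num
  rw [this, Real.exp_nat_mul, Real.exp_log (by positivity)]
  push_cast
  rfl

variable [IsProbabilityMeasure P]

/-- The self-normalized inequality with `K = ⌈3 ln (t + 1)⌉`: the factor `4/3` in `moderate` undoes
the grid's loss of `3/4`, and of the three terms of `f` the first gives `(t + 1)^(-2)`, the second
pays for the `(2K + 2) ^ m` directions, the third for the loss of 1 per item. That `t + 1 ≥ e^8`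
makes `2K + 2` at most `ln² (t + 1)`. -/
lemma IsValid.measure_not_moderate_le (hI : I.IsValid P) {a : Finset (Fin d)} (ha : a ∈ I.𝒜)
    {t : ℕ} (ht : I.init.length ≤ t) (hdt : d ≤ t) (h8 : Real.exp 8 ≤ ((t + 1 : ℕ) : ℝ)) :
    P (I.moderate a t)ᶜ ≤ ENNReal.ofReal (1 / ((t : ℝ) + 1) ^ 2) := by
  set τ := ((t + 1 : ℕ) : ℝ) with hτ
  have hτ' : τ = (t : ℝ) + 1 := by rw [hτ]; push_cast; rfl
  set m := maxSize I.𝒜 with hm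
  set ℓ := Real.log τ with hℓ
  have hτ0 : 0 < τ := (Real.exp_pos _).trans_le h8
  have hτ9 : 9 ≤ τ := by linarith [Real.add_one_le_exp (8 : ℝ)]
  have hℓ8 : 8 ≤ ℓ := (Real.le_log_iff_exp_le hτ0).2 h8
  have hexpℓ : Real.exp ℓ = τ := Real.exp_log hτ0
  have hℓτ : ℓ ≤ τ := by linarith [Real.log_le_sub_one_of_pos hτ0]
  set K := ⌈3 * ℓ⌉₊ with hK
  have hK1 : 3 * ℓ ≤ K := Nat.le_ceil _
  have hK2 : (K : ℝ) ≤ 3 * ℓ + 1 := (Nat.ceil_lt_add_one (by linarith)).le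
  have hgrid : Real.log (2 * K + 2) ≤ 2 * Real.log ℓ := by
    have h1 : (2 * K + 2 : ℝ) ≤ ℓ ^ 2 := by nlinarith
    calc Real.log (2 * K + 2) ≤ Real.log (ℓ ^ 2) := Real.log_le_log (by positivity) h1
      _ = 2 * Real.log ℓ := by rw [Real.log_pow]; norm_num
  have hlogℓ : Real.log ℓ ≤ ℓ := by linarith [Real.log_le_sub_one_of_pos (x := ℓ) (by linarith)]
  have hlogℓ0 : 0 ≤ Real.log ℓ := Real.log_nonneg (by linarith)
  have hmt : (m : ℝ) ≤ τ := by
    rw [hτ']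
    have h1 : (m : ℝ) ≤ d := by exact_mod_cast I.maxSize_le
    have h2 : (d : ℝ) ≤ t := by exact_mod_cast hdt
    linarith
  have hpow : τ ^ 4 ≤ 4 ^ K := by
    have h1 : τ ^ 2 ≤ 2 ^ K := by
      have h2 : (2 : ℝ) ^ K = Real.exp (K * Real.log 2) := by
        rw [Real.exp_nat_mul, Real.exp_log (by norm_num)]
      rw [h2, ← hexpℓ, ← Real.exp_nat_mul]
      apply Real.exp_le_exp.2
      have := Real.log_two_gt_d9
      push_cast
      nlinarith
    calc τ ^ 4 = (τ ^ 2) ^ 2 := by ring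
      _ ≤ (2 ^ K) ^ 2 := by gcongr
      _ = 4 ^ K := by rw [← pow_mul, mul_comm, pow_mul]; norm_num
  have hτ4 : τ ≤ τ ^ 4 := le_self_pow₀ (by linarith) (by norm_num)
  have hm0 : (0 : ℝ) ≤ m := by positivity
  set y := 2 * ℓ + m * Real.log (2 * K + 2) with hy
  have hyK : y ≤ 4 ^ K / 2 := by
    have h1 : m * Real.log (2 * K + 2) ≤ τ * (2 * τ) := by
      have : Real.log (2 * K + 2) ≤ 2 * τ := by linarith
      exact mul_le_mul hmt this (Real.log_nonneg (by linarith [(Nat.cast_nonneg K : (0 : ℝ) ≤ K)])) hτ0.le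
        |>.trans le_rfl
    have h2 : 81 * τ ^ 2 ≤ τ ^ 4 := by
      have : (9 : ℝ) ^ 2 ≤ τ ^ 2 := by gcongr
      nlinarith [sq_nonneg τ]
    nlinarith
  have hf : y ≤ 3 / 4 * (4 / 3 * explore 1 m τ - a.card) := by
    have h1 : (a.card : ℝ) ≤ m := by exact_mod_cast I.card_le_maxSize ha
    have h2 := log_one_add_exp_one_mem.1
    have h3 : m * Real.log (2 * K + 2) ≤ m * (2 * Real.log ℓ) := by gcongr
    have h4 : m / 2 * 1 ≤ m / 2 * Real.log (1 + Real.exp 1 / 1) := by gcongr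
    unfold explore
    rw [← hℓ]
    nlinarith
  have hx : 0 ≤ 4 / 3 * explore 1 m τ := by
    have := explore_nonneg m (x := τ) (by linarith)
    positivity
  have htK : t ≤ 2 * 4 ^ K := by
    have : (t : ℝ) ≤ 2 * 4 ^ K := by linarith [hpow, hτ4, pow_pos (by norm_num : (0 : ℝ) < 4) K]
    exact_mod_cast this
  refine le_trans (measure_mono ?_) ((hI.measure_selfNormalized_le t a htK hx hyK hf).trans ?_)
  · intro ω hω
    exact ⟨fun i _ => one_le_count hI.initial ht ω i, not_le.1 hω⟩
  · apply ENNReal.ofReal_le_ofReal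
    have h1 : ((2 * K + 2 : ℝ)) ^ a.card ≤ (2 * K + 2) ^ m :=
      pow_le_pow_right₀ (by linarith [(Nat.cast_nonneg K : (0 : ℝ) ≤ K)]) (I.card_le_maxSize ha)
    have h2 : Real.exp (-y) = (τ ^ 2 * (2 * K + 2) ^ m)⁻¹ := by
      rw [Real.exp_neg, hy, Real.exp_add, Real.exp_nat_mul, Real.exp_log (by positivity)]
      congr 2
      rw [← hexpℓ, ← Real.exp_nat_mul]
      norm_num
    rw [h2, ← hτ']
    have h3 : (0 : ℝ) < (2 * K + 2) ^ m := by positivity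
    calc (2 * K + 2 : ℝ) ^ a.card * (τ ^ 2 * (2 * K + 2) ^ m)⁻¹
        ≤ (2 * K + 2 : ℝ) ^ m * (τ ^ 2 * (2 * K + 2) ^ m)⁻¹ := by gcongr
      _ = 1 / τ ^ 2 := by field_simp

-- Markov's inequality for the number of rounds of the window outside `moderate`: its mean is at
-- most `4t / (t + 1)²`, whereas it would have to reach `t / 4`, since the window has at least `t /
-- 2` rounds.
open Classical in
lemma IsValid.measure_card_moderate_lt_le (hI : I.IsValid P) {a : Finset (Fin d)}
    (ha : a ∈ I.𝒜) (hD : 0 < minGap I.𝒜 I.μ) {t : ℕ} (ht : I.IsLate t) :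
    P {ω | ((Finset.Ico (t / 2) t).filter fun s => ω ∈ I.moderate a s).card < (t : ℝ) / 4}
      ≤ ENNReal.ofReal (16 / ((t : ℝ) + 1) ^ 2) := by
  have ht2 := (ht.le_half hD hI.pos (s := t) (Nat.div_le_self t 2)).2.2.2
  have ht0 : (0 : ℝ) < t := by exact_mod_cast (by omega : 0 < t)
  set F : Ω → ENNReal := fun ω => ∑ s ∈ Finset.Ico (t / 2) t, (I.moderate a s)ᶜ.indicator 1 ω
    with hF
  have hmm : ∀ s, MeasurableSet (I.moderate a s)ᶜ := fun s =>
    (hI.info_le s s _ (hI.measurableSet_moderate a s)).compl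
  have hFm : Measurable F :=
    Finset.measurable_sum _ fun s _ => measurable_one.indicator (hmm s)
  have hint : ∫⁻ ω, F ω ∂P ≤ ENNReal.ofReal (t * (4 / ((t : ℝ) + 1) ^ 2)) := by
    rw [hF, lintegral_finsetSum _ fun s _ => measurable_one.indicator (hmm s)]
    have h1 : ∀ s ∈ Finset.Ico (t / 2) t, ∫⁻ ω, (I.moderate a s)ᶜ.indicator 1 ω ∂P
        ≤ ENNReal.ofReal (4 / ((t : ℝ) + 1) ^ 2) := by
      intro s hs
      obtain ⟨h2, h3, h4, h5⟩ := ht.le_half hD hI.pos (Finset.mem_Ico.1 hs).1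
      rw [lintegral_indicator_one (hmm s)]
      have h6 : Real.exp 8 ≤ ((s + 1 : ℕ) : ℝ) := by
        push_cast
        have := (size_bounds hD hI.pos).1
        linarith [exp_eight_le]
      refine (hI.measure_not_moderate_le ha (hI.initial.length_le.trans h4) h4 h6).trans ?_
      apply ENNReal.ofReal_le_ofReal
      rw [div_le_div_iff₀ (by positivity) (by positivity)]
      nlinarith
    refine (Finset.sum_le_sum h1).trans ?_
    rw [Finset.sum_const, Nat.card_Ico, nsmul_eq_mul, ENNReal.ofReal_mul ht0.le,
      ENNReal.ofReal_natCast]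
    gcongr
    exact Nat.sub_le _ _
  have hmarkov := (mul_meas_ge_le_lintegral₀ hFm.aemeasurable (ENNReal.ofReal (t / 4))).trans hint
  have hsub : {ω | ((Finset.Ico (t / 2) t).filter fun s => ω ∈ I.moderate a s).card < (t : ℝ) / 4}
      ⊆ {ω | ENNReal.ofReal (t / 4) ≤ F ω} := by
    intro ω hω
    simp only [Set.mem_ofPred_eq] at hω ⊢
    have h1 : F ω = (((Finset.Ico (t / 2) t).filter fun s => ω ∉ I.moderate a s).card : ENNReal) := by
      simp only [hF, Set.indicator, Set.mem_compl_iff, Pi.one_apply]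
      rw [Finset.sum_boole]
    have h2 := Finset.card_filter_add_card_filter_not (s := Finset.Ico (t / 2) t)
      (fun s => ω ∈ I.moderate a s)
    rw [Nat.card_Ico] at h2
    have h3 : t ≤ 2 * (((Finset.Ico (t / 2) t).filter fun s => ω ∈ I.moderate a s).card
      + ((Finset.Ico (t / 2) t).filter fun s => ω ∉ I.moderate a s).card) := by omega
    have h4 : (t : ℝ) ≤ 2 * (((Finset.Ico (t / 2) t).filter fun s => ω ∈ I.moderate a s).card
      + ((Finset.Ico (t / 2) t).filter fun s => ω ∉ I.moderate a s).card) := by exact_mod_cast h3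
    rw [h1, ← ENNReal.ofReal_natCast]
    apply ENNReal.ofReal_le_ofReal
    linarith
  refine (measure_mono hsub).trans ?_
  have h5 : ENNReal.ofReal (t / 4) ≠ 0 := by
    simp only [ne_eq, ENNReal.ofReal_eq_zero, not_le]
    positivity
  refine (ENNReal.mul_le_mul_iff_right h5 ENNReal.ofReal_ne_top).1 (hmarkov.trans ?_)
  rw [← ENNReal.ofReal_mul (by positivity)]
  apply ENNReal.ofReal_le_ofReal
  apply le_of_eq
  field_simp
  norm_num

/-- The event that an item with many observations is inaccurately estimated. -/
def unreliable (I : Setup d Ω) (n t : ℕ) : Set Ω :=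
  {ω | ∃ i, n ≤ I.count t ω i ∧ I.accuracy * I.count t ω i < |I.dev t ω i|}

lemma IsValid.measure_unreliable_le (hI : I.IsValid P) (hD : 0 < minGap I.𝒜 I.μ) (s t : ℕ) :
    P (I.unreliable (enough t) s)
      ≤ ENNReal.ofReal (2 * Nat.factorial 24 * 128 ^ 24 * I.size ^ 145 / (t + 1 : ℝ) ^ 3) := by
  have hm : (0 : ℝ) < maxSize I.𝒜 := by exact_mod_cast (by have := hI.two_le; omega)
  have hacc : 0 < I.accuracy := by unfold accuracy; positivity
  obtain ⟨b1, b2, b3, b4, b5, b6⟩ := size_bounds hD hI.pos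
  have h1 : I.unreliable (enough t) s ⊆ ⋃ i ∈ (Finset.univ : Finset (Fin d)),
      {ω | enough t ≤ I.count s ω i ∧ I.accuracy * I.count s ω i < |I.dev s ω i|} := by
    rintro ω ⟨i, hi⟩
    exact Set.mem_biUnion (Finset.mem_univ i) hi
  refine (measure_mono h1).trans ((measure_biUnion_finset_le _ _).trans ?_)
  refine (Finset.sum_le_sum fun i _ => hI.measure_dev_le s i hacc (enough t)).trans ?_
  rw [Finset.sum_const, Finset.card_univ, Fintype.card_fin, nsmul_eq_mul,
    ← ENNReal.ofReal_natCast, ← ENNReal.ofReal_mul (by positivity)]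
  apply ENNReal.ofReal_le_ofReal
  have h2 := exp_accuracy_le hD hI.pos hI.two_le t
  calc (d : ℝ) * (2 * Real.exp (-(I.accuracy ^ 2 / (2 * I.σ ^ 2) * enough t)))
      ≤ I.size * (2 * (Nat.factorial 24 * 128 ^ 24 * I.size ^ 144 / (t + 1 : ℝ) ^ 3)) := by
        gcongr
    _ = _ := by ring

/-- Late enough, the items of the optimal action were all played many times with high
probability. -/
lemma IsValid.measure_count_lt_le (hI : I.IsValid P) {a : Finset (Fin d)} (ha : I.IsOptimal a)
    {t : ℕ} (ht : I.IsLate t) :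
    P {ω | ∃ i ∈ a, I.count t ω i < enough t}
      ≤ ENNReal.ofReal ((2 * Nat.factorial 24 * 128 ^ 24 + Nat.factorial 16 + 17) * I.size ^ 145
        / (t + 1 : ℝ) ^ 2) := by
  classical
  have hD := ha.minGap_pos hI.nontrivial hI.unique
  have hσ := hI.pos
  obtain ⟨b1, b2, b3, b4, b5, b6⟩ := size_bounds hD hσ
  have hwin : ∀ s ∈ Finset.Ico (t / 2) t, t / 2 ≤ s ∧ s < t := fun s hs => Finset.mem_Ico.1 hs
  have hhalf := ht.le_half hD hσ (s := t / 2) le_rfl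
  have hr : I.init.length ≤ t / 2 := hI.initial.length_le.trans hhalf.2.2.1
  set p := 1 / (512 * root t ^ 12) with hp
  have hp0 : 0 ≤ p := by have := root_pos t; positivity
  set U := ⋃ s ∈ Finset.Ico (t / 2) t, I.unreliable (enough t) s with hU
  set V := ⋃ s ∈ Finset.Ico (t / 2) t, I.wild t s with hV
  set C := {ω | ((Finset.Ico (t / 2) t).filter fun s => ω ∈ I.moderate a s).card < (t : ℝ) / 4}
    with hC
  set N := {ω | (t : ℝ) / 4 ≤ ((Finset.Ico (t / 2) t).filter fun s => ω ∈ I.moderate a s).card ∧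
    (((Finset.Ico (t / 2) t).filter fun s => ω ∈ I.moderate a s ∩ I.optimistic a s).card : ℝ)
      ≤ (d + 1) * enough t} with hN
  -- Outside `U` and `V` the samples of well-observed actions are accurate throughout the window;
  -- outside `C` and `N` there are more than `(d + 1) * enough t` optimistic rounds.
  have hsub : {ω | ∃ i ∈ a, I.count t ω i < enough t} ⊆ (U ∪ V) ∪ (C ∪ N) := by
    rintro ω ⟨i, hi, hcount⟩
    by_contra hcon
    simp only [Set.mem_union, not_or] at hcon
    obtain ⟨⟨hωU, hωV⟩, hωC, hωN⟩ := hcon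
    have hωC' : (t : ℝ) / 4
        ≤ ((Finset.Ico (t / 2) t).filter fun s => ω ∈ I.moderate a s).card :=
      not_lt.1 fun h => hωC h
    have hopt : (d + 1) * enough t < ((Finset.Ico (t / 2) t).filter fun s =>
        value I.μ a ≤ value (I.sample s ω) a).card := by
      by_contra hle
      refine hωN ⟨hωC', ?_⟩
      have h1 : ((Finset.Ico (t / 2) t).filter fun s =>
          ω ∈ I.moderate a s ∩ I.optimistic a s).card
          ≤ ((Finset.Ico (t / 2) t).filter fun s =>
            value I.μ a ≤ value (I.sample s ω) a).card := by
        refine Finset.card_le_card fun s hs => ?_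
        rw [Finset.mem_filter] at hs ⊢
        exact ⟨hs.1, hs.2.2⟩
      have h2 := h1.trans (not_lt.1 hle)
      exact_mod_cast h2
    refine absurd (le_count_of_optimistic hI.nontrivial hI.unique hI.oracle hI.initial hI.two_le
      hσ ha hr (ω := ω) (y := radius d t) (one_le_enough t) ?_ ?_ ?_ ?_ hopt hi) (not_le.2 hcount)
    · intro s hs
      exact I.boostAt_nonneg (ht.le_half hD hσ (hwin s hs).1).2.2.2
    · intro s hs
      by_contra h
      exact hωV (Set.mem_biUnion hs (not_le.1 h).le)
    · intro s hs
      exact ht.gaussian_part_le hD hσ hI.two_le (ht.le_half hD hσ (hwin s hs).1).2.2.2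
    · intro s hs j hj
      by_contra h
      exact hωU (Set.mem_biUnion hs ⟨j, hj, not_le.1 h⟩)
  have hcard : ((Finset.Ico (t / 2) t).card : ℝ) ≤ t + 1 := by
    rw [Nat.card_Ico]
    have : ((t - t / 2 : ℕ) : ℝ) ≤ t := by exact_mod_cast Nat.sub_le _ _
    linarith
  -- The union over the window costs a factor `t + 1`, which is why the events of single rounds were
  -- bounded with the cube.
  have hunion : ∀ (S : ℕ → Set Ω) (x : ℝ), 0 ≤ x →
      (∀ s, P (S s) ≤ ENNReal.ofReal (x / (t + 1 : ℝ) ^ 3)) →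
      P (⋃ s ∈ Finset.Ico (t / 2) t, S s) ≤ ENNReal.ofReal (x / (t + 1 : ℝ) ^ 2) := by
    intro S x hx hS
    refine (measure_biUnion_finset_le _ _).trans ((Finset.sum_le_sum fun s _ => hS s).trans ?_)
    rw [Finset.sum_const, nsmul_eq_mul, ← ENNReal.ofReal_natCast,
      ← ENNReal.ofReal_mul (by positivity)]
    apply ENNReal.ofReal_le_ofReal
    calc ((Finset.Ico (t / 2) t).card : ℝ) * (x / (t + 1 : ℝ) ^ 3)
        ≤ (t + 1) * (x / (t + 1 : ℝ) ^ 3) := by gcongr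
      _ = x / (t + 1 : ℝ) ^ 2 := by field_simp
  have hPU := hunion (I.unreliable (enough t)) _ (by positivity)
    fun s => hI.measure_unreliable_le hD s t
  have hPV := hunion (I.wild t) 1 (by norm_num) fun s => hI.measure_wild_le s t
  have hPC := hI.measure_card_moderate_lt_le ha.1 hD ht
  have hPN : P N ≤ ENNReal.ofReal (Nat.factorial 16 / (t + 1 : ℝ) ^ 2) := by
    refine le_trans ?_ (ENNReal.ofReal_le_ofReal (ht.exp_optimism_le hD hσ))
    refine measure_card_filter_le (𝓕 := fun s => I.info s s)
      (fun s => I.info_mono (Nat.le_succ s) (Nat.le_succ s)) (fun s => hI.info_le s s)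
      (hI.measurableSet_moderate a) (hI.measurableSet_optimistic a) hp0 ?_ _ _
    intro s hs W hW
    obtain ⟨h1, h2, h3, h4⟩ := ht.le_half hD hσ (hwin s hs).1
    have hℓ : Real.log ((s + 1 : ℕ) : ℝ) ≤ Real.log ((t + 1 : ℕ) : ℝ) := by
      apply Real.log_le_log (by positivity)
      have := (hwin s hs).2
      exact_mod_cast (by omega : s + 1 ≤ t + 1)
    refine le_trans ?_ (hI.optimism (hI.initial.length_le.trans h3) (by omega)
      (I.boostAt_nonneg h4) (y := √(4 / 3 * Real.log ((t + 1 : ℕ) : ℝ))) (by gcongr) hW)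
    gcongr
    exact gaussian_tail_log_ge (Real.log_natCast_nonneg _)
  refine (measure_mono hsub).trans ((measure_union_le _ _).trans ((add_le_add
    ((measure_union_le _ _).trans (add_le_add hPU hPV))
    ((measure_union_le _ _).trans (add_le_add hPC hPN))).trans ?_))
  rw [← ENNReal.ofReal_add (by positivity) (by positivity),
    ← ENNReal.ofReal_add (by positivity) (by positivity),
    ← ENNReal.ofReal_add (by positivity) (by positivity)]
  apply ENNReal.ofReal_le_ofReal
  rw [← add_div, ← add_div, ← add_div]
  have hpow : 1 ≤ I.size ^ 145 := one_le_pow₀ b1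
  have hf : (0 : ℝ) ≤ Nat.factorial 16 := by positivity
  gcongr
  generalize (Nat.factorial 16 : ℝ) = x at hf ⊢
  generalize I.size ^ 145 = z at hpow ⊢
  nlinarith

end Setup

end SemiBandit

/-! ### Summation over bad rounds and the regret bound -/

namespace SemiBandit

lemma sum_one_div_sq_le (T : ℕ) : ∑ t ∈ Finset.range T, 1 / ((t : ℝ) + 1) ^ 2 ≤ 2 - 1 / (T : ℝ) := by
  induction T with
  | zero => simp
  | succ T ih =>
    rw [Finset.sum_range_succ]
    rcases Nat.eq_zero_or_pos T with rfl | hT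
    · norm_num
    · have hT' : (0 : ℝ) < T := by exact_mod_cast hT
      have h : 1 / ((T : ℝ) + 1) ^ 2 ≤ 1 / T - 1 / (T + 1) := by
        rw [div_sub_div _ _ hT'.ne' (by positivity), div_le_div_iff₀ (by positivity) (by positivity)]
        nlinarith
      push_cast
      linarith

namespace Setup

variable {d : ℕ} {Ω : Type*} {I : Setup d Ω}

/-- The logarithmic part of the radius turns the boost back into `f`, while its part in `d` meets
the bound `8m` on the boost. Hence `d` appears only in an additive constant here, not next to `ln
T`. -/
lemma boostAt_mul_radius_le (hm : 2 ≤ maxSize I.𝒜) {t T : ℕ} (ht : 2 ≤ t) (htT : t < T) :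
    I.boostAt t * radius d t
      ≤ 24 * Real.log T + 48 * maxSize I.𝒜 * Real.log (Real.log T) + 56 * d * maxSize I.𝒜 := by
  have h1 := boostAt_mul_log (I := I) (t := t) (by omega)
  have h2 := boostAt_le (I := I) hm ht
  have h3 : explore 1 (maxSize I.𝒜) ((t + 1 : ℕ) : ℝ) ≤ explore 1 (maxSize I.𝒜) T :=
    explore_mono _ (by exact_mod_cast (by omega : 3 ≤ t + 1)) (by exact_mod_cast htT)
  have h4 := explore_le hm (x := T) (by exact_mod_cast (by omega : 3 ≤ T))
  have hd : (1 : ℝ) ≤ d := by exact_mod_cast (by have := I.maxSize_le; omega : 1 ≤ d)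
  have hm0 : (0 : ℝ) ≤ maxSize I.𝒜 := by positivity
  have h5 : I.boostAt t * d ≤ 8 * maxSize I.𝒜 * d := by gcongr
  have h6 : I.boostAt t * radius d t
      = 12 * (I.boostAt t * Real.log ((t + 1 : ℕ) : ℝ)) + 4 * (I.boostAt t * d) := by
    unfold radius; ring
  rw [h6, h1]
  nlinarith

/-- The event that round `t + 1` is bad: its regret is not charged to the items. -/
def bad (I : Setup d Ω) (a : Finset (Fin d)) (t : ℕ) : Set Ω :=
  {_ω | ¬ I.IsLate t} ∪ (I.wild t t ∪ I.unreliable (enough t) t)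
    ∪ ({ω | ∃ i ∈ a, I.count t ω i < enough t}
      ∪ {ω | ∃ i ∈ I.play t ω, I.accuracy * I.count t ω i < |I.dev t ω i|})

variable [mΩ : MeasurableSpace Ω] {P : Measure Ω}

lemma IsValid.gap_le_of_notMem_bad (hI : I.IsValid P) {a : Finset (Fin d)} (ha : I.IsOptimal a)
    {t : ℕ} {ω : Ω} (hω : ω ∉ I.bad a t) {L : ℝ} (hL0 : 0 < L)
    (hL : 2 ≤ t → 8 * I.σ ^ 2 * (I.boostAt t * radius d t) ≤ L) :
    gap I.𝒜 I.μ (I.play t ω)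
      ≤ ∑ i ∈ I.play t ω, charge L (minGap I.𝒜 I.μ) (maxSize I.𝒜) (I.count t ω i) := by
  simp only [bad, Set.mem_union, not_or, Set.mem_ofPred_eq, not_not, not_exists, not_and,
    not_lt] at hω
  obtain ⟨⟨hlate, hw, hu⟩, hc, hp⟩ := hω
  have hD := ha.minGap_pos hI.nontrivial hI.unique
  obtain ⟨-, -, h3, h4⟩ := hlate.le_half hD hI.pos (Nat.div_le_self t 2)
  refine gap_play_le_sum_charge hI.nontrivial hI.unique hI.oracle hI.initial hI.two_le hI.pos ha
    (hI.initial.length_le.trans h3) (I.boostAt_nonneg h4) (y := radius d t) ?_ hL0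
    (not_le.1 hw).le (one_le_enough t) (hlate.gaussian_part_le hD hI.pos hI.two_le h4) hc ?_ hp
  · rw [mul_assoc]
    exact hL h4
  · intro i hi
    by_contra h
    exact hu ⟨i, hc i hi, not_le.1 h⟩

/-- A universal constant. -/
noncomputable def badConst : ℝ := 2 * (4 * Nat.factorial 24 * 128 ^ 24 + Nat.factorial 16 + 18)
  + (2 ^ 18) ^ 16 + 258

lemma two_le_badConst : 2 ≤ badConst := by
  unfold badConst
  have h1 : (0 : ℝ) ≤ Nat.factorial 24 := by positivity
  have h2 : (0 : ℝ) ≤ Nat.factorial 16 := by positivity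
  nlinarith

/-- Early rounds number at most `(2 ^ 18 * size ^ 7) ^ 16`; plays of inaccurate items are summed
over time directly, without a bound for each round; all other events have probability of order `(t +
1)^(-2)`. The exponent 145 is that of the deviation bound, 144 plus one for the `d` items, and
dominates all others. -/
lemma IsValid.sum_measure_bad_le [IsProbabilityMeasure P] (hI : I.IsValid P)
    {a : Finset (Fin d)} (ha : I.IsOptimal a) (T : ℕ) :
    ∑ t ∈ Finset.range T, P (I.bad a t) ≤ ENNReal.ofReal (badConst * I.size ^ 145) := by
  classical
  have hD := ha.minGap_pos hI.nontrivial hI.unique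
  have hσ := hI.pos
  obtain ⟨b1, b2, b3, b4, b5, b6⟩ := size_bounds hD hσ
  have hm : (0 : ℝ) < maxSize I.𝒜 := by exact_mod_cast (by have := hI.two_le; omega)
  have hacc : 0 < I.accuracy := by unfold accuracy; positivity
  set B := I.size with hB
  set k : ℝ := 4 * Nat.factorial 24 * 128 ^ 24 + Nat.factorial 16 + 18 with hk
  have hk0 : 0 ≤ k := by positivity
  set τ := (2 ^ 18 * B ^ 7) ^ 16 with hτ
  set Q : ℕ → Fin d → Set Ω := fun t i =>
    {ω | i ∈ I.play t ω ∧ I.accuracy * I.count t ω i < |I.dev t ω i|} with hQ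
  have hpt : ∀ t, P (I.bad a t) ≤ ENNReal.ofReal (k * B ^ 145 * (1 / ((t : ℝ) + 1) ^ 2))
      + (∑ i, P (Q t i) + if t < ⌈τ⌉₊ - 1 then 1 else 0) := by
    intro t
    by_cases hlate : I.IsLate t
    · have hsub : I.bad a t ⊆ (I.wild t t ∪ I.unreliable (enough t) t)
          ∪ ({ω | ∃ i ∈ a, I.count t ω i < enough t} ∪ ⋃ i ∈ (Finset.univ : Finset (Fin d)), Q t i) := by
        rintro ω ((h | h) | (h | ⟨i, hi, h⟩))
        · exact absurd hlate h
        · exact Or.inl h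
        · exact Or.inr (Or.inl h)
        · exact Or.inr (Or.inr (Set.mem_biUnion (Finset.mem_univ i) ⟨hi, h⟩))
      refine (measure_mono hsub).trans ((measure_union_le _ _).trans ?_)
      refine (add_le_add ((measure_union_le _ _).trans (add_le_add (hI.measure_wild_le t t)
        (hI.measure_unreliable_le hD t t))) ((measure_union_le _ _).trans (add_le_add
        (hI.measure_count_lt_le ha hlate) (measure_biUnion_finset_le _ _)))).trans ?_
      rw [← add_assoc]
      refine add_le_add ?_ le_self_add |>.trans (le_of_eq rfl)
      rw [← ENNReal.ofReal_add (by positivity) (by positivity),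
        ← ENNReal.ofReal_add (by positivity) (by positivity)]
      apply ENNReal.ofReal_le_ofReal
      have hx : (1 : ℝ) ≤ (t : ℝ) + 1 := by linarith [(Nat.cast_nonneg t : (0 : ℝ) ≤ t)]
      have hcube : ∀ x : ℝ, 0 ≤ x → x / ((t : ℝ) + 1) ^ 3 ≤ x * (1 / ((t : ℝ) + 1) ^ 2) := by
        intro x hx0
        rw [div_eq_mul_one_div]
        gcongr
        norm_num
      have h1 := hcube 1 (by norm_num)
      have h2 := hcube (2 * Nat.factorial 24 * 128 ^ 24 * B ^ 145) (by positivity)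
      have hpow : 1 ≤ B ^ 145 := one_le_pow₀ b1
      have hz : 0 ≤ 1 / ((t : ℝ) + 1) ^ 2 := by positivity
      have h3 : (1 : ℝ) * (1 / ((t : ℝ) + 1) ^ 2) ≤ B ^ 145 * (1 / ((t : ℝ) + 1) ^ 2) := by
        gcongr
      rw [hk]
      rw [div_eq_mul_one_div ((2 * (Nat.factorial 24 : ℝ) * 128 ^ 24 + Nat.factorial 16 + 17)
        * B ^ 145)]
      generalize (Nat.factorial 24 : ℝ) * 128 ^ 24 = f at *
      linarith
    · have ht : t < ⌈τ⌉₊ - 1 := by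
        have h1 : root t < 2 ^ 18 * B ^ 7 := not_le.1 hlate
        have h2 : root t ^ 16 < τ := pow_lt_pow_left₀ h1 (root_pos t).le (by norm_num)
        rw [root_pow] at h2
        have h3 : t + 1 < ⌈τ⌉₊ := Nat.lt_ceil.2 (by push_cast; exact h2)
        omega
      rw [if_pos ht]
      exact prob_le_one.trans (le_add_self.trans le_add_self)
  refine (Finset.sum_le_sum fun t _ => hpt t).trans ?_
  rw [Finset.sum_add_distrib, Finset.sum_add_distrib]
  have s1 : ∑ t ∈ Finset.range T, ENNReal.ofReal (k * B ^ 145 * (1 / ((t : ℝ) + 1) ^ 2))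
      ≤ ENNReal.ofReal (2 * k * B ^ 145) := by
    rw [← ENNReal.ofReal_sum_of_nonneg fun t _ => by positivity, ← Finset.mul_sum]
    apply ENNReal.ofReal_le_ofReal
    have h1 := sum_one_div_sq_le T
    have h2 : (0 : ℝ) ≤ 1 / T := by positivity
    calc k * B ^ 145 * ∑ t ∈ Finset.range T, 1 / ((t : ℝ) + 1) ^ 2 ≤ k * B ^ 145 * 2 := by
          gcongr
          linarith
      _ = 2 * k * B ^ 145 := by ring
  have s2 : ∑ t ∈ Finset.range T, ∑ i, P (Q t i) ≤ ENNReal.ofReal (258 * B ^ 145) := by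
    rw [Finset.sum_comm]
    refine (Finset.sum_le_sum fun i _ => hI.sum_measure_play_dev_le T i hacc).trans ?_
    rw [Finset.sum_const, Finset.card_univ, Fintype.card_fin, nsmul_eq_mul,
      ← ENNReal.ofReal_natCast, ← ENNReal.ofReal_mul (by positivity)]
    apply ENNReal.ofReal_le_ofReal
    have h1 : 2 * I.σ ^ 2 / I.accuracy ^ 2
        = 128 * (maxSize I.𝒜 : ℝ) ^ 2 * (1 / minGap I.𝒜 I.μ) ^ 2 * I.σ ^ 2 := by
      unfold accuracy
      field_simp
      norm_num
    have h2 : 128 * (maxSize I.𝒜 : ℝ) ^ 2 * (1 / minGap I.𝒜 I.μ) ^ 2 * I.σ ^ 2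
        ≤ 128 * B ^ 2 * B ^ 2 * B ^ 2 := by gcongr
    rw [h1]
    have h3 : (1 : ℝ) ≤ B ^ 6 := one_le_pow₀ b1
    calc (d : ℝ) * (2 * (1 + 128 * (maxSize I.𝒜 : ℝ) ^ 2 * (1 / minGap I.𝒜 I.μ) ^ 2 * I.σ ^ 2))
        ≤ B * (2 * (B ^ 6 + 128 * B ^ 2 * B ^ 2 * B ^ 2)) := by gcongr
      _ = 258 * B ^ 7 := by ring
      _ ≤ 258 * B ^ 145 := by
          gcongr
          norm_num
  have s3 : ∑ t ∈ Finset.range T, (if t < ⌈τ⌉₊ - 1 then (1 : ENNReal) else 0)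
      ≤ ENNReal.ofReal ((2 ^ 18) ^ 16 * B ^ 145) := by
    rw [Finset.sum_boole]
    have h1 : ((Finset.range T).filter fun t => t < ⌈τ⌉₊ - 1).card ≤ ⌈τ⌉₊ - 1 := by
      calc _ ≤ (Finset.range (⌈τ⌉₊ - 1)).card := Finset.card_le_card fun t ht =>
            Finset.mem_range.2 (Finset.mem_filter.1 ht).2
        _ = _ := Finset.card_range _
    have hτ1 : 1 ≤ τ := one_le_pow₀ (by nlinarith [one_le_pow₀ b1 (n := 7)])
    have h2 : ((⌈τ⌉₊ - 1 : ℕ) : ℝ) ≤ τ := by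
      have h3 := (Nat.ceil_lt_add_one (by linarith : 0 ≤ τ)).le
      rw [Nat.cast_sub (Nat.ceil_pos.2 (by linarith))]
      push_cast
      linarith
    rw [← ENNReal.ofReal_natCast]
    apply ENNReal.ofReal_le_ofReal
    calc ((((Finset.range T).filter fun t => t < ⌈τ⌉₊ - 1).card : ℕ) : ℝ)
        ≤ ((⌈τ⌉₊ - 1 : ℕ) : ℝ) := by exact_mod_cast h1
      _ ≤ τ := h2
      _ = (2 ^ 18) ^ 16 * B ^ 112 := by rw [hτ]; ring
      _ ≤ (2 ^ 18) ^ 16 * B ^ 145 := by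
          gcongr
          norm_num
  refine (add_le_add s1 (add_le_add s2 s3)).trans ?_
  rw [← ENNReal.ofReal_add (by positivity) (by positivity),
    ← ENNReal.ofReal_add (by positivity) (by positivity)]
  apply ENNReal.ofReal_le_ofReal
  rw [badConst, ← hk]
  apply le_of_eq
  ring

lemma IsValid.integrable_play [IsProbabilityMeasure P] (hI : I.IsValid P)
    (F : Finset (Fin d) → ℝ) (t : ℕ) : Integrable (fun ω => F (I.play t ω)) P := by
  have hm : Measurable fun ω => F (I.play t ω) := fun s _ =>
    hI.info_le _ _ _ (hI.measurableSet_play t fun a => F a ∈ s)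
  refine Integrable.of_bound hm.aestronglyMeasurable (∑ a, |F a|) (ae_of_all _ fun ω => ?_)
  exact Finset.single_le_sum (f := fun a => |F a|) (fun a _ => abs_nonneg _)
    (Finset.mem_univ (I.play t ω))

lemma IsValid.regret_eq [IsProbabilityMeasure P] (hI : I.IsValid P) (T : ℕ) :
    regret P I.𝒜 I.μ 1 I.σ I.sel I.init I.X I.Z T
      = ∫ ω, ∑ t ∈ Finset.range T, gap I.𝒜 I.μ (I.play t ω) ∂P := by
  have h1 : ∀ ω, ∑ t ∈ Finset.range T, gap I.𝒜 I.μ (I.play t ω)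
      = T * optValue I.𝒜 I.μ - ∑ t ∈ Finset.range T, value I.μ (I.play t ω) := by
    intro ω
    simp only [gap]
    rw [Finset.sum_sub_distrib, Finset.sum_const, Finset.card_range, nsmul_eq_mul]
  simp_rw [h1]
  rw [integral_sub (integrable_const _)
    (integrable_finsetSum _ fun t _ => hI.integrable_play (value I.μ) t)]
  simp [regret, play]

lemma IsValid.regret_le_mul_maxGap [IsProbabilityMeasure P] (hI : I.IsValid P) (T : ℕ) :
    regret P I.𝒜 I.μ 1 I.σ I.sel I.init I.X I.Z T ≤ T * maxGap I.𝒜 I.μ := by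
  rw [hI.regret_eq]
  have h := integral_mono (μ := P)
    (integrable_finsetSum (Finset.range T) fun t _ => hI.integrable_play (gap I.𝒜 I.μ) t)
    (integrable_const (T * maxGap I.𝒜 I.μ)) fun ω => by
      refine (Finset.sum_le_sum fun t _ =>
        I.gap_le_maxGap (play_mem hI.oracle hI.initial t ω)).trans ?_
      simp
  simpa using h

lemma IsValid.regret_le [IsProbabilityMeasure P] (hI : I.IsValid P) {a : Finset (Fin d)}
    (ha : I.IsOptimal a) (T : ℕ) {L : ℝ} (hL0 : 0 < L)
    (hL : ∀ t < T, 2 ≤ t → 8 * I.σ ^ 2 * (I.boostAt t * radius d t) ≤ L) :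
    regret P I.𝒜 I.μ 1 I.σ I.sel I.init I.X I.Z T
      ≤ d * (13 * (L / minGap I.𝒜 I.μ) * Real.log (maxSize I.𝒜))
        + maxGap I.𝒜 I.μ * (badConst * I.size ^ 145) := by
  classical
  have hD := ha.minGap_pos hI.nontrivial hI.unique
  have hm1 : (1 : ℝ) ≤ maxSize I.𝒜 := by exact_mod_cast (by have := hI.two_le; omega)
  have hmax : 0 ≤ maxGap I.𝒜 I.μ := (ha.gap_nonneg ha.1).trans (I.gap_le_maxGap ha.1)
  have hB := (size_bounds hD hI.pos).1
  have hbc := two_le_badConst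
  have hlog := Real.log_nonneg hm1
  set E := d * (13 * (L / minGap I.𝒜 I.μ) * Real.log (maxSize I.𝒜)) with hE
  have hE0 : 0 ≤ E := by positivity
  set M := maxGap I.𝒜 I.μ with hM
  -- A measurable hull has the same probability, so measurability of the bad events need not be
  -- checked.
  set S : ℕ → Set Ω := fun t => toMeasurable P (I.bad a t) with hS
  have hSm : ∀ t, MeasurableSet (S t) := fun t => measurableSet_toMeasurable _ _
  have hint : Integrable (fun ω => ∑ t ∈ Finset.range T, gap I.𝒜 I.μ (I.play t ω)) P :=
    integrable_finsetSum _ fun t _ => hI.integrable_play (gap I.𝒜 I.μ) t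
  have hnn : ∀ ω, 0 ≤ ∑ t ∈ Finset.range T, gap I.𝒜 I.μ (I.play t ω) := fun ω =>
    Finset.sum_nonneg fun t _ => ha.gap_nonneg (play_mem hI.oracle hI.initial t ω)
  rw [hI.regret_eq, ← ENNReal.ofReal_le_ofReal_iff (by positivity),
    ofReal_integral_eq_lintegral_ofReal hint (ae_of_all _ hnn)]
  have hpath : ∀ ω, ENNReal.ofReal (∑ t ∈ Finset.range T, gap I.𝒜 I.μ (I.play t ω))
      ≤ ENNReal.ofReal E
        + ENNReal.ofReal M * ∑ t ∈ Finset.range T, (S t).indicator 1 ω := by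
    intro ω
    have h1 : ∑ t ∈ Finset.range T, gap I.𝒜 I.μ (I.play t ω)
        ≤ ∑ t ∈ Finset.range T, (∑ i ∈ I.play t ω,
          charge L (minGap I.𝒜 I.μ) (maxSize I.𝒜) (I.count t ω i)
          + if ω ∈ S t then M else 0) := by
      refine Finset.sum_le_sum fun t ht => ?_
      have hc : 0 ≤ ∑ i ∈ I.play t ω,
          charge L (minGap I.𝒜 I.μ) (maxSize I.𝒜) (I.count t ω i) :=
        Finset.sum_nonneg fun i _ => charge_nonneg hL0.le hD.le _ _
      split_ifs with h
      · have := I.gap_le_maxGap (play_mem hI.oracle hI.initial t ω)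
        linarith
      · rw [add_zero]
        exact hI.gap_le_of_notMem_bad ha (fun hb => h (subset_toMeasurable _ _ hb)) hL0
          (hL t (Finset.mem_range.1 ht))
    rw [Finset.sum_add_distrib] at h1
    have h2 := h1.trans (add_le_add (I.sum_sum_charge_le hL0 hD hI.two_le T ω) le_rfl)
    refine (ENNReal.ofReal_le_ofReal h2).trans ?_
    rw [ENNReal.ofReal_add hE0 (Finset.sum_nonneg fun t _ => by split_ifs <;> simp [hmax]),
      ENNReal.ofReal_sum_of_nonneg fun t _ => by split_ifs <;> simp [hmax], Finset.mul_sum]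
    refine add_le_add le_rfl (Finset.sum_le_sum fun t _ => ?_)
    by_cases h : ω ∈ S t <;> simp [h]
  refine (lintegral_mono hpath).trans ?_
  have hind : ∀ t, Measurable ((S t).indicator (1 : Ω → ENNReal)) := fun t =>
    measurable_one.indicator (hSm t)
  rw [lintegral_add_left measurable_const, lintegral_const, measure_univ, mul_one,
    lintegral_const_mul _ (Finset.measurable_sum _ fun t _ => hind t),
    lintegral_finsetSum _ fun t _ => hind t]
  simp_rw [lintegral_indicator_one (hSm _), hS, measure_toMeasurable]
  rw [ENNReal.ofReal_add hE0 (by positivity), ENNReal.ofReal_mul hmax]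
  gcongr
  exact hI.sum_measure_bad_le ha T

lemma IsValid.regret_le_logs [IsProbabilityMeasure P] (hI : I.IsValid P) {T : ℕ} (hT : 2 ≤ T)
    {K : ℝ} (hK : 2 ≤ K) (hbad : badConst * I.size ^ 145 = K) :
    regret P I.𝒜 I.μ 1 I.σ I.sel I.init I.X I.Z T
      ≤ 2496 * (I.σ ^ 2 * d * Real.log (maxSize I.𝒜) / minGap I.𝒜 I.μ) * Real.log T
        + 4992 * (I.σ ^ 2 * d ^ 2 * maxSize I.𝒜 * Real.log (maxSize I.𝒜) / minGap I.𝒜 I.μ)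
          * Real.log (Real.log T)
        + (20000 * I.size ^ 7 + maxGap I.𝒜 I.μ * K) := by
  obtain ⟨a, ha, -⟩ := id hI.unique
  have ha : I.IsOptimal a := ha
  have hm := hI.two_le
  have hD : 0 < minGap I.𝒜 I.μ := ha.minGap_pos hI.nontrivial hI.unique
  have hσ := hI.pos
  obtain ⟨b1, b2, b3, b4, b5, b6⟩ := size_bounds hD hσ
  have hM : 0 ≤ maxGap I.𝒜 I.μ := (ha.gap_nonneg ha.1).trans (I.gap_le_maxGap ha.1)
  have hm2 : (2 : ℝ) ≤ maxSize I.𝒜 := by exact_mod_cast hm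
  have hd1 : (1 : ℝ) ≤ d := by
    have : maxSize I.𝒜 ≤ d := I.maxSize_le
    exact_mod_cast (by omega : 1 ≤ d)
  have hshort : regret P I.𝒜 I.μ 1 I.σ I.sel I.init I.X I.Z T ≤ T * maxGap I.𝒜 I.μ :=
    hI.regret_le_mul_maxGap T
  have hlong : ∀ L : ℝ, 0 < L →
      (∀ t < T, 2 ≤ t → 8 * I.σ ^ 2 * (I.boostAt t * radius d t) ≤ L) →
      regret P I.𝒜 I.μ 1 I.σ I.sel I.init I.X I.Z T
        ≤ d * (13 * (L / minGap I.𝒜 I.μ) * Real.log (maxSize I.𝒜)) + maxGap I.𝒜 I.μ * K := by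
    intro L hL0 hL
    have h := hI.regret_le ha T hL0 hL
    rwa [hbad] at h
  have hboost : ∀ t < T, 2 ≤ t → I.boostAt t * radius d t ≤ _ := fun t ht ht2 =>
    boostAt_mul_radius_le (I := I) hm ht2 ht
  clear hbad
  generalize regret P I.𝒜 I.μ 1 I.σ I.sel I.init I.X I.Z T = R at *
  generalize I.size = B at *
  generalize minGap I.𝒜 I.μ = D at *
  generalize maxGap I.𝒜 I.μ = M at *
  generalize (maxSize I.𝒜 : ℝ) = m at *
  generalize I.σ = σ at *
  have hlogm : 0 ≤ Real.log m := Real.log_nonneg (by linarith)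
  have hlogm' : Real.log m ≤ B := by
    linarith [Real.log_le_sub_one_of_pos (by linarith : 0 < m)]
  have hS : σ ^ 2 * d ^ 2 * m * Real.log m / D ≤ B ^ 7 * 1 := by
    calc σ ^ 2 * d ^ 2 * m * Real.log m / D = σ ^ 2 * d ^ 2 * m * Real.log m * (1 / D) := by ring
      _ ≤ B ^ 2 * B ^ 2 * B * B * B := by gcongr
      _ = B ^ 7 * 1 := by ring
  have hS0 : 0 ≤ σ ^ 2 * d ^ 2 * m * Real.log m / D := by positivity
  set S := σ ^ 2 * d ^ 2 * m * Real.log m / D with hSdef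
  have hB7 : 0 ≤ B ^ 7 := by positivity
  rcases eq_or_lt_of_le hT with rfl | hT3
  -- For `T = 2` the double logarithm is negative but at least `-1`. Two rounds cost at most `2M ≤ M
  -- * K`, and the polynomial term `20000 * B ^ 7` outweighs `4992 * S`.
  · have hlog2 : 0.69 ≤ Real.log 2 := by linarith [Real.log_two_gt_d9]
    have h2 : -1 ≤ Real.log (Real.log 2) := by
      have h3 := Real.one_sub_inv_le_log_of_pos (by linarith : 0 < Real.log 2)
      have h4 : (Real.log 2)⁻¹ ≤ (0.69 : ℝ)⁻¹ := by gcongr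
      norm_num at h4
      linarith
    have h5 : 0 ≤ 2496 * (σ ^ 2 * d * Real.log m / D) * Real.log 2 := by positivity
    have h6 : 2 * M ≤ M * K := by nlinarith
    have h7 : -S ≤ S * Real.log (Real.log 2) := by nlinarith
    push_cast at hshort ⊢
    linarith
  · have hT3' : (3 : ℝ) ≤ T := by exact_mod_cast hT3
    have hlogT := one_le_log hT3'
    have hloglogT := Real.log_nonneg hlogT
    have h1 := hlong (8 * σ ^ 2 * (24 * Real.log T + 48 * m * Real.log (Real.log T) + 56 * d * m))
      (by positivity) fun t ht ht2 => mul_le_mul_of_nonneg_left (hboost t ht ht2) (by positivity)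
    refine h1.trans ?_
    -- The constants are `13 · 8` times 24, 48 and 56. The last term, free of `T`, goes into the
    -- polynomial.
    have h2 : d * (13 * (8 * σ ^ 2 * (24 * Real.log T + 48 * m * Real.log (Real.log T)
        + 56 * d * m) / D) * Real.log m)
        = 2496 * (σ ^ 2 * d * Real.log m / D) * Real.log T
          + 4992 * (σ ^ 2 * d * m * Real.log m / D) * Real.log (Real.log T) + 5824 * S := by
      rw [hSdef]
      field_simp
      ring
    -- The argument yields only one factor `d` in the double-logarithmic term; the stated `d ^ 2` is
    -- weaker.
    have h3 : σ ^ 2 * d * m * Real.log m / D ≤ S := by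
      rw [hSdef]
      have : (d : ℝ) ≤ d ^ 2 := le_self_pow₀ hd1 (by norm_num)
      gcongr
    have h4 : 4992 * (σ ^ 2 * d * m * Real.log m / D) * Real.log (Real.log T)
        ≤ 4992 * S * Real.log (Real.log T) := by gcongr
    rw [h2]
    linarith

end Setup

/-- The polynomial term of the regret bound, in the variables `m`, `d`, `1 / Δ_min`, `Δ_max`
and `σ`. -/
noncomputable def remainder (c : ℝ) (n : ℕ) : MvPolynomial (Fin 5) ℝ :=
  MvPolynomial.C 20000 * (1 + .X 0 + .X 1 + .X 2 + .X 4) ^ 7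
    + .X 3 * (MvPolynomial.C c * (1 + .X 0 + .X 1 + .X 2 + .X 4) ^ n)

lemma eval_remainder (c : ℝ) (n : ℕ) (v : Fin 5 → ℝ) :
    MvPolynomial.eval v (remainder c n) = 20000 * (1 + v 0 + v 1 + v 2 + v 4) ^ 7
      + v 3 * (c * (1 + v 0 + v 1 + v 2 + v 4) ^ n) := by
  simp [remainder]

lemma Setup.IsValid.regret_le_remainder {d : ℕ} {Ω : Type*} [MeasurableSpace Ω] {I : Setup d Ω}
    {P : Measure Ω} [IsProbabilityMeasure P] (hI : I.IsValid P) {T : ℕ} (hT : 2 ≤ T) :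
    regret P I.𝒜 I.μ 1 I.σ I.sel I.init I.X I.Z T
      ≤ 2496 * (I.σ ^ 2 * d * Real.log (maxSize I.𝒜) / minGap I.𝒜 I.μ) * Real.log T
        + 4992 * (I.σ ^ 2 * d ^ 2 * maxSize I.𝒜 * Real.log (maxSize I.𝒜) / minGap I.𝒜 I.μ)
          * Real.log (Real.log T)
        + MvPolynomial.eval ![(maxSize I.𝒜 : ℝ), (d : ℝ), 1 / minGap I.𝒜 I.μ,
            maxGap I.𝒜 I.μ, I.σ] (remainder Setup.badConst 145) := by
  obtain ⟨a, ha, -⟩ := id hI.unique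
  have ha : I.IsOptimal a := ha
  have hD : 0 < minGap I.𝒜 I.μ := ha.minGap_pos hI.nontrivial hI.unique
  have hK : 2 ≤ Setup.badConst * I.size ^ 145 := by
    have h1 := Setup.two_le_badConst
    have h2 : 1 ≤ I.size ^ 145 := one_le_pow₀ (Setup.size_bounds hD hI.pos).1
    exact h1.trans (le_mul_of_one_le_right (by linarith) h2)
  rw [eval_remainder]
  exact hI.regret_le_logs hT hK rfl

end SemiBandit

theorem theorem1 :
    ∃ C C' : ℝ, 0 < C ∧ 0 < C' ∧ ∃ Q : MvPolynomial (Fin 5) ℝ,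
      ∀ (d : ℕ) (𝒜 : Finset (Finset (Fin d))) (μ : Fin d → ℝ) (σ : ℝ)
        (sel : (Fin d → ℝ) → Finset (Fin d)) (init : List (Finset (Fin d)))
        (Ω : Type*) [MeasurableSpace Ω] (P : Measure Ω) [IsProbabilityMeasure P]
        (X Z : ℕ → Ω → Fin d → ℝ) (T : ℕ),
        𝒜.Nontrivial → 2 ≤ SemiBandit.maxSize 𝒜 → SemiBandit.UniqueOptimal 𝒜 μ → 0 < σ →
        SemiBandit.IsArgmaxOracle 𝒜 sel → SemiBandit.IsInitialization 𝒜 init →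
        SemiBandit.IsRewardProcess P μ σ X → SemiBandit.IsGaussianProcess P Z →
        IndepFun (fun ω t => X t ω) (fun ω t => Z t ω) P → 2 ≤ T →
        SemiBandit.regret P 𝒜 μ 1 σ sel init X Z T
          ≤ C * (σ ^ 2 * d * Real.log (SemiBandit.maxSize 𝒜) / SemiBandit.minGap 𝒜 μ)
                * Real.log T
            + C' * (σ ^ 2 * d ^ 2 * SemiBandit.maxSize 𝒜 * Real.log (SemiBandit.maxSize 𝒜)
                / SemiBandit.minGap 𝒜 μ) * Real.log (Real.log T)
            + MvPolynomial.eval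
                ![(SemiBandit.maxSize 𝒜 : ℝ), (d : ℝ), 1 / SemiBandit.minGap 𝒜 μ,
                  SemiBandit.maxGap 𝒜 μ, σ] Q := by
  refine ⟨2496, 4992, by norm_num, by norm_num,
    SemiBandit.remainder SemiBandit.Setup.badConst 145, ?_⟩
  intro d 𝒜 μ σ sel init Ω _ P _ X Z T hn hm hu hσ hsel hinit hX hZ hXZ hT
  exact SemiBandit.Setup.IsValid.regret_le_remainder (I := ⟨𝒜, μ, σ, sel, init, X, Z⟩)
    ⟨hn, hm, hu, hσ, hsel, hinit, hX, hZ, hXZ⟩ hT
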